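/- Let $A$ be a discrete valuation ring with fraction field $K$, residue field $F$ and uniformizer $\pi$; put $S=\operatorname{Spec}A$, and for an $A$-scheme $X$ let $X_\eta=X\times_AK$ and $X_s=X\times_AF$. A quasi-projective $A$-scheme $X$ is called quasi-semistable if (1) $X$ is regular and flat over $A$; (2) for every closed point $x\in X_s$ whose residue field is separable over $F$, the completion of $\mathcal O_{X,x}$ is isomorphic as an $A$-algebra to $A'[[x_1,\dots,x_r,y_1,\dots,y_n]]/\langle \pi-u\,x_1^{e_1}\cdots x_r^{e_r}\rangle$ with $e_1,\dots,e_r\ge 1$, $u$ a unit of the power series ring, and $A'$ a local finite étale $A$-algebra (necessarily $A'=A$ if $x$ has residue field $F$); (3) the irreducible components of $X_{s,red}$ are smooth over $F$ and intersect transversally, i.e. for any distinct components $Y_{i_1},\dots,Y_{i_p}$, $p\geq 1$, the scheme-theoretic intersection $Y_{i_1,\dots,i_p}=Y_{i_1}\cap\dots\cap Y_{i_p}$ is smooth over $F$ and of pure codimension $p$ in $X$. It is called semistable if moreover $X_s$ is reduced. A hyperplane over $A$ is the closed subscheme $H\subset\mathbb P^N_A$ defined by a surjection $\varphi:A^{N+1}\to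 A^N$, i.e. by an equation $\sum a_ix_i=0$ with $a_i\in A$ not all divisible by $\pi$, where $\ker\varphi=A\cdot\sum a_ie_i$. For a subscheme $Z\subset\mathbb P^N$ write $Z\cdot H=Z\times_{\mathbb P^N}H$. If $Z$ is smooth over a field $L$, then $H$ and $Z$ intersect transversally in $\mathbb P^N_L$ if $Z\cdot H$ is smooth over $L$ and of pure codimension $1$ in $Z$. If $Z$ is only assumed regular, then $H$ and $Z$ intersect transversally if $Z\cdot H$ is regular and of pure codimension $1$ in $Z$. Let $X\subset\mathbb P^N_A$ be a quasi-semistable (resp. semistable) subscheme, let $Y_1,\dots,Y_M$ be the irreducible components of $X_{s,red}$, and let $H\subset\mathbb P^N_A$ be a hyperplane over $A$. Assume (i) $H_s$ and $Y_{i_1,\dots,i_p}$ intersect transversally in $\mathbb P^N_F$ (in the smooth sense) for all $i_1,\dots,i_p$; (ii) $H_\eta$ and $X_\eta$ intersect transversally in $\mathbb P^N_K$ (in the regular sense). Then $X$ and $H$ intersect transversally in $\mathbb P^N_A$ (in the regular sense), $X\cdot H$ is again quasi-semistable (resp. semistable), and $(X\cdot H)\cup X_{s,red}$ is a simple normal crossing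 divisor on $X$. If $X$ is proper over $A$, then (i) implies (ii). If in addition $X$ is semistable or $\operatorname{char}K=0$, then (i) also implies that $X_\eta\cdot H_\eta$ is smooth over $K$, so that $H_\eta$ and $X_\eta$ intersect transversally in the smooth sense. -/

import Mathlib

open CategoryTheory CategoryTheory.Limits AlgebraicGeometry

universe u

noncomputable section

namespace Bertini

/-! ### Projective space and hyperplanes over a ring -/

/-- The grading of `A[x_0, …, x_{n-1}]` by degree. -/
abbrev grading (A : Type u) [CommRing A] (n : ℕ) : ℕ → Submodule A (MvPolynomial (Fin n) A) :=
  MvPolynomial.homogeneousSubmodule (Fin n) A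

instance gradedRing (A : Type u) [CommRing A] (n : ℕ) : GradedRing (grading A n) :=
  MvPolynomial.gradedAlgebra

/-- `Proj A[x_0, …, x_{n-1}]`; projective `N`-space is the case `n = N + 1`. -/
abbrev projOf (A : Type u) [CommRing A] (n : ℕ) : Scheme.{u} := Proj (grading A n)

/-- Projective `N`-space over `A`. -/
abbrev projSpace (A : Type u) [CommRing A] (N : ℕ) : Scheme.{u} := projOf A (N + 1)

/-- The structure morphism `ℙ^N_A ⟶ Spec A`. -/
def projStr (A : Type u) [CommRing A] (N : ℕ) : projSpace A N ⟶ Spec (.of A) :=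
  Proj.toSpecZero (grading A (N + 1)) ≫
    Spec.map (CommRingCat.ofHom (algebraMap A (grading A (N + 1) 0)))

section Hyperplane

variable {A : Type u} [CommRing A] {n m : ℕ}

/-- The homomorphism `Sym φ : A[x_0, …, x_{n-1}] → A[y_0, …, y_{m-1}]` induced by a linear map
`φ : A^n → A^m`; it sends `x_i` to `∑ j, φ(e_i)_j y_j`. -/
def symAlgHom (φ : (Fin n → A) →ₗ[A] (Fin m → A)) :
    MvPolynomial (Fin n) A →ₐ[A] MvPolynomial (Fin m) A :=
  MvPolynomial.aeval fun i => ∑ j, MvPolynomial.C (φ (Pi.single i 1) j) * MvPolynomial.X j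

theorem symAlgHom_isHomogeneous (φ : (Fin n → A) →ₗ[A] (Fin m → A)) {d : ℕ}
    {p : MvPolynomial (Fin n) A} (hp : p.IsHomogeneous d) : (symAlgHom φ p).IsHomogeneous d := by
  have h := hp.aeval (fun i => ∑ j, MvPolynomial.C (φ (Pi.single i 1) j) * MvPolynomial.X j)
    (n := 1) (fun i => MvPolynomial.IsHomogeneous.sum _ _ _ fun j _ => by
      simpa using (MvPolynomial.isHomogeneous_C (Fin m) (φ (Pi.single i 1) j)).mul
        (MvPolynomial.isHomogeneous_X A j))
  simpa [symAlgHom] using h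

/-- `Sym φ` as a homomorphism of graded rings. -/
def symHom (φ : (Fin n → A) →ₗ[A] (Fin m → A)) : grading A n →+*ᵍ grading A m where
  __ := (symAlgHom φ).toRingHom
  map_mem {_ _} h := symAlgHom_isHomogeneous φ h

theorem symHom_X_mem (φ : (Fin n → A) →ₗ[A] (Fin m → A)) (hφ : Function.Surjective φ)
    (j : Fin m) : (MvPolynomial.X j : MvPolynomial (Fin m) A) ∈
      (HomogeneousIdeal.irrelevant (grading A n)).toIdeal.map (symAlgHom φ) := by
  obtain ⟨v, hv⟩ := hφ (Pi.single j 1)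
  have hv' : v = ∑ i, v i • (Pi.single i (1 : A) : Fin n → A) := by
    ext k; simp [Finset.sum_apply, Pi.single_apply]
  have key : symAlgHom φ (∑ i, MvPolynomial.C (v i) * MvPolynomial.X i) = MvPolynomial.X j := by
    have h1 : ∀ k, ∑ i, v i * φ (Pi.single i 1) k = (Pi.single j 1 : Fin m → A) k := by
      intro k
      rw [← hv]
      conv_rhs => rw [hv']
      simp [map_sum, Finset.sum_apply]
    simp only [symAlgHom, map_sum, map_mul, MvPolynomial.aeval_X, MvPolynomial.algHom_C,
      MvPolynomial.algebraMap_eq, Finset.mul_sum]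
    rw [Finset.sum_comm]
    simp_rw [← mul_assoc, ← Finset.sum_mul, ← map_mul, ← map_sum, h1]
    rw [Finset.sum_eq_single j] <;> simp +contextual
  rw [← key]
  refine Ideal.mem_map_of_mem _ (Ideal.sum_mem _ fun i _ => Ideal.mul_mem_left _ _ ?_)
  exact HomogeneousIdeal.mem_irrelevant_of_mem (grading A n) (i := 1) Nat.one_pos
    (MvPolynomial.isHomogeneous_X A i)

theorem irrelevant_le_map_symHom (φ : (Fin n → A) →ₗ[A] (Fin m → A))
    (hφ : Function.Surjective φ) :
    HomogeneousIdeal.irrelevant (grading A m) ≤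
      (HomogeneousIdeal.irrelevant (grading A n)).map (symHom φ) := by
  have hX := symHom_X_mem φ hφ
  refine (HomogeneousIdeal.irrelevant_le _).mpr fun i hi p hp => ?_
  have hp : p.IsHomogeneous i := hp
  change p ∈ Ideal.map (symAlgHom φ) _
  rw [p.as_sum]
  refine Ideal.sum_mem _ fun d hd => ?_
  have hdeg := hp (MvPolynomial.mem_support_iff.mp hd)
  obtain ⟨j, hj⟩ : ∃ j, d j ≠ 0 := by
    by_contra! h
    have : d = 0 := Finsupp.ext h
    subst this
    simp at hdeg
    omega
  have : (MvPolynomial.monomial d (p.coeff d) : MvPolynomial (Fin m) A) =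
      MvPolynomial.monomial (d - Finsupp.single j 1) (p.coeff d) * MvPolynomial.X j := by
    rw [MvPolynomial.X, MvPolynomial.monomial_mul, mul_one, tsub_add_cancel_of_le]
    simpa [Nat.one_le_iff_ne_zero] using hj
  rw [this]
  exact Ideal.mul_mem_left _ _ (hX j)

/-- The inclusion into `ℙ^N_A` of the hyperplane attached to a surjection `φ : A^{N+1} → A^N`.
If `ker φ` is spanned by `∑ a_i e_i`, it is the closed subscheme with equation `∑ a_i x_i = 0`. -/
def hyperplane {N : ℕ} (φ : (Fin (N + 1) → A) →ₗ[A] (Fin N → A)) (hφ : Function.Surjective φ) :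
    projOf A N ⟶ projSpace A N :=
  Proj.map (symHom φ) (irrelevant_le_map_symHom φ hφ)

end Hyperplane

/-! ### Fibres -/

section Fibres

variable (A : Type u) [CommRing A] [IsDomain A] [IsDiscreteValuationRing A]

/-- The generic point `η = Spec K ⟶ Spec A`, `K` the fraction field. -/
abbrev genPt : Spec (.of (FractionRing A)) ⟶ Spec (.of A) :=
  Spec.map (CommRingCat.ofHom (algebraMap A (FractionRing A)))

/-- The closed point `s = Spec F ⟶ Spec A`, `F` the residue field. -/
abbrev closedPt : Spec (.of (IsLocalRing.ResidueField A)) ⟶ Spec (.of A) :=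
  Spec.map (CommRingCat.ofHom (IsLocalRing.residue A))

/-- The base change `X ×_S T ⟶ P ×_S T` of an `S`-morphism `i : X ⟶ P`. -/
abbrev baseChange {X P S T : Scheme.{u}} (i : X ⟶ P) (p : P ⟶ S) (t : T ⟶ S) :
    pullback (i ≫ p) t ⟶ pullback p t :=
  pullback.lift (pullback.fst (i ≫ p) t ≫ i) (pullback.snd (i ≫ p) t)
    (by rw [Category.assoc, pullback.condition])

end Fibres

/-! ### Regularity, codimension, transversality -/

/-- All local rings are regular. -/
def IsRegularScheme (X : Scheme.{u}) : Prop := ∀ x : X, IsRegularLocalRing (X.presheaf.stalk x)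

/-- For a closed immersion `j : Z ⟶ X`: every irreducible component of `Z` has codimension `c` in
`X`, that is, the local ring of `X` at its generic point has dimension `c`. -/
def HasPureCodim {Z X : Scheme.{u}} (j : Z ⟶ X) (c : ℕ) : Prop :=
  ∀ z : Z, closure {z} ∈ irreducibleComponents Z → ringKrullDim (X.presheaf.stalk (j z)) = c

/-- A hyperplane `h : H ⟶ P` meets `i : Z ⟶ P` transversally over a field `L`: the
scheme-theoretic intersection `Z ×_P H` is smooth over `L` and of pure codimension `1` in `Z`. -/
structure MeetsSmoothly {Z H P : Scheme.{u}} {L : Type u} [Field L] (i : Z ⟶ P) (h : H ⟶ P)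
    (p : P ⟶ Spec (.of L)) : Prop where
  smooth : Smooth (pullback.fst i h ≫ i ≫ p)
  codim : HasPureCodim (pullback.fst i h) 1

/-- The notion of transversality for schemes `Z` that are only assumed regular:
`Z ×_P H` is regular and of pure codimension `1` in `Z`. -/
structure MeetsRegularly {Z H P : Scheme.{u}} (i : Z ⟶ P) (h : H ⟶ P) : Prop where
  regular : IsRegularScheme (pullback i h)
  codim : HasPureCodim (pullback.fst i h) 1

/-- The ideal in the local ring at `x` generated by an ideal sheaf. -/
def stalkIdeal {X : Scheme.{u}} (D : X.IdealSheafData) (x : X) : Ideal (X.presheaf.stalk x) :=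
  ⨆ (U : X.affineOpens) (hx : x ∈ U.1), (D.ideal U).map (X.presheaf.germ U.1 x hx).hom

/-- The closed subscheme defined by `D` is a simple (= strict) normal crossing divisor on `X`: at
each of its points `x` the local ring of `X` is regular, and the ideal of `D` at `x` is generated
by the product of some members of a regular system of parameters of that (Zariski) local ring. -/
def IsSNCDivisor {X : Scheme.{u}} (D : X.IdealSheafData) : Prop :=
  ∀ x ∈ D.support, IsRegularLocalRing (X.presheaf.stalk x) ∧
    ∃ (d : ℕ) (t : Fin d → X.presheaf.stalk x)
      (J : Finset (Fin d)),
      ringKrullDim (X.presheaf.stalk x) = d ∧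
      Ideal.span (Set.range t) = IsLocalRing.maximalIdeal (X.presheaf.stalk x) ∧
      J.Nonempty ∧ stalkIdeal D x = Ideal.span {∏ j ∈ J, t j}

/-- The ideal sheaf of the scheme-theoretic intersection `Y_I` of the members `Y ∈ I`, each with
its reduced scheme structure. -/
def stratumIdeal (X : Scheme.{u}) (I : Finset (Set X)) : X.IdealSheafData :=
  ⨆ Y ∈ I, Scheme.IdealSheafData.vanishingIdeal ⟨closure Y, isClosed_closure⟩

/-- The scheme-theoretic intersection `Y_I`. -/
abbrev stratum (X : Scheme.{u}) (I : Finset (Set X)) : Scheme.{u} := (stratumIdeal X I).subscheme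

/-- The inclusion `Y_I ⟶ X`. -/
abbrev stratumι (X : Scheme.{u}) (I : Finset (Set X)) : stratum X I ⟶ X :=
  (stratumIdeal X I).subschemeι

/-! ### Quasi-semistable and semistable schemes -/

/-- The structure homomorphism `R → 𝒪_{X,x}` of a scheme over `Spec R`. -/
def toStalk {R : Type u} [CommRing R] {X : Scheme.{u}} (f : X ⟶ Spec (.of R)) (x : X) :
    R →+* X.presheaf.stalk x :=
  ((Scheme.ΓSpecIso (.of R)).inv ≫ f.appTop ≫ X.presheaf.germ ⊤ x trivial).hom

/-- The structure homomorphism `R → κ(x)` of a scheme over `Spec R`. -/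
def toResidue {R : Type u} [CommRing R] {X : Scheme.{u}} (f : X ⟶ Spec (.of R)) (x : X) :
    R →+* X.residueField x :=
  ((Scheme.ΓSpecIso (.of R)).inv ≫ f.appTop ≫ X.Γevaluation x).hom

/-- For a scheme over a field `L`: the extension `κ(x) / L` is separable (algebraic). -/
def HasSeparableResidueField {L : Type u} [Field L] {X : Scheme.{u}} (f : X ⟶ Spec (.of L))
    (x : X) : Prop :=
  letI := (toResidue f x).toAlgebra
  Algebra.IsSeparable L (X.residueField x)

/-- The ring `R[[x_1, …, x_r, y_1, …, y_n]] / (ϖ - u x_1^{e_1} ⋯ x_r^{e_r})`. -/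
abbrev ModelRing (R : Type u) [CommRing R] (ϖ : R) {r n : ℕ} (e : Fin r → ℕ)
    (v : MvPowerSeries (Fin r ⊕ Fin n) R) : Type u :=
  MvPowerSeries (Fin r ⊕ Fin n) R ⧸
    Ideal.span {MvPowerSeries.C ϖ - v * ∏ i, MvPowerSeries.X (Sum.inl i) ^ e i}

section QS

variable {A : Type u} [CommRing A] [IsDomain A] [IsDiscreteValuationRing A]

/-- The completion of `𝒪_{X,x}` is isomorphic, as an `A`-algebra, to
`A'[[x_1, …, x_r, y_1, …, y_n]] / (π - u x_1^{e_1} ⋯ x_r^{e_r})` with `π` a uniformizer of `A`, all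
`e_i ≥ 1`, `u` a unit, and `A'` a local finite étale `A`-algebra. The isomorphism forces the
residue field of `A'` to be `κ(x)`; if `κ(x)` is the residue field `F` of `A`, then `A' = A`. -/
def HasModelCompletion {X : Scheme.{u}} (f : X ⟶ Spec (.of A)) (x : X) : Prop :=
  ∃ (A' : Type u) (_ : CommRing A') (_ : Algebra A A'), IsLocalRing A' ∧ Module.Finite A A' ∧
    Algebra.Etale A A' ∧
  ∃ (π : A) (r n : ℕ) (e : Fin r → ℕ) (v : MvPowerSeries (Fin r ⊕ Fin n) A'),
    Irreducible π ∧ (∀ i, 1 ≤ e i) ∧ IsUnit v ∧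
  ∃ iso : AdicCompletion (IsLocalRing.maximalIdeal (X.presheaf.stalk x)) (X.presheaf.stalk x) ≃+*
      ModelRing A' (algebraMap A A' π) e v,
    ∀ a : A, iso (algebraMap (X.presheaf.stalk x) _ (toStalk f x a)) =
      Ideal.Quotient.mk _ (MvPowerSeries.C (algebraMap A A' a))

/-- An object of the category `𝒬𝒮`: a quasi-projective `A`-scheme `f : X ⟶ Spec A` that is regular
and flat over `A`, such that the completed local rings at the closed points `x` of `X_s` (with
`κ(x)` separable over `F`, so all of them if `F` is perfect) have the required form, and such that
the irreducible components of `X_{s,red}` are smooth over `F` and intersect transversally. At a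
closed point with inseparable residue field no isomorphism as in `HasModelCompletion` of
`A`-algebras can exist, and the condition on the components alone describes `X` there. -/
structure IsQuasiSemistable {X : Scheme.{u}} (f : X ⟶ Spec (.of A)) : Prop where
  quasiProjective : ∃ (N : ℕ) (i : X ⟶ projSpace A N), IsImmersion i ∧ i ≫ projStr A N = f
  regular : IsRegularScheme X
  flat : Flat f
  completion : ∀ x : (pullback f (closedPt A) : Scheme.{u}), IsClosed {x} →
    HasSeparableResidueField (pullback.snd f (closedPt A)) x →
    HasModelCompletion f (pullback.fst f (closedPt A) x)
  components : ∀ I : Finset (Set (pullback f (closedPt A) : Scheme.{u})), I.Nonempty →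
    (I : Set (Set (pullback f (closedPt A) : Scheme.{u}))) ⊆ irreducibleComponents _ →
    Smooth (stratumι (pullback f (closedPt A)) I ≫ pullback.snd f (closedPt A)) ∧
    HasPureCodim (stratumι (pullback f (closedPt A)) I ≫ pullback.fst f (closedPt A)) I.card

/-- An object of the category `𝒮`: an object of `𝒬𝒮` with reduced special fibre. -/
structure IsSemistable {X : Scheme.{u}} (f : X ⟶ Spec (.of A)) : Prop
    extends IsQuasiSemistable f where
  reduced : IsReduced (pullback f (closedPt A))

/-- The ideal sheaf of `X_{s,red}` in `X`. -/
def specialFibreRed {X : Scheme.{u}} (f : X ⟶ Spec (.of A)) : X.IdealSheafData :=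
  Scheme.IdealSheafData.vanishingIdeal
    ⟨closure (Set.range (pullback.fst f (closedPt A))), isClosed_closure⟩

end QS

end Bertini

end

/-! ### Parts of regular systems of parameters in a Noetherian local ring. -/

section RegularParameters

open IsLocalRing

variable {R : Type*} [CommRing R]

/-! The heart is a statement about the regular local ring R of X at a point x of the special fibre.
The components of X_s through x correspond to the minimal primes over π. Each component is regular
of codimension 1, so its prime is principal, say (t_k); their common intersection is regular of
codimension r, so t_1, …, t_r is part of a regular system of parameters
(`exists_parameters_of_mem_range`). Hypothesis (i), applied to the smallest stratum through x, says
that the local equation a of H becomes a regular parameter of R/(t_1, …, t_r). Hence t_1, …, t_r, a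
is again part of a regular system of parameters (`exists_parameters_of_meetsStrata`).

Near the special fibre the assertions on X·H follow from this. R/(a) is regular; π is a unit times a
monomial in the t_k, first in R and then in R/(a) (`IsPartRSP.exists_eq_unit_mul_prod_pow`); no t_k
lies in (a), so π stays nonzero and X·H is flat; the strata of X·H are locally those of X cut with
H; the divisor is given by a·t_1⋯t_r. The completion of R/(a) receives A' from the model at x. A
power series ring over A' then surjects onto it, and comparing dimensions identifies the kernel
(`exists_modelRing_equiv`).

On the generic fibre, an open subscheme of X, hypothesis (ii) says directly that H is cut out by a
regular parameter. If X is proper, every point of X·H specializes to the special fibre, where X·H is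
already known to be regular; regularity passes to localizations by Serre's theorem, proved here
through projective dimension (`IsRegularLocalRing.of_isLocalization_atPrime`). This makes (ii)
automatic.

Smoothness of the generic fibre of X·H in characteristic 0 is regularity over a perfect field. In
the semistable case π is a unit times t_1⋯t_r, and the Jacobian criterion applies: a local ring of
X·H is a quotient of a regular ring C smooth over A, and derivations of C dual to the parameters are
lifted from the smooth stratum in the special fibre. The relation π − τ_1⋯τ_r has derivative
−∏_{i≠k} τ_i along τ_k, which is invertible wherever π is
(`formallySmooth_localization_of_prod_eq`). -/

/-- `t` is a part of a regular system of parameters: it extends to a generating system of the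
maximal ideal with `dim R` members. -/
def IsPartRSP [IsLocalRing R] {ι : Type*} (t : ι → R) : Prop :=
  ∃ (k : ℕ) (s : Fin k → R), Ideal.span (Set.range t ∪ Set.range s) = maximalIdeal R ∧
    ringKrullDim R = ((Nat.card ι + k : ℕ) : WithBot ℕ∞)

/-- A basis of the image of I in the cotangent space is extended to a basis of the whole space. The
first vectors are lifted to elements of I, the others arbitrarily to m; Nakayama gives generation.
-/
theorem IsLocalRing.exists_generators_adapted [IsLocalRing R] [IsNoetherianRing R] (I : Ideal R)
    (hI : I ≤ maximalIdeal R) : ∃ (c k : ℕ) (u : Fin c → R) (s : Fin k → R), (∀ i, u i ∈ I) ∧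
      I ≤ Ideal.span (Set.range u) ⊔ maximalIdeal R ^ 2 ∧
      Ideal.span (Set.range u ∪ Set.range s) = maximalIdeal R ∧
      c + k = (maximalIdeal R).spanFinrank := by
  classical
  let κ := ResidueField R
  let V := CotangentSpace R
  let SI : Set V := {v | ∃ x : maximalIdeal R, (x : R) ∈ I ∧ (maximalIdeal R).toCotangent x = v}
  obtain ⟨b, hbs, hbspan, hbli⟩ := exists_linearIndependent κ SI
  have hbli' : LinearIndepOn κ id b := hbli
  let b' := hbli'.extend (Set.subset_univ b)
  have hbb' : b ⊆ b' := hbli'.subset_extend _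
  let B := Module.Basis.extend hbli'
  have hfin : b'.Finite := Module.Finite.finite_basis B
  have hcard : b'.ncard = Module.finrank κ V := by
    rw [Module.finrank_eq_nat_card_basis B]; rfl
  have hlift : ∀ v : V, ∃ x : maximalIdeal R, (maximalIdeal R).toCotangent x = v :=
    fun v => (maximalIdeal R).toCotangent_surjective v
  choose ℓ hℓ using hlift
  choose! μ hμI hμ using fun v (hv : v ∈ SI) => hv
  have hbfin : b.Finite := hfin.subset hbb'
  have := hbfin.to_subtype
  have hdfin : (b' \ b).Finite := hfin.subset Set.sdiff_subset
  have := hdfin.to_subtype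
  let eb := Finite.equivFin b
  let ed := Finite.equivFin ↥(b' \ b)
  refine ⟨Nat.card b, Nat.card ↥(b' \ b), fun i => (μ (eb.symm i) : R),
    fun i => (ℓ (ed.symm i) : R), fun i => hμI _ (hbs (eb.symm i).2), ?_, ?_, ?_⟩
  · intro x hx
    have hxm : x ∈ maximalIdeal R := hI hx
    have h1 : (maximalIdeal R).toCotangent ⟨x, hxm⟩ ∈ Submodule.span κ b := by
      rw [hbspan]; exact Submodule.subset_span ⟨⟨x, hxm⟩, hx, rfl⟩
    have h2 : (maximalIdeal R).toCotangent ⟨x, hxm⟩ ∈ Submodule.span R b := by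
      rw [← Submodule.restrictScalars_mem R, Submodule.restrictScalars_span] at h1
      · exact h1
      · exact Ideal.Quotient.mk_surjective
    have h3 : b = (maximalIdeal R).toCotangent '' (μ '' b) := by
      rw [Set.image_image]
      ext v
      constructor
      · intro hv; exact ⟨v, hv, hμ v (hbs hv)⟩
      · rintro ⟨w, hw, rfl⟩; simp only [hμ w (hbs hw)]; exact hw
    rw [h3, Submodule.span_image] at h2
    obtain ⟨y, hy, hyx⟩ := h2
    have h4 : (y : R) - x ∈ maximalIdeal R ^ 2 := (Ideal.toCotangent_eq _).1 hyx
    have h5 : (y : R) ∈ Ideal.span (Set.range fun i => (μ (eb.symm i) : R)) := by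
      have : (y : R) ∈ (Submodule.span R (μ '' b)).map (maximalIdeal R).subtype := ⟨y, hy, rfl⟩
      rw [Submodule.map_span] at this
      refine Ideal.span_mono ?_ this
      rintro _ ⟨_, ⟨v, hv, rfl⟩, rfl⟩
      exact ⟨eb ⟨v, hv⟩, by simp only [Equiv.symm_apply_apply]; rfl⟩
    have : x = y + -(y - x) := by ring
    rw [this]
    exact Submodule.add_mem_sup h5 (neg_mem h4)
  · have key : Submodule.span R ((μ '' b) ∪ (ℓ '' (b' \ b))) = (⊤ : Submodule R (maximalIdeal R)) := by
      rw [← CotangentSpace.span_image_eq_top_iff, Set.image_union, Set.image_image,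
        Set.image_image]
      have h1 : (fun x => (maximalIdeal R).toCotangent (μ x)) '' b = b := by
        ext v
        constructor
        · rintro ⟨w, hw, rfl⟩; simp only [hμ w (hbs hw)]; exact hw
        · intro hv; exact ⟨v, hv, hμ v (hbs hv)⟩
      have h2 : (fun x => (maximalIdeal R).toCotangent (ℓ x)) '' (b' \ b) = b' \ b := by
        simp [hℓ]
      rw [h1, h2, Set.union_sdiff_cancel hbb']
      have := B.span_eq
      simpa [B, b'] using this
    have h6 := congrArg (Submodule.map (maximalIdeal R).subtype) key
    rw [Submodule.map_span, Submodule.map_top, Submodule.range_subtype] at h6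
    refine Eq.trans ?_ h6
    congr 1
    rw [Set.image_union, Set.image_image, Set.image_image]
    congr 1
    · ext x
      constructor
      · rintro ⟨i, rfl⟩; exact ⟨_, (eb.symm i).2, rfl⟩
      · rintro ⟨v, hv, rfl⟩; exact ⟨eb ⟨v, hv⟩, by simp only [Equiv.symm_apply_apply]; rfl⟩
    · ext x
      constructor
      · rintro ⟨i, rfl⟩; exact ⟨_, (ed.symm i).2, rfl⟩
      · rintro ⟨v, hv, rfl⟩; exact ⟨ed ⟨v, hv⟩, by simp only [Equiv.symm_apply_apply]; rfl⟩
  · rw [spanFinrank_maximalIdeal_eq_finrank_cotangentSpace, ← hcard, Nat.card_coe_set_eq,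
      Nat.card_coe_set_eq, add_comm]
    exact Set.ncard_sdiff_add_ncard_of_subset hbb' hfin

theorem IsLocalRing.spanFinrank_maximalIdeal_le_of_span_eq [IsLocalRing R] {ι : Type*} [Finite ι]
    (t : ι → R) (h : Ideal.span (Set.range t) = maximalIdeal R) :
    (maximalIdeal R).spanFinrank ≤ Nat.card ι := by
  rw [← h]
  refine (Submodule.spanFinrank_span_le_ncard_of_finite (Set.finite_range t)).trans ?_
  rw [← Set.image_univ, ← Set.ncard_univ]
  exact Set.ncard_image_le Set.finite_univ

theorem IsLocalRing.exists_fin_span_eq_maximalIdeal [IsLocalRing R] [IsNoetherianRing R] :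
    ∃ s : Fin (maximalIdeal R).spanFinrank → R, Ideal.span (Set.range s) = maximalIdeal R := by
  have hfg : (maximalIdeal R).FG := (maximalIdeal R).fg_of_isNoetherianRing
  have h1 := Submodule.FG.generators_ncard hfg
  have h2 := Submodule.FG.finite_generators hfg
  have := h2.to_subtype
  let e := Finite.equivFinOfCardEq ((Nat.card_coe_set_eq _).trans h1)
  refine ⟨fun i => (e.symm i : R), ?_⟩
  conv_rhs => rw [← (maximalIdeal R).span_generators]
  congr 1
  ext x
  constructor
  · rintro ⟨i, rfl⟩; exact (e.symm i).2
  · intro hx; exact ⟨e ⟨x, hx⟩, by simp⟩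

theorem IsLocalRing.exists_ringKrullDim_eq_natCast (S : Type*) [CommRing S] [IsLocalRing S]
    [IsNoetherianRing S] : ∃ n : ℕ, ringKrullDim S = n := by
  have h := ringKrullDim_le_spanFinrank_maximalIdeal S
  have hne : ringKrullDim S ≠ ⊥ := ringKrullDim_ne_bot
  revert h hne
  generalize ringKrullDim S = x
  induction x with
  | bot => simp
  | coe x =>
    induction x with
    | top =>
      intro h
      have h' : (⊤ : ℕ∞) ≤ (((maximalIdeal S).spanFinrank : ℕ) : ℕ∞) := WithBot.coe_le_coe.1 h
      exact absurd (top_le_iff.1 h') (ENat.natCast_ne_top _)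
    | coe x => intro _ _; exact ⟨x, rfl⟩

theorem IsRegularLocalRing.exists_ringKrullDim_eq (R : Type*) [CommRing R]
    [IsRegularLocalRing R] :
    ∃ d : ℕ, ringKrullDim R = d ∧ (maximalIdeal R).spanFinrank = d :=
  ⟨_, ((isRegularLocalRing_iff R).1 inferInstance).symm, rfl⟩

/-- Quotients of a local ring by `I` and the number of generators of the maximal ideals. -/
theorem IsLocalRing.spanFinrank_le_add_of_surjective [IsLocalRing R] [IsNoetherianRing R]
    {S : Type*} [CommRing S] [IsLocalRing S] (φ : R →+* S) (hφ : Function.Surjective φ)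
    {c : ℕ} (u : Fin c → R) (hu : ∀ i, u i ∈ RingHom.ker φ)
    (hker : RingHom.ker φ ≤ Ideal.span (Set.range u) ⊔ maximalIdeal R ^ 2) :
    (maximalIdeal R).spanFinrank ≤ c + (maximalIdeal S).spanFinrank := by
  have : IsNoetherianRing S := isNoetherianRing_of_surjective R S φ hφ
  have hloc : IsLocalHom φ := hφ.isLocalHom
  obtain ⟨s, hs⟩ := IsLocalRing.exists_fin_span_eq_maximalIdeal (R := S)
  choose s' hs' using fun i => hφ (s i)
  have hm : (maximalIdeal S).comap φ = maximalIdeal R := maximalIdeal_comap φ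
  have hle : Ideal.span (Set.range (Sum.elim u s')) ≤ maximalIdeal R := by
    rw [Ideal.span_le]
    rintro _ ⟨i | i, rfl⟩
    · change u i ∈ maximalIdeal R
      rw [← hm, Ideal.mem_comap, (RingHom.mem_ker).1 (hu i)]
      exact zero_mem _
    · change s' i ∈ maximalIdeal R
      rw [← hm, Ideal.mem_comap, hs', ← hs]
      exact Ideal.subset_span ⟨i, rfl⟩
  have hge : maximalIdeal R ≤ Ideal.span (Set.range (Sum.elim u s')) ⊔
      maximalIdeal R • maximalIdeal R := by
    intro x hx
    rw [← hm, Ideal.mem_comap, ← hs] at hx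
    have h1 : φ x ∈ (Ideal.span (Set.range s')).map φ := by
      rw [Ideal.map_span]
      refine Ideal.span_mono ?_ hx
      rintro _ ⟨i, rfl⟩
      exact ⟨s' i, ⟨i, rfl⟩, hs' i⟩
    obtain ⟨y, hy, hyx⟩ := (Ideal.mem_map_iff_of_surjective φ hφ).1 h1
    have h2 : x - y ∈ RingHom.ker φ := by rw [RingHom.mem_ker, map_sub, hyx, sub_self]
    have h3 := hker h2
    rw [Set.Sum.elim_range, Ideal.span_union, smul_eq_mul, ← pow_two]
    have : x = (x - y) + y := by ring
    rw [this]
    have h4 : Ideal.span (Set.range u) ⊔ maximalIdeal R ^ 2 ≤ Ideal.span (Set.range u) ⊔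
        Ideal.span (Set.range s') ⊔ maximalIdeal R ^ 2 := sup_le_sup_right le_sup_left _
    refine add_mem (h4 h3) (Ideal.mem_sup_left (Ideal.mem_sup_right hy))
  have heq : Ideal.span (Set.range (Sum.elim u s')) = maximalIdeal R := by
    refine le_antisymm hle ?_
    exact Submodule.le_of_le_smul_of_le_jacobson_bot (maximalIdeal R).fg_of_isNoetherianRing
      (maximalIdeal_le_jacobson _) hge
  refine (IsLocalRing.spanFinrank_maximalIdeal_le_of_span_eq _ heq).trans ?_
  simp

theorem IsPartRSP.isRegularLocalRing [IsLocalRing R] [IsNoetherianRing R] {ι : Type*} [Finite ι]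
    {t : ι → R} (h : IsPartRSP t) : IsRegularLocalRing R := by
  obtain ⟨k, s, hs, hd⟩ := h
  refine IsRegularLocalRing.of_spanFinrank_maximalIdeal_le R ?_
  rw [hd]
  rw [← Set.Sum.elim_range] at hs
  have := IsLocalRing.spanFinrank_maximalIdeal_le_of_span_eq _ hs
  rw [Nat.card_sum, Nat.card_fin] at this
  exact_mod_cast this

theorem IsPartRSP.mem [IsLocalRing R] {ι : Type*} {t : ι → R} (h : IsPartRSP t) (i : ι) :
    t i ∈ maximalIdeal R := by
  obtain ⟨k, s, hs, -⟩ := h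
  rw [← hs]
  exact Ideal.subset_span (Or.inl ⟨i, rfl⟩)

theorem ringKrullDim_le_add_of_surjective [IsLocalRing R] [IsNoetherianRing R]
    {S : Type*} [CommRing S] (φ : R →+* S) (hφ : Function.Surjective φ) {ι : Type*} [Finite ι]
    (t : ι → R) (ht : ∀ i, t i ∈ maximalIdeal R) (hker : RingHom.ker φ = Ideal.span (Set.range t)) :
    ringKrullDim R ≤ ringKrullDim S + (Nat.card ι : ℕ) := by
  let e : R ⧸ Ideal.span (Set.range t) ≃+* S :=
    (Ideal.quotEquivOfEq hker.symm).trans (RingHom.quotientKerEquivOfSurjective hφ)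
  rw [← ringKrullDim_eq_of_ringEquiv e]
  refine (ringKrullDim_le_ringKrullDim_quotient_add_spanFinrank (Ideal.span (Set.range t))
    ?_).trans ?_
  · rw [IsLocalRing.ringJacobson_eq_maximalIdeal, Ideal.span_le]
    rintro _ ⟨i, rfl⟩; exact ht i
  · gcongr
    refine Nat.cast_le.2 ?_
    refine (Submodule.spanFinrank_span_le_ncard_of_finite (Set.finite_range t)).trans ?_
    have h := Set.ncard_image_le (f := t) (Set.finite_univ (α := ι))
    rwa [Set.image_univ, Set.ncard_univ] at h

/-- Quotients by parts of a regular system of parameters. -/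
theorem IsPartRSP.of_surjective [IsLocalRing R] [IsNoetherianRing R] {S : Type*} [CommRing S]
    [IsLocalRing S] {ι κ : Type*} [Finite ι] [Finite κ] {f : κ → R} {t : ι → R}
    (h : IsPartRSP (Sum.elim f t)) (φ : R →+* S) (hφ : Function.Surjective φ)
    (hker : RingHom.ker φ = Ideal.span (Set.range f)) :
    IsPartRSP (φ ∘ t) ∧ ringKrullDim R = ringKrullDim S + (Nat.card κ : ℕ) := by
  have : IsNoetherianRing S := isNoetherianRing_of_surjective R S φ hφ
  have hloc : IsLocalHom φ := hφ.isLocalHom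
  have hmem := h.mem
  obtain ⟨k, s, hs, hd⟩ := h
  have hspan : Ideal.span (Set.range (φ ∘ t) ∪ Set.range (φ ∘ s)) = maximalIdeal S := by
    have h1 : (maximalIdeal R).map φ = maximalIdeal S := by
      rw [← maximalIdeal_comap φ, Ideal.map_comap_of_surjective φ hφ]
    rw [← h1, ← hs, Ideal.map_span, Set.image_union, Set.Sum.elim_range, Set.image_union,
      Set.union_assoc, Ideal.span_union (φ '' Set.range f)]
    rw [← Set.range_comp, ← Set.range_comp, ← Set.range_comp]
    have h2 : Ideal.span (Set.range (φ ∘ f)) = ⊥ := by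
      rw [Ideal.span_eq_bot]
      rintro _ ⟨i, rfl⟩
      have : f i ∈ RingHom.ker φ := by rw [hker]; exact Ideal.subset_span ⟨i, rfl⟩
      exact this
    rw [h2, bot_sup_eq]
  have hle := ringKrullDim_le_add_of_surjective φ hφ f (fun i => hmem (Sum.inl i)) hker
  rw [← Set.Sum.elim_range] at hspan
  have h3 := IsLocalRing.spanFinrank_maximalIdeal_le_of_span_eq _ hspan
  have h4 := ringKrullDim_le_spanFinrank_maximalIdeal S
  rw [Nat.card_sum, Nat.card_fin] at h3
  have h5 : ringKrullDim S ≤ ((Nat.card ι + k : ℕ) : WithBot ℕ∞) :=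
    h4.trans (by exact_mod_cast h3)
  rw [hd, Nat.card_sum] at hle
  obtain ⟨n, hn⟩ := IsLocalRing.exists_ringKrullDim_eq_natCast S
  rw [hn] at hle h5
  have h6 : Nat.card κ + Nat.card ι + k ≤ n + Nat.card κ := by exact_mod_cast hle
  have h7 : n ≤ Nat.card ι + k := by exact_mod_cast h5
  have h8 : n = Nat.card ι + k := by omega
  refine ⟨⟨k, φ ∘ s, by rw [← hspan, Set.Sum.elim_range], by rw [hn, h8]⟩, ?_⟩
  rw [hd, hn, h8, Nat.card_sum]
  push_cast
  ring

/-- Lifts of generators of the maximal ideal of S together with f generate that of R. The bound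
opposite to `hd` always holds, so the number of generators is exactly the dimension. -/
theorem IsPartRSP.of_surjective_of_ringKrullDim [IsLocalRing R] [IsNoetherianRing R] {S : Type*}
    [CommRing S] [IsLocalRing S] {ι κ : Type*} [Finite ι] [Finite κ] {f : κ → R} {t : ι → R}
    (φ : R →+* S) (hφ : Function.Surjective φ) (hker : RingHom.ker φ = Ideal.span (Set.range f))
    (h : IsPartRSP (φ ∘ t)) (hd : ringKrullDim S + (Nat.card κ : ℕ) ≤ ringKrullDim R) :
    IsPartRSP (Sum.elim f t) := by
  have hloc : IsLocalHom φ := hφ.isLocalHom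
  have hm : (maximalIdeal S).comap φ = maximalIdeal R := maximalIdeal_comap φ
  have hfm : ∀ i, f i ∈ maximalIdeal R := fun i => by
    have : f i ∈ RingHom.ker φ := by rw [hker]; exact Ideal.subset_span ⟨i, rfl⟩
    rw [← hm, Ideal.mem_comap, (RingHom.mem_ker).1 this]
    exact zero_mem _
  have hle := ringKrullDim_le_add_of_surjective φ hφ f hfm hker
  have hdim := le_antisymm hle hd
  obtain ⟨k, s, hs, hsd⟩ := h
  choose s' hs' using fun i => hφ (s i)
  refine ⟨k, s', ?_, ?_⟩
  · rw [← hm, ← hs]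
    have h1 : Ideal.span (Set.range (φ ∘ t) ∪ Set.range s) =
        (Ideal.span (Set.range t ∪ Set.range s')).map φ := by
      rw [Ideal.map_span, Set.image_union, ← Set.range_comp, ← Set.range_comp]
      congr 3
      ext i; exact (hs' i).symm
    rw [h1, Ideal.comap_map_of_surjective' φ hφ, hker, Set.Sum.elim_range, Set.union_assoc,
      Ideal.span_union (Set.range f), sup_comm]
  · rw [hdim, hsd, Nat.card_sum]
    push_cast; ring

theorem IsPartRSP.of_isRegularLocalRing [IsRegularLocalRing R] {ι : Type*} [IsEmpty ι]
    (t : ι → R) : IsPartRSP t := by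
  obtain ⟨d, hd, hd'⟩ := IsRegularLocalRing.exists_ringKrullDim_eq R
  obtain ⟨s, hs⟩ := IsLocalRing.exists_fin_span_eq_maximalIdeal (R := R)
  refine ⟨_, s, by rw [Set.range_eq_empty, Set.empty_union, hs], ?_⟩
  rw [hd, hd', Nat.card_of_isEmpty, zero_add]

theorem IsPartRSP.comp_equiv [IsLocalRing R] {ι κ : Type*} {t : ι → R} (h : IsPartRSP t)
    (e : κ ≃ ι) : IsPartRSP (t ∘ e) := by
  obtain ⟨k, s, hs, hd⟩ := h
  exact ⟨k, s, by rw [EquivLike.range_comp, hs], by rw [Nat.card_congr e, hd]⟩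

theorem IsPartRSP.inl [IsLocalRing R] {ι κ : Type*} [Finite ι] [Finite κ] {f : κ → R} {t : ι → R}
    (h : IsPartRSP (Sum.elim f t)) : IsPartRSP f := by
  obtain ⟨k, s, hs, hd⟩ := h
  let e := Finite.equivFin ι
  refine ⟨Nat.card ι + k, Sum.elim (t ∘ e.symm) s ∘ finSumFinEquiv.symm, ?_, ?_⟩
  · rw [EquivLike.range_comp, ← hs, Set.Sum.elim_range, Set.Sum.elim_range,
      EquivLike.range_comp, Set.union_assoc]
  · rw [hd, Nat.card_sum, add_assoc]

theorem IsPartRSP.inr [IsLocalRing R] {ι κ : Type*} [Finite ι] [Finite κ] {f : κ → R} {t : ι → R}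
    (h : IsPartRSP (Sum.elim f t)) : IsPartRSP t := by
  have := h.comp_equiv (Equiv.sumComm ι κ)
  have e : Sum.elim f t ∘ Equiv.sumComm ι κ = Sum.elim t f := by ext (i | i) <;> rfl
  rw [e] at this
  exact this.inl

theorem IsPartRSP.restrict [IsLocalRing R] {ι : Type*} [Finite ι] {t : ι → R} (h : IsPartRSP t)
    (p : ι → Prop) : IsPartRSP (Sum.elim (fun i : {i // p i} => t i) (fun i : {i // ¬ p i} => t i)) := by
  classical
  have := h.comp_equiv (Equiv.sumCompl p)
  convert this using 1
  ext (i | i) <;> rfl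

/-- Generators adapted to (x) contain at least one element of (x), since x is not in m². All
elements of that kind may be replaced by x alone, and minimality of the number of generators forces
there to have been just one. -/
theorem isPartRSP_of_mem_of_notMem_sq [IsRegularLocalRing R] {x : R} (hx : x ∈ maximalIdeal R)
    (hx2 : x ∉ maximalIdeal R ^ 2) : IsPartRSP (fun _ : Unit => x) := by
  obtain ⟨d, hd, hd'⟩ := IsRegularLocalRing.exists_ringKrullDim_eq R
  obtain ⟨c, k, u, s, huI, hIu, hspan, hck⟩ :=
    IsLocalRing.exists_generators_adapted (Ideal.span {x}) ((Ideal.span_singleton_le_iff_mem _).2 hx)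
  have hc : c ≠ 0 := by
    rintro rfl
    apply hx2
    have := hIu (Ideal.mem_span_singleton_self x)
    rwa [Set.range_eq_empty, Ideal.span_empty, bot_sup_eq] at this
  have hspan' : Ideal.span (Set.range (Sum.elim (fun _ : Unit => x) s)) = maximalIdeal R := by
    rw [Set.Sum.elim_range, Ideal.span_union]
    apply le_antisymm
    · rw [sup_le_iff]
      refine ⟨?_, ?_⟩
      · rw [Ideal.span_le]; rintro _ ⟨i, rfl⟩; exact hx
      · rw [← hspan]; exact Ideal.span_mono Set.subset_union_right
    · rw [← hspan, Ideal.span_union]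
      refine sup_le_sup_right ?_ _
      rw [Ideal.span_le]
      rintro _ ⟨i, rfl⟩
      have := huI i
      rwa [Set.range_const]
  have h2 := IsLocalRing.spanFinrank_maximalIdeal_le_of_span_eq _ hspan'
  rw [Nat.card_sum, Nat.card_unique, Nat.card_fin] at h2
  refine ⟨k, s, by rw [← Set.Sum.elim_range, hspan'], ?_⟩
  rw [hd, Nat.card_unique]
  congr 1
  omega

/-- Induction on the dimension. Take x in m outside m² and outside all minimal primes. The quotient
by x is regular of smaller dimension, so (x) is prime and contains a minimal prime q; as x is not in
q, q = xq, and q vanishes by Nakayama. -/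
theorem IsRegularLocalRing.isDomain_aux (d : ℕ) : ∀ (R : Type u) [CommRing R]
    [IsRegularLocalRing R], ringKrullDim R = d → IsDomain R := by
  induction d with
  | zero =>
    intro R _ _ hd
    obtain ⟨d', hd', hs⟩ := IsRegularLocalRing.exists_ringKrullDim_eq R
    rw [hd] at hd'
    have : d' = 0 := by exact_mod_cast hd'.symm
    rw [this, Submodule.spanFinrank_eq_zero_iff_eq_bot (Ideal.fg_of_isNoetherianRing _)] at hs
    exact (isField_iff_maximalIdeal_eq.2 hs).isDomain
  | succ d ih =>
    intro R _ _ hd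
    have hnb : maximalIdeal R ≠ ⊥ := by
      intro h
      have := ringKrullDim_eq_zero_of_isField (isField_iff_maximalIdeal_eq.2 h)
      rw [hd] at this
      exact absurd this (by exact_mod_cast Nat.succ_ne_zero d)
    obtain ⟨x, hxm, hx2, hxmin⟩ : ∃ x ∈ maximalIdeal R, x ∉ maximalIdeal R ^ 2 ∧
        ∀ p ∈ minimalPrimes R, x ∉ p := by
      by_contra! hcon
      have hfin := minimalPrimes.finite_of_isNoetherianRing R
      classical
      have hsub : ((maximalIdeal R : Ideal R) : Set R) ⊆
          ⋃ i ∈ (↑(insert (maximalIdeal R ^ 2) hfin.toFinset) : Set (Ideal R)), (i : Set R) := by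
        intro x hx
        by_cases h : x ∈ maximalIdeal R ^ 2
        · exact Set.mem_biUnion (by simp) h
        · obtain ⟨p, hp, hxp⟩ := hcon x hx h
          exact Set.mem_biUnion (by simp [hp]) hxp
      -- Prime avoidance tolerates two ideals that need not be prime. Only m² needs this exemption,
      -- so it fills both places.
      rw [Ideal.subset_union_prime (maximalIdeal R ^ 2) (maximalIdeal R ^ 2)] at hsub
      · obtain ⟨p, hp, hle⟩ := hsub
        rw [Finset.mem_insert, Set.Finite.mem_toFinset] at hp
        rcases hp with rfl | hp
        · apply hnb
          refine Submodule.eq_bot_of_le_smul_of_le_jacobson_bot (maximalIdeal R) _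
            (Ideal.fg_of_isNoetherianRing _) ?_ (maximalIdeal_le_jacobson _)
          rwa [smul_eq_mul, ← pow_two]
        · have hprime : p.IsPrime := hp.1.1
          have heq : p = maximalIdeal R := le_antisymm (le_maximalIdeal hprime.ne_top) hle
          have h0 := Ideal.height_eq_zero_iff.2 hp
          rw [heq] at h0
          have h1 := IsLocalRing.maximalIdeal_height_eq_ringKrullDim (R := R)
          rw [h0, hd] at h1
          exact absurd h1.symm (by exact_mod_cast Nat.succ_ne_zero d)
      · intro i hi h1 _
        rw [Finset.mem_insert, Set.Finite.mem_toFinset] at hi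
        exact (hi.resolve_left h1).1.1
    have hP := isPartRSP_of_mem_of_notMem_sq hxm hx2
    have hP' : IsPartRSP (Sum.elim (fun _ : Unit => x) (Empty.elim : Empty → R)) := by
      have := hP.comp_equiv (Equiv.sumEmpty Unit Empty)
      convert this using 1
      ext (i | i) <;> [rfl; exact i.elim]
    have hne : Ideal.span {x} ≠ ⊤ := ne_top_of_le_ne_top (maximalIdeal.isMaximal R).ne_top
      ((Ideal.span_singleton_le_iff_mem _).2 hxm)
    have := Ideal.Quotient.nontrivial_iff.2 hne
    have hloc : IsLocalRing (R ⧸ Ideal.span {x}) :=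
      .of_surjective' (Ideal.Quotient.mk _) Ideal.Quotient.mk_surjective
    obtain ⟨h1, h2⟩ := hP'.of_surjective (Ideal.Quotient.mk (Ideal.span {x}))
      Ideal.Quotient.mk_surjective (by rw [Ideal.mk_ker, Set.range_const])
    have hreg := h1.isRegularLocalRing
    obtain ⟨n, hn⟩ := IsLocalRing.exists_ringKrullDim_eq_natCast (R ⧸ Ideal.span {x})
    have hdn : n = d := by
      rw [hd, hn, Nat.card_unique] at h2
      have : d + 1 = n + 1 := by exact_mod_cast h2
      omega
    have hdom := ih (R ⧸ Ideal.span {x}) (by rw [hn, hdn])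
    have hprime : (Ideal.span {x}).IsPrime := (Ideal.Quotient.isDomain_iff_prime _).1 hdom
    obtain ⟨q, hq, hqx⟩ := Ideal.exists_minimalPrimes_le (I := ⊥) (J := Ideal.span {x}) bot_le
    have hqp : q.IsPrime := hq.1.1
    have hxq := hxmin q hq
    have hq0 : q = ⊥ := by
      refine Submodule.eq_bot_of_le_smul_of_le_jacobson_bot (maximalIdeal R) _
        (Ideal.fg_of_isNoetherianRing _) ?_ (maximalIdeal_le_jacobson _)
      intro y hy
      -- Here y = ax lies in q and x does not, so a lies in q and y in mq.
      obtain ⟨a, rfl⟩ := Ideal.mem_span_singleton'.1 (hqx hy)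
      rw [mul_comm]
      exact Submodule.smul_mem_smul hxm ((hqp.mem_or_mem hy).resolve_right hxq)
    rw [hq0] at hqp
    exact IsDomain.of_bot_isPrime R

/-- A regular local ring is a domain. -/
theorem IsRegularLocalRing.isDomain (R : Type u) [CommRing R] [IsRegularLocalRing R] :
    IsDomain R :=
  have ⟨d, hd, _⟩ := IsRegularLocalRing.exists_ringKrullDim_eq R
  IsRegularLocalRing.isDomain_aux d R hd

theorem IsPartRSP.quotient [IsLocalRing R] [IsNoetherianRing R] {ι κ : Type*} [Finite ι]
    [Finite κ] {f : κ → R} {t : ι → R} (h : IsPartRSP (Sum.elim f t)) :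
    ∃ (_ : IsLocalRing (R ⧸ Ideal.span (Set.range f))),
      IsPartRSP (Ideal.Quotient.mk (Ideal.span (Set.range f)) ∘ t) ∧
      ringKrullDim R = ringKrullDim (R ⧸ Ideal.span (Set.range f)) + (Nat.card κ : ℕ) := by
  have hne : Ideal.span (Set.range f) ≠ ⊤ := by
    refine ne_top_of_le_ne_top (maximalIdeal.isMaximal R).ne_top (Ideal.span_le.2 ?_)
    rintro _ ⟨i, rfl⟩
    exact h.mem (Sum.inl i)
  have := Ideal.Quotient.nontrivial_iff.2 hne
  have hloc : IsLocalRing (R ⧸ Ideal.span (Set.range f)) :=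
    .of_surjective' (Ideal.Quotient.mk _) Ideal.Quotient.mk_surjective
  exact ⟨hloc, h.of_surjective _ Ideal.Quotient.mk_surjective Ideal.mk_ker⟩

theorem IsPartRSP.sumEmpty [IsLocalRing R] {ι : Type*} {t : ι → R} (h : IsPartRSP t) :
    IsPartRSP (Sum.elim t (Empty.elim : Empty → R)) := by
  have := h.comp_equiv (Equiv.sumEmpty ι Empty)
  convert this using 1
  ext (i | i) <;> [rfl; exact i.elim]

/-- The quotient is again regular, hence a domain. -/
theorem IsPartRSP.isPrime_span [IsLocalRing R] [IsNoetherianRing R] {ι : Type*}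
    [Finite ι] {t : ι → R} (h : IsPartRSP t) : (Ideal.span (Set.range t)).IsPrime := by
  obtain ⟨h1, h2, -⟩ := h.sumEmpty.quotient
  have := h2.isRegularLocalRing
  have := IsRegularLocalRing.isDomain (R ⧸ Ideal.span (Set.range t))
  exact (Ideal.Quotient.isDomain_iff_prime _).1 this

theorem IsPartRSP.isPrime_span_image [IsLocalRing R] [IsNoetherianRing R] {ι : Type*}
    [Finite ι] {t : ι → R} (h : IsPartRSP t) (J : Set ι) : (Ideal.span (t '' J)).IsPrime := by
  have := (h.restrict (· ∈ J)).inl.isPrime_span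
  convert this
  ext x; simp

theorem IsPartRSP.ringKrullDim_image [IsLocalRing R] [IsNoetherianRing R] {ι : Type*}
    [Finite ι] {t : ι → R} (h : IsPartRSP t) (J : Set ι) :
    ringKrullDim R = ringKrullDim (R ⧸ Ideal.span (t '' J)) + (J.ncard : ℕ) := by
  obtain ⟨_, -, h2⟩ := (h.restrict (· ∈ J)).quotient
  have : Set.range (fun i : {i // i ∈ J} => t i) = t '' J := by ext x; simp
  rw [h2, ← Nat.card_coe_set_eq, this]

/-- Otherwise adding i to J would leave the ideal unchanged while the dimension of the quotient
drops by one. -/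
theorem IsPartRSP.notMem_span_image [IsLocalRing R] [IsNoetherianRing R] {ι : Type*}
    [Finite ι] {t : ι → R} (h : IsPartRSP t) {J : Set ι} {i : ι} (hi : i ∉ J) :
    t i ∉ Ideal.span (t '' J) := by
  intro hmem
  have h1 := h.ringKrullDim_image J
  have h2 := h.ringKrullDim_image (insert i J)
  rw [Set.image_insert_eq, Ideal.span_insert,
    sup_eq_right.2 ((Ideal.span_singleton_le_iff_mem _).2 hmem),
    Set.ncard_insert_of_notMem hi (Set.toFinite J)] at h2
  have := h.isRegularLocalRing
  have hprime := h.isPrime_span_image J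
  have hloc : IsLocalRing (R ⧸ Ideal.span (t '' J)) :=
    .of_surjective' (Ideal.Quotient.mk _) Ideal.Quotient.mk_surjective
  obtain ⟨n, hn⟩ := IsLocalRing.exists_ringKrullDim_eq_natCast (R ⧸ Ideal.span (t '' J))
  rw [hn] at h1 h2
  rw [h1] at h2
  have : n + J.ncard = n + (J.ncard + 1) := by exact_mod_cast h2
  omega

/-- Krull's height theorem bounds the height above. Adjoining the parameters one at a time gives a
strictly increasing chain of primes, which bounds it below. -/
theorem IsPartRSP.height_span_image [IsLocalRing R] [IsNoetherianRing R] {ι : Type*}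
    [Finite ι] {t : ι → R} (h : IsPartRSP t) (J : Finset ι) :
    (Ideal.span (t '' (J : Set ι))).height = J.card := by
  classical
  apply le_antisymm
  · refine (Ideal.height_le_spanFinrank _ (h.isPrime_span_image _).ne_top).trans ?_
    have := Submodule.spanFinrank_span_le_ncard_of_finite (R := R) ((J.finite_toSet).image t)
    refine (Nat.cast_le.2 (this.trans (Set.ncard_image_le J.finite_toSet))).trans ?_
    rw [Set.ncard_coe_finset]
  · induction J using Finset.induction_on with
    | empty => simp
    | insert a J ha ih =>
      have hp1 := h.isPrime_span_image (J : Set ι)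
      have hp2 := h.isPrime_span_image ((insert a J : Finset ι) : Set ι)
      have hlt : Ideal.span (t '' (J : Set ι)) <
          Ideal.span (t '' ((insert a J : Finset ι) : Set ι)) := by
        refine lt_of_le_of_ne (Ideal.span_mono (Set.image_mono (by simp))) fun heq => ?_
        refine h.notMem_span_image (J := (J : Set ι)) (i := a) (by simpa using ha) ?_
        rw [heq]
        exact Ideal.subset_span ⟨a, by simp, rfl⟩
      have := Ideal.height_add_one_le_of_lt_of_isPrime hlt
      rw [Finset.card_insert_of_notMem ha]
      rw [Nat.cast_add, Nat.cast_one]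
      exact (add_le_add_left ih 1).trans this

theorem IsPartRSP.height_span [IsLocalRing R] [IsNoetherianRing R] {ι : Type*}
    [Finite ι] {t : ι → R} (h : IsPartRSP t) : (Ideal.span (Set.range t)).height = Nat.card ι := by
  have := Fintype.ofFinite ι
  have := h.height_span_image Finset.univ
  simpa using this

/-- If `R` and `R ⧸ I` are regular, then `I` is generated by a part of a regular system of
parameters of `R`. -/
theorem IsRegularLocalRing.exists_isPartRSP_of_surjective [IsRegularLocalRing R] {S : Type*}
    [CommRing S] [IsRegularLocalRing S] (φ : R →+* S) (hφ : Function.Surjective φ) :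
    ∃ (c : ℕ) (u : Fin c → R), IsPartRSP u ∧ RingHom.ker φ = Ideal.span (Set.range u) := by
  have hloc : IsLocalHom φ := hφ.isLocalHom
  obtain ⟨d, hd, hd'⟩ := IsRegularLocalRing.exists_ringKrullDim_eq R
  obtain ⟨e, he, he'⟩ := IsRegularLocalRing.exists_ringKrullDim_eq S
  have hkm : RingHom.ker φ ≤ maximalIdeal R := le_maximalIdeal (RingHom.ker_ne_top φ)
  obtain ⟨c, k, u, s, huI, hIu, hspan, hck⟩ := IsLocalRing.exists_generators_adapted _ hkm
  have hle := IsLocalRing.spanFinrank_le_add_of_surjective φ hφ u huI hIu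
  have hu : IsPartRSP u := ⟨k, s, hspan, by rw [hd, Nat.card_fin, hck, hd']⟩
  refine ⟨c, u, hu, ?_⟩
  have hsub : Ideal.span (Set.range u) ≤ RingHom.ker φ := by
    rw [Ideal.span_le]; rintro _ ⟨i, rfl⟩; exact huI i
  obtain ⟨_, h1, h2⟩ := hu.sumEmpty.quotient
  have hQ := h1.isRegularLocalRing
  have hprime := hu.isPrime_span
  obtain ⟨n, hn⟩ := IsLocalRing.exists_ringKrullDim_eq_natCast (R ⧸ Ideal.span (Set.range u))
  let ψ : R ⧸ Ideal.span (Set.range u) →+* S := Ideal.Quotient.lift _ φ hsub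
  have hψ : Function.Surjective ψ := Ideal.Quotient.lift_surjective_of_surjective _ _ hφ
  refine le_antisymm (fun x hx => ?_) hsub
  rw [← Ideal.Quotient.eq_zero_iff_mem]
  by_contra hne
  -- The adapted elements u already give a regular domain R/(u) of dimension d − c. A nonzero kernel
  -- of R/(u) → S would make dim S smaller than d − c, while `hle` says d ≤ c + dim S.
  have hS : ringKrullDim S + 1 ≤ ringKrullDim (R ⧸ Ideal.span (Set.range u)) :=
    ringKrullDim_succ_le_of_surjective ψ hψ (r := Ideal.Quotient.mk _ x)
      (mem_nonZeroDivisors_of_ne_zero hne) hx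
  rw [hd, hn, Nat.card_fin] at h2
  rw [he, hn] at hS
  have h3 : d = n + c := by exact_mod_cast h2
  have h4 : e + 1 ≤ n := by exact_mod_cast hS
  omega

/-- A nonzero element of a regular local ring whose minimal primes are generated by the members of
a part of a regular system of parameters is, up to a unit, a product of powers of these. -/
theorem IsPartRSP.exists_eq_unit_mul_prod_pow [IsLocalRing R] [IsNoetherianRing R] {ι : Type*}
    [Fintype ι] {t : ι → R} (h : IsPartRSP t) {a : R} (ha : a ≠ 0)
    (hmin : (Ideal.span {a}).minimalPrimes = Set.range fun i => Ideal.span {t i}) :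
    ∃ (e : ι → ℕ) (v : R), IsUnit v ∧ (∀ i, 1 ≤ e i) ∧ a = v * ∏ i, t i ^ e i := by
  classical
  have := h.isRegularLocalRing
  have := IsRegularLocalRing.isDomain R
  have hp : ∀ i, (Ideal.span {t i}).IsPrime := fun i => by
    simpa using h.isPrime_span_image {i}
  have ht0 : ∀ i, t i ≠ 0 := fun i h0 => by
    have := h.notMem_span_image (J := ∅) (i := i) (by simp)
    simp [h0] at this
  have hprime : ∀ i, Prime (t i) := fun i => (Ideal.span_singleton_prime (ht0 i)).1 (hp i)
  have hnd : ∀ i j, i ≠ j → ¬ t j ∣ t i := fun i j hij hdvd => by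
    refine h.notMem_span_image (J := {j}) (i := i) (by simpa using hij) ?_
    simpa using Ideal.mem_span_singleton.2 hdvd
  have hfin : ∀ i, FiniteMultiplicity (t i) a := fun i =>
    FiniteMultiplicity.of_not_isUnit (hprime i).not_isUnit ha
  have hstep : ∀ J : Finset ι, ∃ v : R, a = v * ∏ i ∈ J, t i ^ multiplicity (t i) a := by
    intro J
    induction J using Finset.induction_on with
    | empty => exact ⟨a, by simp⟩
    | insert j J hj ih =>
      obtain ⟨v, hv⟩ := ih
      have hdvd : t j ^ multiplicity (t j) a ∣ v := by
        have h1 : t j ^ multiplicity (t j) a ∣ v * ∏ i ∈ J, t i ^ multiplicity (t i) a := by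
          rw [← hv]; exact pow_multiplicity_dvd _ _
        refine (hprime j).pow_dvd_of_dvd_mul_right _ ?_ h1
        intro h2
        obtain ⟨i, hi, h3⟩ := (hprime j).exists_mem_finset_dvd h2
        exact hnd i j (fun h => hj (h ▸ hi)) ((hprime j).dvd_of_dvd_pow h3)
      obtain ⟨w, hw⟩ := hdvd
      refine ⟨w, ?_⟩
      rw [Finset.prod_insert hj]
      conv_lhs => rw [hv, hw]
      ring
  obtain ⟨v, hv⟩ := hstep Finset.univ
  have hmem : ∀ i, t i ∣ a := fun i => by
    have : Ideal.span {t i} ∈ (Ideal.span {a}).minimalPrimes := by rw [hmin]; exact ⟨i, rfl⟩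
    exact Ideal.mem_span_singleton.1 (this.1.2 (Ideal.mem_span_singleton_self a))
  refine ⟨fun i => multiplicity (t i) a, v, ?_, fun i => ?_, hv⟩
  · by_contra hnu
    have hv0 : v ≠ 0 := by rintro rfl; rw [zero_mul] at hv; exact ha hv
    have hvm : Ideal.span {v} ≤ maximalIdeal R :=
      (Ideal.span_singleton_le_iff_mem _).2 ((mem_maximalIdeal v).2 hnu)
    -- A minimal prime q over the nonunit v has height at most 1. It contains a, hence some (t_i),
    -- which already has height 1; so q = (t_i) and t_i divides v, although its full multiplicity
    -- has been removed from a.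
    obtain ⟨q, hq, hqm⟩ := Ideal.exists_minimalPrimes_le hvm
    have hqp : q.IsPrime := hq.1.1
    have haq : Ideal.span {a} ≤ q := by
      rw [Ideal.span_singleton_le_iff_mem, hv]
      exact Ideal.mul_mem_right _ _ (hq.1.2 (Ideal.mem_span_singleton_self v))
    obtain ⟨q', hq', hqq⟩ := Ideal.exists_minimalPrimes_le haq
    have hht := Ideal.height_le_one_of_isPrincipal_of_mem_minimalPrimes (Ideal.span {v}) q hq
    rw [hmin] at hq'
    obtain ⟨i, rfl⟩ := hq'
    simp only at hqq
    have hti : Ideal.span {t i} = q := by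
      by_contra hne
      have hlt := lt_of_le_of_ne hqq hne
      have := hp i
      have h1 := Ideal.height_add_one_le_of_lt_of_isPrime hlt
      have h2 : (Ideal.span {t i}).height = 1 := by
        have := h.height_span_image {i}
        simpa using this
      rw [h2] at h1
      exact absurd (h1.trans hht) (by decide)
    have hvt : t i ∣ v := Ideal.mem_span_singleton.1 (hti ▸ hq.1.2 (Ideal.mem_span_singleton_self v))
    obtain ⟨w, hw⟩ := hvt
    have : t i ^ (multiplicity (t i) a + 1) ∣ a := by
      refine ⟨w * ∏ j ∈ Finset.univ.erase i, t j ^ multiplicity (t j) a, ?_⟩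
      conv_lhs => rw [hv, ← Finset.mul_prod_erase Finset.univ _ (Finset.mem_univ i), hw]
      ring
    exact (hfin i).not_pow_dvd_of_multiplicity_lt (Nat.lt_succ_self _) this
  · exact (hfin i).le_multiplicity_of_pow_dvd (by simpa using hmem i)

end RegularParameters

/-! ### Projective dimension, and Serre's theorem on localizations of regular local rings. -/

section ProjectiveDimension

open IsLocalRing

/-- The projective dimension of the module `M` is at most `n`. -/
def Module.ProjDimLE (R : Type u) [CommRing R] (M : Type u) [AddCommGroup M] [Module R M]
    (n : ℕ) : Prop :=
  HasProjectiveDimensionLE (ModuleCat.of R M) n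

namespace Module.ProjDimLE

variable {R : Type u} [CommRing R] {M N P : Type u} [AddCommGroup M] [Module R M]
  [AddCommGroup N] [Module R N] [AddCommGroup P] [Module R P]

theorem zero_iff : Module.ProjDimLE R M 0 ↔ Module.Projective R M := by
  rw [IsProjective.iff_projective]
  exact projective_iff_hasProjectiveDimensionLT_one.symm

theorem succ_iff {f : M →ₗ[R] N} {g : N →ₗ[R] P} (hf : Function.Injective f)
    (hg : Function.Surjective g) (hfg : Function.Exact f g) [Module.Projective R N] (n : ℕ) :
    Module.ProjDimLE R P (n + 1) ↔ Module.ProjDimLE R M n := by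
  let S := ModuleCat.shortComplexOfCompEqZero f g hfg.linearMap_comp_eq_zero
  have hS : S.ShortExact :=
    { exact := ModuleCat.shortComplex_exact S hfg
      mono_f := (ModuleCat.mono_iff_injective _).2 hf
      epi_g := (ModuleCat.epi_iff_surjective _).2 hg }
  exact hS.hasProjectiveDimensionLT_X₃_iff n ((IsProjective.iff_projective N).1 inferInstance)

theorem of_linearEquiv (e : M ≃ₗ[R] N) {n : ℕ} (h : Module.ProjDimLE R M n) :
    Module.ProjDimLE R N n :=
  have : HasProjectiveDimensionLT (ModuleCat.of R M) (n + 1) := h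
  hasProjectiveDimensionLT_of_iso e.toModuleIso (n + 1)

theorem of_retract (i : N →ₗ[R] M) (r : M →ₗ[R] N) (hir : r ∘ₗ i = LinearMap.id) {n : ℕ}
    (h : Module.ProjDimLE R M n) : Module.ProjDimLE R N n :=
  have : HasProjectiveDimensionLT (ModuleCat.of R M) (n + 1) := h
  Retract.hasProjectiveDimensionLT (X := ModuleCat.of R N) (Y := ModuleCat.of R M)
    ⟨ModuleCat.ofHom i, ModuleCat.ofHom r, by rw [← ModuleCat.ofHom_comp, hir]; rfl⟩ (n + 1)

theorem mono {n m : ℕ} (hnm : n ≤ m) (h : Module.ProjDimLE R M n) : Module.ProjDimLE R M m :=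
  have : HasProjectiveDimensionLT (ModuleCat.of R M) (n + 1) := h
  hasProjectiveDimensionLT_of_ge (ModuleCat.of R M) (n + 1) (m + 1) (by omega)

end Module.ProjDimLE

open Module

/-- Projective dimension and reduction modulo a regular element. -/
theorem Module.projDimLE_quotSMulTop_iff {R : Type u} [CommRing R] [IsLocalRing R]
    [IsNoetherianRing R] {x : R} (hx : x ∈ maximalIdeal R) (hxR : IsSMulRegular R x) (n : ℕ) :
    ∀ (M : Type u) [AddCommGroup M] [Module R M] [Module.Finite R M], IsSMulRegular M x →
      (Module.ProjDimLE (R ⧸ Ideal.span {x}) (QuotSMulTop x M) n ↔ Module.ProjDimLE R M n) := by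
  have hne : Ideal.span {x} ≠ ⊤ := ne_top_of_le_ne_top (maximalIdeal.isMaximal R).ne_top
    ((Ideal.span_singleton_le_iff_mem _).2 hx)
  have := Ideal.Quotient.nontrivial_iff.2 hne
  have hloc : IsLocalRing (R ⧸ Ideal.span {x}) :=
    .of_surjective' (Ideal.Quotient.mk _) Ideal.Quotient.mk_surjective
  have hxj : x ∈ (⊥ : Ideal R).jacobson := by
    rw [IsLocalRing.jacobson_eq_maximalIdeal _ bot_ne_top]; exact hx
  induction n with
  | zero =>
    intro M _ _ _ hM
    have : Module.Finite (R ⧸ Ideal.span {x}) (QuotSMulTop x M) :=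
      Module.Finite.of_restrictScalars_finite R _ _
    have : Module.FinitePresentation R M := Module.finitePresentation_of_finite R M
    rw [ProjDimLE.zero_iff, ProjDimLE.zero_iff]
    have h := Module.free_quotSMulTop_iff_free (R := R) (M := M) hxj hM
    constructor
    · intro h1
      have : Module.Free (R ⧸ Ideal.span {x}) (QuotSMulTop x M) := Module.free_of_flat_of_isLocalRing
      have := h.1 this
      infer_instance
    · intro h1
      have : Module.Free R M := Module.free_of_flat_of_isLocalRing
      have := h.2 this
      infer_instance
  | succ n ih =>
    intro M _ _ _ hM
    obtain ⟨k, f, hf⟩ := Module.Finite.exists_fin' R M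
    let F := Fin k → R
    let K := LinearMap.ker f
    have hex : Function.Exact K.subtype f := fun y => by simp [K]
    have hKreg : IsSMulRegular K x := by
      intro a b hab
      refine Subtype.ext (funext fun i => hxR ?_)
      have := congrFun (congrArg Subtype.val hab) i
      simpa using this
    rw [ProjDimLE.succ_iff K.injective_subtype hf hex n, ← ih K hKreg]
    let f₁ := (QuotSMulTop.map x K.subtype).extendScalarsOfSurjective
      (R := R) (S := R ⧸ Ideal.span {x}) Ideal.Quotient.mk_surjective
    let f₂ := (QuotSMulTop.map x f).extendScalarsOfSurjective
      (R := R) (S := R ⧸ Ideal.span {x}) Ideal.Quotient.mk_surjective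
    have h2 : Function.Surjective f₂ := QuotSMulTop.map_surjective x hf
    have h12 : Function.Exact f₁ f₂ := QuotSMulTop.map_exact x hex hf
    -- The presentation stays exact on the left modulo x because x is regular on M. The zero module
    -- is prepended so that injectivity can be read off a four-term exact sequence.
    have h01 : Function.Exact (QuotSMulTop.map x (0 : PUnit.{u + 1} →ₗ[R] K))
        (QuotSMulTop.map x K.subtype) :=
      QuotSMulTop.map_first_exact_on_four_term_exact_of_isSMulRegular_last
        (by rw [LinearMap.exact_zero_iff_injective]; exact K.injective_subtype) hex hM
    have h1 : Function.Injective f₁ := by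
      rw [map_zero, LinearMap.exact_zero_iff_injective] at h01
      exact h01
    exact ProjDimLE.succ_iff h1 h2 h12 n

/-- Finitely generated modules over a regular local ring have finite projective dimension. -/
theorem IsRegularLocalRing.projDimLE (d : ℕ) : ∀ (R : Type u) [CommRing R] [IsRegularLocalRing R],
    ringKrullDim R = d → ∀ (M : Type u) [AddCommGroup M] [Module R M] [Module.Finite R M],
    Module.ProjDimLE R M d := by
  induction d with
  | zero =>
    intro R _ _ hd M _ _ _
    obtain ⟨d', hd', hs⟩ := IsRegularLocalRing.exists_ringKrullDim_eq R
    rw [hd] at hd'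
    have : d' = 0 := by exact_mod_cast hd'.symm
    rw [this, Submodule.spanFinrank_eq_zero_iff_eq_bot (Ideal.fg_of_isNoetherianRing _)] at hs
    let := (isField_iff_maximalIdeal_eq.2 hs).toField
    rw [ProjDimLE.zero_iff]
    exact Module.Projective.of_free (R := R)
  | succ d ih =>
    intro R _ _ hd M _ _ _
    have := IsRegularLocalRing.isDomain R
    obtain ⟨d', hd', hs⟩ := IsRegularLocalRing.exists_ringKrullDim_eq R
    rw [hd] at hd'
    have hdd : d' = d + 1 := by exact_mod_cast hd'.symm
    obtain ⟨x, hxm, hx2⟩ : ∃ x ∈ maximalIdeal R, x ∉ maximalIdeal R ^ 2 := by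
      by_contra! hcon
      have hb : maximalIdeal R = ⊥ := by
        refine Submodule.eq_bot_of_le_smul_of_le_jacobson_bot (maximalIdeal R) _
          (Ideal.fg_of_isNoetherianRing _) ?_ (maximalIdeal_le_jacobson _)
        rw [smul_eq_mul, ← pow_two]; exact hcon
      rw [hb, Submodule.spanFinrank_bot] at hs
      omega
    have hP := isPartRSP_of_mem_of_notMem_sq hxm hx2
    have hx0 : x ≠ 0 := by rintro rfl; exact hx2 (zero_mem _)
    have hxR : IsSMulRegular R x := fun a b hab => mul_left_cancel₀ hx0 hab
    have hne : Ideal.span {x} ≠ ⊤ := ne_top_of_le_ne_top (maximalIdeal.isMaximal R).ne_top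
      ((Ideal.span_singleton_le_iff_mem _).2 hxm)
    have := Ideal.Quotient.nontrivial_iff.2 hne
    have hloc : IsLocalRing (R ⧸ Ideal.span {x}) :=
      .of_surjective' (Ideal.Quotient.mk _) Ideal.Quotient.mk_surjective
    obtain ⟨h1, h2⟩ := hP.sumEmpty.of_surjective (Ideal.Quotient.mk (Ideal.span {x}))
      Ideal.Quotient.mk_surjective (by rw [Ideal.mk_ker, Set.range_const])
    have hreg := h1.isRegularLocalRing
    obtain ⟨n, hn⟩ := IsLocalRing.exists_ringKrullDim_eq_natCast (R ⧸ Ideal.span {x})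
    have hdn : n = d := by
      rw [hd, hn, Nat.card_unique] at h2
      have : d + 1 = n + 1 := by exact_mod_cast h2
      omega
    -- The element x may be a zero divisor on M, but it is regular on the first syzygy K, a
    -- submodule of a free module. Passing to K costs one unit of projective dimension, which is the
    -- difference between d + 1 and d.
    obtain ⟨k, f, hf⟩ := Module.Finite.exists_fin' R M
    let K := LinearMap.ker f
    have hex : Function.Exact K.subtype f := fun y => by simp [K]
    have hKreg : IsSMulRegular K x := by
      intro a b hab
      refine Subtype.ext (funext fun i => hxR ?_)
      have := congrFun (congrArg Subtype.val hab) i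
      simpa using this
    have : Module.Finite (R ⧸ Ideal.span {x}) (QuotSMulTop x K) :=
      Module.Finite.of_restrictScalars_finite R _ _
    rw [ProjDimLE.succ_iff K.injective_subtype hf hex d,
      ← Module.projDimLE_quotSMulTop_iff hxm hxR d K hKreg]
    exact ih (R ⧸ Ideal.span {x}) (by rw [hn, hdn]) _

/-- If the maximal ideal of a Noetherian local ring has a nonzero annihilator, then all finite
modules of finite projective dimension are free. -/
theorem Module.ProjDimLE.free_of_annihilator {R : Type u} [CommRing R] [IsLocalRing R]
    [IsNoetherianRing R] {a : R} (ha : a ≠ 0) (ham : ∀ y ∈ maximalIdeal R, a * y = 0) (n : ℕ) :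
    ∀ (M : Type u) [AddCommGroup M] [Module R M] [Module.Finite R M],
      Module.ProjDimLE R M n → Module.Free R M := by
  -- A minimal free cover, obtained by lifting a basis of the fibre of M: relations have
  -- coefficients in m, so a kills them.
  have key : ∀ (M : Type u) [AddCommGroup M] [Module R M] [Module.Finite R M],
      ∃ (k : ℕ) (f : (Fin k → R) →ₗ[R] M), Function.Surjective f ∧
        ∀ v ∈ LinearMap.ker f, a • v = 0 := by
    intro M _ _ _
    let b := Module.finBasis (ResidueField R) (TensorProduct R (ResidueField R) M)
    have hsurj := TensorProduct.mk_surjective R M (ResidueField R) Ideal.Quotient.mk_surjective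
    choose v hv using fun i => hsurj (b i)
    refine ⟨_, Fintype.linearCombination R v, ?_, ?_⟩
    · rw [← LinearMap.range_eq_top, Fintype.range_linearCombination]
      exact IsLocalRing.span_eq_top_of_tmul_eq_basis v b hv
    · intro c hc
      rw [LinearMap.mem_ker, Fintype.linearCombination_apply] at hc
      have h1 := congrArg (TensorProduct.mk R (ResidueField R) M 1) hc
      rw [map_sum, map_zero] at h1
      have h2 := Fintype.linearIndependent_iff.1 b.linearIndependent (fun i => residue R (c i)) (by
        rw [← h1]
        refine Finset.sum_congr rfl fun i _ => ?_
        rw [map_smul, hv]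
        exact algebraMap_smul (ResidueField R) (c i) (b i))
      funext i
      exact ham _ ((residue_eq_zero_iff _).1 (h2 i))
  induction n with
  | zero =>
    intro M _ _ _ h
    have := ProjDimLE.zero_iff.1 h
    exact Module.free_of_flat_of_isLocalRing
  | succ n ih =>
    intro M _ _ _ h
    obtain ⟨k, f, hf, hk⟩ := key M
    let K := LinearMap.ker f
    have hex : Function.Exact K.subtype f := fun y => by simp [K]
    rw [ProjDimLE.succ_iff K.injective_subtype hf hex n] at h
    have hfree := ih K h
    -- K is free by induction and killed by a; a basis vector would force a = 0.
    have hK : Subsingleton K := by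
      by_contra hns
      rw [not_subsingleton_iff_nontrivial] at hns
      let b := Module.Free.chooseBasis R K
      obtain ⟨i⟩ := b.index_nonempty
      have h1 : a • b i = 0 := Subtype.ext (hk _ (b i).2)
      have h2 := congrArg (fun z => b.repr z i) h1
      simp at h2
      exact ha h2
    have hinj : Function.Injective f := by
      rw [← LinearMap.ker_eq_bot]
      exact Submodule.subsingleton_iff_eq_bot.1 hK
    exact Module.Free.of_equiv (LinearEquiv.ofBijective f ⟨hinj, hf⟩)

theorem IsRegularLocalRing.of_maximalIdeal_eq_bot {R : Type u} [CommRing R] [IsLocalRing R]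
    [IsNoetherianRing R] (h : maximalIdeal R = ⊥) : IsRegularLocalRing R := by
  apply IsRegularLocalRing.of_spanFinrank_maximalIdeal_le
  rw [h, Submodule.spanFinrank_bot]
  exact ringKrullDim_nonneg_of_nontrivial

/-- If `x ∉ m²` is a regular element of the maximal ideal `m`, then the residue field is a direct
summand of `m / x m` over `R / x`. -/
theorem Module.ProjDimLE.residueField_quotient {R : Type u} [CommRing R] [IsLocalRing R]
    [IsNoetherianRing R] {x : R} (hx : x ∈ maximalIdeal R) (hx2 : x ∉ maximalIdeal R ^ 2)
    [IsLocalRing (R ⧸ Ideal.span {x})] {n : ℕ}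
    (h : Module.ProjDimLE (R ⧸ Ideal.span {x}) (QuotSMulTop x (maximalIdeal R)) n) :
    Module.ProjDimLE (R ⧸ Ideal.span {x}) (ResidueField (R ⧸ Ideal.span {x})) n := by
  let B := R ⧸ Ideal.span {x}
  let q : R →+* B := Ideal.Quotient.mk _
  have hq : Function.Surjective q := Ideal.Quotient.mk_surjective
  have hqloc : IsLocalHom q := .of_surjective q hq
  let m := maximalIdeal R
  let xm : m := ⟨x, hx⟩
  let c : QuotSMulTop x m := Submodule.Quotient.mk xm
  -- The section sends 1 to the class of x; for s in m the product sx lies in xm, so the maximal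
  -- ideal acts by zero on this class.
  let i : ResidueField B →ₗ[B] QuotSMulTop x m :=
    Submodule.liftQ (maximalIdeal B) (LinearMap.toSpanSingleton B _ c) (by
      intro b hb
      obtain ⟨s, rfl⟩ := hq b
      have hs : s ∈ m := (maximalIdeal_comap q).le hb
      change Submodule.Quotient.mk (s • xm) = (0 : QuotSMulTop x m)
      rw [Submodule.Quotient.mk_eq_zero]
      have : s • xm = x • (⟨s, hs⟩ : m) := Subtype.ext (mul_comm _ _)
      rw [this]
      exact Submodule.smul_mem_pointwise_smul _ _ _ trivial)
  have hx0 : m.toCotangent xm ≠ 0 := by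
    rw [Ne, Ideal.toCotangent_eq_zero]; exact hx2
  -- The retraction comes from a linear form on m/m² with value 1 on the class of x, which is
  -- nonzero since x is not in m².
  obtain ⟨ℓ, hℓ⟩ := Module.Projective.exists_dual_eq_one (ResidueField R)
    (V := CotangentSpace R) hx0
  let g : ResidueField R →ₗ[R] ResidueField B :=
    { toFun := ResidueField.map q
      map_add' := map_add _
      map_smul' := fun a z => by
        obtain ⟨z, rfl⟩ := residue_surjective z
        change ResidueField.map q (residue R (a * z)) = residue B (q a * q z)
        rw [ResidueField.map_residue, map_mul] }
  let r₀ : m →ₗ[R] ResidueField B := g ∘ₗ (ℓ.restrictScalars R) ∘ₗ m.toCotangent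
  let r₁ : QuotSMulTop x m →ₗ[R] ResidueField B :=
    Submodule.liftQ _ r₀ (by
      rintro _ ⟨a, -, rfl⟩
      change r₀ (x • a) = 0
      rw [map_smul]
      obtain ⟨z, hz⟩ := residue_surjective (r₀ a)
      rw [← hz]
      change residue B (q x * z) = 0
      have : q x = 0 := Ideal.Quotient.eq_zero_iff_mem.2 (Ideal.mem_span_singleton_self x)
      rw [this, zero_mul, map_zero])
  let r : QuotSMulTop x m →ₗ[B] ResidueField B :=
    r₁.extendScalarsOfSurjective (R := R) (S := B) hq
  refine h.of_retract i r ?_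
  refine LinearMap.ext fun z => ?_
  obtain ⟨b, rfl⟩ := residue_surjective z
  change r (b • c) = residue B b
  rw [map_smul]
  have h1 : r c = residue B 1 := by
    change ResidueField.map q (ℓ (m.toCotangent xm)) = _
    rw [hℓ, map_one, map_one]
  rw [h1]
  change residue B (b * 1) = _
  rw [mul_one]

/-- A Noetherian local ring whose residue field has finite projective dimension is regular. -/
theorem IsRegularLocalRing.of_projDimLE_residueField (k : ℕ) : ∀ (R : Type u) [CommRing R]
    [IsLocalRing R] [IsNoetherianRing R] (n : ℕ), (maximalIdeal R).spanFinrank ≤ k →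
    Module.ProjDimLE R (ResidueField R) n → IsRegularLocalRing R := by
  induction k with
  | zero =>
    intro R _ _ _ n hk _
    apply IsRegularLocalRing.of_maximalIdeal_eq_bot
    rwa [← Submodule.spanFinrank_eq_zero_iff_eq_bot (Ideal.fg_of_isNoetherianRing _),
      ← Nat.le_zero]
  | succ k ih =>
    intro R _ _ _ n hk h
    by_cases hb : maximalIdeal R = ⊥
    · exact IsRegularLocalRing.of_maximalIdeal_eq_bot hb
    -- If m outside m² consisted of zero divisors, prime avoidance would put m inside an associated
    -- prime, so m would have a nonzero annihilator. The residue field would then be free, and m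
    -- would be zero.
    obtain ⟨x, hxm, hx2, hxr⟩ : ∃ x ∈ maximalIdeal R, x ∉ maximalIdeal R ^ 2 ∧
        x ∈ nonZeroDivisors R := by
      by_contra! hcon
      have hfin := associatedPrimes.finite R R
      classical
      have hsub : ((maximalIdeal R : Ideal R) : Set R) ⊆
          ⋃ i ∈ (↑(insert (maximalIdeal R ^ 2) hfin.toFinset) : Set (Ideal R)), (i : Set R) := by
        intro x hx
        by_cases h : x ∈ maximalIdeal R ^ 2
        · exact Set.mem_biUnion (by simp) h
        · have hx' : x ∈ (nonZeroDivisors R : Set R)ᶜ := hcon x hx h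
          rw [← biUnion_associatedPrimes_eq_compl_nonZeroDivisors] at hx'
          obtain ⟨p, hp, hxp⟩ := Set.mem_iUnion₂.1 hx'
          exact Set.mem_biUnion (by simp [hp]) hxp
      rw [Ideal.subset_union_prime (maximalIdeal R ^ 2) (maximalIdeal R ^ 2)] at hsub
      · obtain ⟨p, hp, hle⟩ := hsub
        rw [Finset.mem_insert, Set.Finite.mem_toFinset] at hp
        rcases hp with rfl | hp
        · apply hb
          refine Submodule.eq_bot_of_le_smul_of_le_jacobson_bot (maximalIdeal R) _
            (Ideal.fg_of_isNoetherianRing _) ?_ (maximalIdeal_le_jacobson _)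
          rwa [smul_eq_mul, ← pow_two]
        · have hprime : p.IsPrime := hp.isPrime
          obtain ⟨-, a, ha⟩ := isAssociatedPrime_iff.1 hp
          have ham : ∀ y ∈ maximalIdeal R, a * y = 0 := by
            intro y hy
            have := hle hy
            rw [ha, Submodule.mem_colon_singleton] at this
            rw [mul_comm]; simpa using this
          have ha0 : a ≠ 0 := by
            rintro rfl
            apply hprime.ne_top
            rw [ha]
            ext y
            simp [Submodule.mem_colon_singleton]
          have hfree := h.free_of_annihilator ha0 ham n
          let b := Module.Free.chooseBasis R (ResidueField R)
          have hnt : Nontrivial (ResidueField R) :=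
            Ideal.Quotient.nontrivial_iff.2 (maximalIdeal.isMaximal R).ne_top
          obtain ⟨i⟩ : Nonempty (Module.Free.ChooseBasisIndex R (ResidueField R)) :=
            b.index_nonempty
          apply hb
          rw [eq_bot_iff]
          intro y hy
          have h1 : y • b i = 0 := by
            obtain ⟨z, hz⟩ := residue_surjective (b i)
            rw [← hz]
            change residue R (y * z) = 0
            exact (residue_eq_zero_iff _).2 (Ideal.mul_mem_right _ _ hy)
          have h2 := congrArg (fun z => b.repr z i) h1
          simpa using h2
      · intro i hi h1 _
        rw [Finset.mem_insert, Set.Finite.mem_toFinset] at hi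
        exact (hi.resolve_left h1).isPrime
    have hxR : IsSMulRegular R x := fun a b hab =>
      (mul_cancel_left_mem_nonZeroDivisors hxr).1 hab
    have hne : Ideal.span {x} ≠ ⊤ := ne_top_of_le_ne_top (maximalIdeal.isMaximal R).ne_top
      ((Ideal.span_singleton_le_iff_mem _).2 hxm)
    have := Ideal.Quotient.nontrivial_iff.2 hne
    have hloc : IsLocalRing (R ⧸ Ideal.span {x}) :=
      .of_surjective' (Ideal.Quotient.mk _) Ideal.Quotient.mk_surjective
    have hmreg : IsSMulRegular (maximalIdeal R) x := fun a b hab =>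
      Subtype.ext (hxR (congrArg Subtype.val hab))
    have hex : Function.Exact (maximalIdeal R).subtype (maximalIdeal R).mkQ :=
      LinearMap.exact_subtype_mkQ _
    -- The bound is first weakened to n + 1, so that the syzygy m of the residue field has
    -- projective dimension at most n, including when n = 0.
    have h1 := (ProjDimLE.succ_iff (maximalIdeal R).injective_subtype
      (maximalIdeal R).mkQ_surjective hex n).1 (h.mono (Nat.le_succ n))
    rw [← Module.projDimLE_quotSMulTop_iff hxm hxR n _ hmreg] at h1
    have h2 := h1.residueField_quotient hxm hx2
    obtain ⟨hk1, hk2⟩ : (maximalIdeal (R ⧸ Ideal.span {x})).spanFinrank ≤ k ∧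
        (maximalIdeal R).spanFinrank ≤
          1 + (maximalIdeal (R ⧸ Ideal.span {x})).spanFinrank := by
      let q := Ideal.Quotient.mk (Ideal.span {x})
      have hqs : Function.Surjective q := Ideal.Quotient.mk_surjective
      have hxx : x ∈ RingHom.ker q := by rw [Ideal.mk_ker]; exact Ideal.mem_span_singleton_self x
      constructor
      · obtain ⟨c, l, u, s, huI, hIu, hspan, hck⟩ := IsLocalRing.exists_generators_adapted
          (Ideal.span {x}) ((Ideal.span_singleton_le_iff_mem _).2 hxm)
        have hc : c ≠ 0 := by
          rintro rfl
          apply hx2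
          have := hIu (Ideal.mem_span_singleton_self x)
          rwa [Set.range_eq_empty, Ideal.span_empty, bot_sup_eq] at this
        have h1 : Ideal.span (Set.range (q ∘ s)) = maximalIdeal (R ⧸ Ideal.span {x}) := by
          rw [← IsLocalRing.map_maximalIdeal_of_surjective q hqs, ← hspan, Ideal.map_span,
            Set.image_union, Ideal.span_union, Set.range_comp, eq_comm, sup_eq_right, Ideal.span_le]
          rintro _ ⟨_, ⟨i, rfl⟩, rfl⟩
          have : q (u i) = 0 := Ideal.Quotient.eq_zero_iff_mem.2 (huI i)
          rw [this]
          exact zero_mem _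
        have h2 := IsLocalRing.spanFinrank_maximalIdeal_le_of_span_eq _ h1
        rw [Nat.card_fin] at h2
        omega
      · refine IsLocalRing.spanFinrank_le_add_of_surjective q hqs (fun _ : Fin 1 => x)
          (fun _ => hxx) ?_
        rw [Ideal.mk_ker, Set.range_const]
        exact le_sup_left
    have hreg := ih (R ⧸ Ideal.span {x}) n hk1 h2
    obtain ⟨d, hd, hs⟩ := IsRegularLocalRing.exists_ringKrullDim_eq (R ⧸ Ideal.span {x})
    apply IsRegularLocalRing.of_spanFinrank_maximalIdeal_le
    refine le_trans ?_ (ringKrullDim_quotient_succ_le_of_nonZeroDivisor hxr)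
    rw [hd]
    have : (maximalIdeal R).spanFinrank ≤ d + 1 := by omega
    exact_mod_cast this

/-- Serre: localizations of regular local rings are regular. -/
theorem IsRegularLocalRing.of_isLocalization_atPrime {R : Type u} [CommRing R]
    [IsRegularLocalRing R] (q : Ideal R) [q.IsPrime] (S : Type u) [CommRing S] [Algebra R S]
    [IsLocalization.AtPrime S q] : IsRegularLocalRing S := by
  have := IsLocalization.AtPrime.isLocalRing S q
  have := IsLocalization.isNoetherianRing q.primeCompl S inferInstance
  suffices h : IsRegularLocalRing (Localization.AtPrime q) from
    IsRegularLocalRing.of_ringEquiv (Localization.algEquiv q.primeCompl S).toRingEquiv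
  obtain ⟨n, hn⟩ := IsLocalRing.exists_ringKrullDim_eq_natCast R
  -- The residue field of the localization at q is the localization of R/q, so finiteness of
  -- projective dimension is inherited.
  have h := IsRegularLocalRing.projDimLE n R hn (R ⧸ q)
  have : HasProjectiveDimensionLE (ModuleCat.of R (R ⧸ q)) n := h
  have h' := ModuleCat.localizedModule_hasProjectiveDimensionLE n q.primeCompl
    (ModuleCat.of R (R ⧸ q))
  let T := Localization.AtPrime q
  have hT : Module.ProjDimLE T ((ModuleCat.of R (R ⧸ q)).localizedModule q.primeCompl) n := h'
  have hmap : q.localized' T q.primeCompl (Algebra.linearMap R T) = maximalIdeal T := by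
    rw [Ideal.localized'_eq_map, Localization.AtPrime.map_eq_maximalIdeal]
  refine IsRegularLocalRing.of_projDimLE_residueField _ T n le_rfl ?_
  have := ModuleCat.localizedModule_isLocalizedModule (ModuleCat.of R (R ⧸ q)) q.primeCompl
  let e₁ := IsLocalizedModule.linearEquiv q.primeCompl
    ((ModuleCat.of R (R ⧸ q)).localizedModuleMkLinearMap q.primeCompl)
    (q.toLocalizedQuotient' T q.primeCompl (Algebra.linearMap R T))
  let e₂ := LinearEquiv.extendScalarsOfIsLocalization q.primeCompl T e₁
  exact hT.of_linearEquiv (e₂.trans (Submodule.quotEquivOfEq _ _ hmap))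

end ProjectiveDimension

/-! ### Completed local rings and the model ring. -/

section Completion

open IsLocalRing

/-- Going down along a flat map lifts a longest chain of primes of R. -/
theorem ringKrullDim_le_of_flat_of_isLocalHom {R S : Type*} [CommRing R] [CommRing S]
    [IsLocalRing R] [IsLocalRing S] [IsNoetherianRing R] [Algebra R S] [Module.Flat R S]
    [IsLocalHom (algebraMap R S)] : ringKrullDim R ≤ ringKrullDim S := by
  obtain ⟨n, hn⟩ := IsLocalRing.exists_ringKrullDim_eq_natCast R
  have hh : (maximalIdeal R).height = n := by
    have := IsLocalRing.maximalIdeal_height_eq_ringKrullDim (R := R)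
    rw [hn] at this
    exact_mod_cast this
  have hfin : (maximalIdeal R).FiniteHeight := ⟨Or.inr (by rw [hh]; exact ENat.natCast_ne_top n)⟩
  obtain ⟨l, hl1, hl2⟩ := (maximalIdeal R).exists_ltSeries_length_eq_height
  have : (maximalIdeal S).LiesOver l.last.asIdeal := by
    rw [hl1]
    exact ⟨(IsLocalRing.maximalIdeal_comap (algebraMap R S)).symm⟩
  obtain ⟨L, hL, -, -⟩ := Ideal.exists_ltSeries_of_hasGoingDown l (maximalIdeal S)
  rw [hn]
  have h1 : (l.length : ℕ) = n := by rw [hh] at hl2; exact_mod_cast hl2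
  rw [← h1, ← hL]
  exact Order.LTSeries.length_le_krullDim L

/-- Modulo each power of I only a truncation of the power series matters, so evaluation of
polynomials gives compatible maps to the quotients, glued by completeness. -/
theorem MvPowerSeries.exists_ringHom_of_isAdicComplete {σ R T : Type*} [Finite σ] [CommRing R]
    [CommRing T] (I : Ideal T) [IsAdicComplete I T] (ψ : R →+* T) (a : σ → T)
    (ha : ∀ i, a i ∈ I) : ∃ Φ : MvPowerSeries σ R →+* T,
      (∀ x, Φ (MvPowerSeries.C x) = ψ x) ∧ ∀ i, Φ (MvPowerSeries.X i) = a i := by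
  let g : MvPolynomial σ R →+* T := MvPolynomial.eval₂Hom ψ a
  have hg : (MvPolynomial.idealOfVars σ R).map g ≤ I := by
    rw [MvPolynomial.idealOfVars, Ideal.map_span, Ideal.span_le]
    rintro _ ⟨_, ⟨i, rfl⟩, rfl⟩
    simpa [g] using ha i
  have hgn : ∀ n, ∀ p ∈ MvPolynomial.idealOfVars σ R ^ n, g p ∈ I ^ n := fun n p hp => by
    have h1 := Ideal.mem_map_of_mem g hp
    rw [Ideal.map_pow] at h1
    exact Ideal.pow_right_mono hg n h1
  let f : ∀ n : ℕ, MvPowerSeries σ R →+* T ⧸ I ^ n := fun n =>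
    (Ideal.Quotient.lift (MvPolynomial.idealOfVars σ R ^ n) ((Ideal.Quotient.mk (I ^ n)).comp g)
      (fun p hp => Ideal.Quotient.eq_zero_iff_mem.2 (hgn n p hp))).comp
      (MvPowerSeries.truncTotalAlgHom σ R n : MvPowerSeries σ R →+* _)
  have hf_apply : ∀ n p, f n p = Ideal.Quotient.mk (I ^ n) (g (MvPowerSeries.truncTotal n p)) :=
    fun n p => rfl
  have hf : ∀ {m n : ℕ} (hle : m ≤ n), (Ideal.Quotient.factorPow I hle).comp (f n) = f m := by
    intro m n hle
    ext p
    rw [RingHom.comp_apply, hf_apply, hf_apply]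
    change Ideal.Quotient.mk (I ^ m) _ = _
    rw [Ideal.Quotient.eq, ← map_sub]
    exact hgn m _ (MvPowerSeries.truncTotal_sub_truncTotal_mem_pow_idealOfVars hle (le_refl _) _)
  have hcoe : ∀ n (p : MvPolynomial σ R), f n (p : MvPowerSeries σ R) =
      Ideal.Quotient.mk (I ^ n) (g p) := by
    intro n p
    rw [hf_apply, Ideal.Quotient.eq, ← map_sub]
    exact hgn n _ (Ideal.Quotient.eq.1 ((MvPowerSeries.truncTotalAlgHom σ R n).commutes p))
  let Φ := IsAdicComplete.liftRingHom I f hf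
  have hΦ : ∀ p : MvPolynomial σ R, Φ (p : MvPowerSeries σ R) = g p := by
    intro p
    rw [← sub_eq_zero]
    refine (inferInstance : IsHausdorff I T).haus _ fun n => ?_
    rw [SModEq.zero, smul_eq_mul, Ideal.mul_top, ← Ideal.Quotient.eq_zero_iff_mem, map_sub,
      IsAdicComplete.mk_liftRingHom I f hf, hcoe, sub_self]
  refine ⟨Φ, fun x => ?_, fun i => ?_⟩
  · rw [← MvPolynomial.coe_C, hΦ]; simp [g]
  · rw [← MvPolynomial.coe_X, hΦ]; simp [g]

theorem MvPowerSeries.mem_span_range_X {σ R : Type*} [Finite σ] [CommRing R]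
    {b : MvPowerSeries σ R} (hb : MvPowerSeries.constantCoeff b = 0) :
    b ∈ Ideal.span (Set.range (MvPowerSeries.X : σ → MvPowerSeries σ R)) := by
  classical
  have := Fintype.ofFinite σ
  have hex : ∀ d : σ →₀ ℕ, d ≠ 0 → ∃ i, 1 ≤ d i := fun d hd => by
    obtain ⟨i, hi⟩ := Finsupp.ne_iff.1 hd
    exact ⟨i, Nat.one_le_iff_ne_zero.2 hi⟩
  -- Each nonconstant monomial is assigned to one chosen variable dividing it; c i collects those
  -- assigned to i, divided by that variable. The default value 0 avoids counting a monomial twice.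
  let c : σ → MvPowerSeries σ R := fun i d =>
    if h : d + Finsupp.single i 1 ≠ 0 then
      if (hex _ h).choose = i then MvPowerSeries.coeff (d + Finsupp.single i 1) b else 0
    else 0
  have key : b = ∑ i, c i * MvPowerSeries.X i := by
    ext d
    rw [map_sum]
    simp_rw [MvPowerSeries.X, MvPowerSeries.coeff_mul_monomial, mul_one]
    by_cases hd : d = 0
    · subst hd
      rw [MvPowerSeries.coeff_zero_eq_constantCoeff_apply, hb, Finset.sum_eq_zero]
      intro i _
      rw [if_neg]
      intro h
      simpa using h i
    · have hi := (hex d hd).choose_spec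
      set i := (hex d hd).choose with hi_def
      have hsub : ∀ j, 1 ≤ d j → d - Finsupp.single j 1 + Finsupp.single j 1 = d := fun j hj =>
        tsub_add_cancel_of_le (by simpa using hj)
      have hc : ∀ j, 1 ≤ d j → MvPowerSeries.coeff (d - Finsupp.single j 1) (c j) =
          if i = j then MvPowerSeries.coeff d b else 0 := by
        intro j hj
        change c j (d - Finsupp.single j 1) = _
        simp only [c, hsub j hj]
        rw [dif_pos hd]
      rw [Finset.sum_eq_single i]
      · rw [if_pos (by simpa using hi), hc i hi, if_pos rfl]
      · intro j _ hj
        split_ifs with h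
        · rw [hc j (by simpa using h), if_neg (Ne.symm hj)]
        · rfl
      · simp
  rw [key]
  exact Ideal.sum_mem _ fun i _ => Ideal.mul_mem_left _ _ (Ideal.subset_span ⟨i, rfl⟩)

/-- The completion of a regular local ring over a discrete valuation ring `A` in which a
uniformizer of `A` is a monomial in a regular system of parameters. -/
theorem exists_modelRing_equiv {A : Type*} [CommRing A] [IsDomain A] [IsDiscreteValuationRing A]
    {A' : Type u} [CommRing A'] [Algebra A A'] [IsLocalRing A'] [Module.Finite A A']
    [Algebra.Etale A A'] {S : Type u} [CommRing S] [IsRegularLocalRing S] (g : A →+* S)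
    (ψ : A' →+* AdicCompletion (maximalIdeal S) S)
    (hψ : ∀ a, ψ (algebraMap A A' a) = algebraMap S _ (g a))
    (hψs : ∀ s : S, ∃ a', ψ a' - algebraMap S (AdicCompletion (maximalIdeal S) S) s ∈
      maximalIdeal (AdicCompletion (maximalIdeal S) S))
    {π : A} (hπ : Irreducible π) (hπS : g π ∈ maximalIdeal S) {r n : ℕ} (t : Fin r → S)
    (y : Fin n → S) (hspan : Ideal.span (Set.range t ∪ Set.range y) = maximalIdeal S)
    (hdim : ringKrullDim S = (r + n : ℕ)) (e : Fin r → ℕ) (he : ∀ i, 1 ≤ e i) {w : S}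
    (hw : IsUnit w) (hgπ : g π = w * ∏ i, t i ^ e i) :
    ∃ v : MvPowerSeries (Fin r ⊕ Fin n) A', IsUnit v ∧
      ∃ iso : AdicCompletion (maximalIdeal S) S ≃+* Bertini.ModelRing A' (algebraMap A A' π) e v,
        ∀ a : A, iso (algebraMap S _ (g a)) =
          Ideal.Quotient.mk _ (MvPowerSeries.C (algebraMap A A' a)) := by
  let T := AdicCompletion (maximalIdeal S) S
  let B := MvPowerSeries (Fin r ⊕ Fin n) A'
  let τ : Fin r ⊕ Fin n → S := Sum.elim t y
  have hτspan : Ideal.span (Set.range τ) = maximalIdeal S := by rw [Set.Sum.elim_range, hspan]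
  have hτm : ∀ i, τ i ∈ maximalIdeal S := fun i => by
    rw [← hτspan]; exact Ideal.subset_span ⟨i, rfl⟩
  have hTm : maximalIdeal T = Ideal.span (Set.range fun i => algebraMap S T (τ i)) := by
    have h1 := Ideal.map_span (algebraMap S T) (Set.range τ)
    rw [hτspan, ← Set.range_comp] at h1
    exact AdicCompletion.maximalIdeal_eq_map.trans h1
  obtain ⟨Φ, hΦC, hΦX⟩ := MvPowerSeries.exists_ringHom_of_isAdicComplete (maximalIdeal T) ψ
    (fun i => algebraMap S T (τ i)) (fun i => by
      rw [AdicCompletion.maximalIdeal_eq_map]; exact Ideal.mem_map_of_mem _ (hτm i))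
  let J : Ideal B := Ideal.span (Set.range MvPowerSeries.X)
  have hJ : J.map Φ = maximalIdeal T := by
    rw [hTm, Ideal.map_span, ← Set.range_comp]
    exact congrArg (fun f => Ideal.span (Set.range f)) (funext hΦX)
  -- S and its completion have the same residue field, so the condition on elements of S extends to
  -- all of T.
  have hresT : ∀ z : T, ∃ a' : A', ψ a' - z ∈ maximalIdeal T := by
    intro z
    obtain ⟨s, hs⟩ := residue_surjective
      ((AdicCompletion.residueField_map_bijective (R := S)).2 (residue T z)).choose
    have h1 := ((AdicCompletion.residueField_map_bijective (R := S)).2 (residue T z)).choose_spec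
    rw [← hs, ResidueField.map_residue] at h1
    obtain ⟨a', ha'⟩ := hψs s
    refine ⟨a', ?_⟩
    have h2 : algebraMap S T s - z ∈ maximalIdeal T := by
      rw [← residue_eq_zero_iff, map_sub, h1, sub_self]
    have h3 := add_mem ha' h2
    rwa [sub_add_sub_cancel] at h3
  -- By completeness it suffices to be surjective modulo the ideal of the variables, where constants
  -- already suffice.
  have hΦs : Function.Surjective Φ := by
    have : IsHausdorff (J.map Φ) T := by rw [hJ]; infer_instance
    refine surjective_of_mk_map_comp_surjective (I := J) Φ fun z => ?_
    obtain ⟨z, rfl⟩ := Ideal.Quotient.mk_surjective z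
    obtain ⟨a', ha'⟩ := hresT z
    refine ⟨MvPowerSeries.C a', ?_⟩
    rw [RingHom.comp_apply, hΦC, Ideal.Quotient.eq, hJ]
    exact ha'
  have hΦloc : IsLocalHom Φ := .of_surjective Φ hΦs
  obtain ⟨v, hv⟩ := hΦs (algebraMap S T w)
  have hvu : IsUnit v := isUnit_of_map_unit Φ v (by rw [hv]; exact hw.map _)
  let ρ : B := MvPowerSeries.C (algebraMap A A' π) - v * ∏ i, MvPowerSeries.X (Sum.inl i) ^ e i
  have hρ : Φ ρ = 0 := by
    simp only [ρ, map_sub, hΦC, hψ, map_mul, map_prod, map_pow, hΦX, hv, hgπ, τ, Sum.elim_inl]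
    exact sub_self _
  let M := Bertini.ModelRing A' (algebraMap A A' π) e v
  let Ψ : M →+* T := Ideal.Quotient.lift (Ideal.span {ρ}) Φ (fun b hb => by
    obtain ⟨c, rfl⟩ := Ideal.mem_span_singleton'.1 hb
    rw [map_mul, hρ, mul_zero])
  have hΨs : Function.Surjective Ψ := Ideal.Quotient.lift_surjective_of_surjective _ _ hΦs
  have hMnt : Nontrivial M := Ψ.domain_nontrivial
  have hMloc : IsLocalRing M := .of_surjective' (Ideal.Quotient.mk _) Ideal.Quotient.mk_surjective
  have : IsNoetherianRing A' := .of_finite A A'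
  have hBn : IsNoetherianRing B := inferInstance
  have hMn : IsNoetherianRing M := isNoetherianRing_of_surjective B M (Ideal.Quotient.mk _)
    Ideal.Quotient.mk_surjective
  -- An empty product would make π a unit of S. At least one variable is needed below to express π
  -- through the variables.
  have hr : r ≠ 0 := by
    rintro rfl
    rw [Finset.univ_eq_empty, Finset.prod_empty, mul_one] at hgπ
    exact (mem_maximalIdeal _).1 hπS (hgπ ▸ hw)
  have hπA' : ¬ IsUnit (algebraMap A A' π) := by
    intro h
    have h1 := h.map ψ
    rw [hψ] at h1
    exact (mem_maximalIdeal _).1 hπS (isUnit_of_map_unit (algebraMap S T) _ h1)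
  have hloc : IsLocalHom (algebraMap A A') := by
    refine ((local_hom_TFAE (algebraMap A A')).out 0 2).2 ?_
    rw [hπ.maximalIdeal_eq, Ideal.map_span,
      Set.image_singleton, Ideal.span_singleton_le_iff_mem]
    exact hπA'
  -- Since A' is unramified over A, π still generates its maximal ideal.
  have hmA' : maximalIdeal A' = Ideal.span {algebraMap A A' π} := by
    rw [← Algebra.FormallyUnramified.map_maximalIdeal (R := A), hπ.maximalIdeal_eq, Ideal.map_span,
      Set.image_singleton]
  let q : B →+* M := Ideal.Quotient.mk _
  have hqs : Function.Surjective q := Ideal.Quotient.mk_surjective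
  have hqloc : IsLocalHom q := .of_surjective q hqs
  -- In the model ring the relation puts π into the ideal of the variables, so π is not needed as an
  -- extra generator: r + n generators suffice.
  have hMspan : Ideal.span (Set.range fun i => q (MvPowerSeries.X i)) = maximalIdeal M := by
    apply le_antisymm
    · rw [Ideal.span_le]
      rintro _ ⟨i, rfl⟩
      have : (MvPowerSeries.X i : B) ∈ maximalIdeal B := by
        rw [mem_maximalIdeal, mem_nonunits_iff, MvPowerSeries.isUnit_iff_constantCoeff,
          MvPowerSeries.constantCoeff_X]
        exact not_isUnit_zero
      exact (maximalIdeal_comap q).ge this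
    · intro z hz
      obtain ⟨b, rfl⟩ := hqs z
      have hb : b ∈ maximalIdeal B := (maximalIdeal_comap q).le hz
      rw [mem_maximalIdeal, mem_nonunits_iff, MvPowerSeries.isUnit_iff_constantCoeff,
        ← mem_nonunits_iff, ← mem_maximalIdeal, hmA', Ideal.mem_span_singleton'] at hb
      obtain ⟨c, hc⟩ := hb
      have hJb : b - MvPowerSeries.C (MvPowerSeries.constantCoeff b) ∈ J :=
        MvPowerSeries.mem_span_range_X (by simp)
      have h1 := Ideal.mem_map_of_mem q hJb
      rw [Ideal.map_span, ← Set.range_comp, map_sub] at h1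
      have h2 : q (MvPowerSeries.C (MvPowerSeries.constantCoeff b)) ∈
          Ideal.span (Set.range fun i => q (MvPowerSeries.X i)) := by
        rw [← hc, map_mul, map_mul]
        refine Ideal.mul_mem_left _ _ ?_
        have h3 : q (MvPowerSeries.C (algebraMap A A' π)) =
            q (v * ∏ i, MvPowerSeries.X (Sum.inl i) ^ e i) :=
          Ideal.Quotient.eq.2 (Ideal.mem_span_singleton_self ρ)
        rw [h3, map_mul]
        refine Ideal.mul_mem_left _ _ ?_
        obtain ⟨i⟩ : Nonempty (Fin r) := ⟨⟨0, Nat.pos_of_ne_zero hr⟩⟩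
        have h4 : q (∏ i, MvPowerSeries.X (Sum.inl i) ^ e i) =
            q (MvPowerSeries.X (Sum.inl i)) ^ e i *
              q (∏ j ∈ Finset.univ.erase i, MvPowerSeries.X (Sum.inl j) ^ e j) := by
          rw [← map_pow, ← map_mul]
          exact congrArg q (Finset.mul_prod_erase _ _ (Finset.mem_univ i)).symm
        rw [h4]
        have h5 : q (MvPowerSeries.X (Sum.inl i)) ∈
            Ideal.span (Set.range fun i => q (MvPowerSeries.X i)) :=
          Ideal.subset_span ⟨Sum.inl i, rfl⟩
        exact Ideal.mul_mem_right _ _ (Ideal.pow_mem_of_mem _ h5 _ (he i))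
      have h3 := add_mem h1 h2
      rwa [sub_add_cancel] at h3
  -- The completion is flat over S, so its dimension is at least r + n. As M surjects onto it and
  -- has r + n generators of its maximal ideal, M is regular of dimension r + n.
  have hTdim : ((r + n : ℕ) : WithBot ℕ∞) ≤ ringKrullDim T := by
    rw [← hdim]
    have : Module.Flat S T := AdicCompletion.flat_of_isNoetherian _
    exact ringKrullDim_le_of_flat_of_isLocalHom
  have hTM : ringKrullDim T ≤ ringKrullDim M := ringKrullDim_le_of_surjective Ψ hΨs
  have hsf := IsLocalRing.spanFinrank_maximalIdeal_le_of_span_eq _ hMspan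
  rw [Nat.card_sum, Nat.card_fin, Nat.card_fin] at hsf
  have hMreg : IsRegularLocalRing M := by
    apply IsRegularLocalRing.of_spanFinrank_maximalIdeal_le
    refine le_trans ?_ (hTdim.trans hTM)
    exact_mod_cast hsf
  have hMdom := IsRegularLocalRing.isDomain M
  have hMle : ringKrullDim M ≤ (r + n : ℕ) := by
    refine (ringKrullDim_le_spanFinrank_maximalIdeal M).trans ?_
    exact_mod_cast hsf
  -- M is a domain, so a nonzero kernel would make T of dimension smaller than r + n.
  have hΨi : Function.Injective Ψ := by
    rw [injective_iff_map_eq_zero]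
    intro z hz
    by_contra hne
    have h1 := ringKrullDim_succ_le_of_surjective Ψ hΨs (mem_nonZeroDivisors_of_ne_zero hne) hz
    have h2 := (add_le_add_left hTdim 1).trans (h1.trans hMle)
    have h3 : r + n + 1 ≤ r + n := by exact_mod_cast h2
    omega
  refine ⟨v, hvu, (RingEquiv.ofBijective Ψ ⟨hΨi, hΨs⟩).symm, fun a => ?_⟩
  rw [RingEquiv.symm_apply_eq]
  change _ = Φ (MvPowerSeries.C (algebraMap A A' a))
  rw [hΦC, hψ]

theorem AdicCompletion.exists_ringHom_map {R S : Type*} [CommRing R] [CommRing S] (I : Ideal R)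
    (J : Ideal S) (φ : R →+* S) (h : I ≤ J.comap φ) :
    ∃ Φ : AdicCompletion I R →+* AdicCompletion J S,
      ∀ x, Φ (algebraMap R _ x) = algebraMap S _ (φ x) := by
  have hn : ∀ n, I ^ n ≤ (J ^ n).comap φ := fun n =>
    (Ideal.pow_right_mono h n).trans (Ideal.le_comap_pow φ n)
  let f : ∀ n : ℕ, AdicCompletion I R →+* S ⧸ J ^ n := fun n =>
    (Ideal.quotientMap (J ^ n) φ (hn n)).comp (AdicCompletion.evalₐ I n : _ →+* R ⧸ I ^ n)
  have hf : ∀ {m n : ℕ} (hle : m ≤ n), (Ideal.Quotient.factorPow J hle).comp (f n) = f m := by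
    intro m n hle
    ext x
    obtain ⟨c, rfl⟩ := AdicCompletion.mk_surjective I R x
    simp only [f, RingHom.comp_apply, RingHom.coe_coe, AdicCompletion.evalₐ_mk,
      Ideal.quotientMap_mk]
    change Ideal.Quotient.mk (J ^ m) _ = _
    rw [Ideal.Quotient.eq, ← map_sub]
    refine hn m ?_
    have h1 := c.2 hle
    rw [SModEq.sub_mem, smul_eq_mul, Ideal.mul_top] at h1
    rw [← neg_sub]
    exact neg_mem h1
  refine ⟨AdicCompletion.liftRingHom J f hf, fun x => ?_⟩
  refine AdicCompletion.ext_evalₐ fun n => ?_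
  rw [AdicCompletion.evalₐ_liftRingHom]
  simp [f, AdicCompletion.algebraMap_apply]

/-- The model of a completed local ring passes to regular quotients in which the uniformizer is
again a monomial in a regular system of parameters. -/
theorem exists_modelRing_equiv_of_surjective {A : Type*} [CommRing A] [IsDomain A]
    [IsDiscreteValuationRing A] {A' : Type u} [CommRing A'] [Algebra A A'] [IsLocalRing A']
    [Module.Finite A A'] [Algebra.Etale A A'] {R S : Type u} [CommRing R] [IsLocalRing R]
    [IsNoetherianRing R] [CommRing S] [IsRegularLocalRing S] (φ : R →+* S)
    (hφ : Function.Surjective φ) (g : A →+* R) {σ : Type*}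
    (q : MvPowerSeries σ A' →+* AdicCompletion (maximalIdeal R) R) (hq : Function.Surjective q)
    (hqA : ∀ a, q (MvPowerSeries.C (algebraMap A A' a)) = algebraMap R _ (g a))
    {π : A} (hπ : Irreducible π) (hπS : φ (g π) ∈ maximalIdeal S) {r n : ℕ} (t : Fin r → S)
    (y : Fin n → S) (hspan : Ideal.span (Set.range t ∪ Set.range y) = maximalIdeal S)
    (hdim : ringKrullDim S = (r + n : ℕ)) (e : Fin r → ℕ) (he : ∀ i, 1 ≤ e i) {w : S}
    (hw : IsUnit w) (hgπ : φ (g π) = w * ∏ i, t i ^ e i) :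
    ∃ v : MvPowerSeries (Fin r ⊕ Fin n) A', IsUnit v ∧
      ∃ iso : AdicCompletion (maximalIdeal S) S ≃+* Bertini.ModelRing A' (algebraMap A A' π) e v,
        ∀ a : A, iso (algebraMap S _ (φ (g a))) =
          Ideal.Quotient.mk _ (MvPowerSeries.C (algebraMap A A' a)) := by
  have hφloc : IsLocalHom φ := .of_surjective φ hφ
  have hqloc : IsLocalHom q := .of_surjective q hq
  obtain ⟨Φ, hΦ⟩ := AdicCompletion.exists_ringHom_map (maximalIdeal R) (maximalIdeal S) φ
    (maximalIdeal_comap φ).ge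
  have hΦm : maximalIdeal (AdicCompletion (maximalIdeal R) R) ≤
      (maximalIdeal (AdicCompletion (maximalIdeal S) S)).comap Φ := by
    refine AdicCompletion.maximalIdeal_eq_map.trans_le (Ideal.map_le_iff_le_comap.2 fun x hx => ?_)
    rw [Ideal.mem_comap, Ideal.mem_comap, hΦ]
    refine (AdicCompletion.maximalIdeal_eq_map (R := S)).ge (Ideal.mem_map_of_mem _ ?_)
    exact (maximalIdeal_comap φ).ge hx
  refine exists_modelRing_equiv (φ.comp g) ((Φ.comp q).comp MvPowerSeries.C) (fun a => ?_)
    (fun s => ?_) hπ hπS t y hspan hdim e he hw hgπ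
  · change Φ (q _) = _
    rw [hqA, hΦ]
    rfl
  · obtain ⟨x, rfl⟩ := hφ s
    obtain ⟨b, hb⟩ := hq (algebraMap R _ x)
    -- A power series differs from its constant term by a nonunit, so A' reaches all residue classes
    -- of the completion of R, and therefore of that of S.
    refine ⟨MvPowerSeries.constantCoeff b, ?_⟩
    change Φ (q (MvPowerSeries.C _)) - _ ∈ maximalIdeal (AdicCompletion (maximalIdeal S) S)
    rw [← hΦ, ← hb, ← map_sub, ← map_sub]
    refine hΦm ((maximalIdeal_comap q).ge ?_)
    rw [mem_maximalIdeal, mem_nonunits_iff, MvPowerSeries.isUnit_iff_constantCoeff]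
    simp

end Completion

/-! ### Ideal sheaves on stalks, and primes of a stalk as generizations of the point. -/

namespace Bertini
open Scheme.IdealSheafData

section StalkIdeal
variable {X Y : Scheme.{u}}

theorem map_germ_ideal_of_le (D : X.IdealSheafData) {x : X} {U V : X.affineOpens} (h : U ≤ V)
    (hx : x ∈ U.1) : (D.ideal V).map (X.presheaf.germ V.1 x (h hx)).hom =
      (D.ideal U).map (X.presheaf.germ U.1 x hx).hom := by
  rw [← D.map_ideal h, Ideal.map_map, ← CommRingCat.hom_comp]
  exact congrArg (fun t => Ideal.map (CommRingCat.Hom.hom t) (D.ideal V))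
    (X.presheaf.germ_res (U := U.1) (V := V.1) (homOfLE h) x hx).symm

theorem stalkIdeal_eq (D : X.IdealSheafData) {x : X} {U : X.Opens} (hU : IsAffineOpen U)
    (hx : x ∈ U) : stalkIdeal D x = (D.ideal ⟨U, hU⟩).map (X.presheaf.germ U x hx).hom := by
  refine le_antisymm (iSup₂_le fun V hV => ?_)
    (le_iSup₂_of_le (f := fun (U : X.affineOpens) (hx : x ∈ U.1) =>
      (D.ideal U).map (X.presheaf.germ U.1 x hx).hom) ⟨U, hU⟩ hx le_rfl)
  obtain ⟨f, g, hfg, hxf⟩ := exists_basicOpen_le_affine_inter hU V.2 x ⟨hx, hV⟩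
  have h1 : X.affineBasicOpen (U := ⟨U, hU⟩) f ≤ ⟨U, hU⟩ := X.basicOpen_le f
  have h2 : X.affineBasicOpen (U := ⟨U, hU⟩) f ≤ V := hfg.trans_le (X.basicOpen_le g)
  exact ((map_germ_ideal_of_le D h2 hxf).trans (map_germ_ideal_of_le D h1 hxf).symm).le

theorem exists_isAffineOpen_mem (x : X) : ∃ U : X.Opens, IsAffineOpen U ∧ x ∈ U := by
  obtain ⟨_, ⟨U, hU, rfl⟩, hxU, -⟩ :=
    X.isBasis_affineOpens.exists_subset_of_mem_open (Set.mem_univ x) isOpen_univ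
  exact ⟨U, hU, hxU⟩

theorem SpecMap_fromSpecStalk_eq {x : X} {B : CommRingCat.{u}} (ψ : X.presheaf.stalk x ⟶ B)
    {U : X.Opens} (hU : IsAffineOpen U) (hx : x ∈ U) : Spec.map ψ ≫ X.fromSpecStalk x =
      Spec.map (X.presheaf.germ U x hx ≫ ψ) ≫ hU.fromSpec := by
  rw [← IsAffineOpen.fromSpecStalk_eq_fromSpecStalk hU hx, IsAffineOpen.fromSpecStalk,
    ← Spec.map_comp_assoc]

theorem SpecMap_fromSpecStalk_app {x : X} {B : CommRingCat.{u}}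
    (ψ : X.presheaf.stalk x ⟶ B) {U : X.Opens} (hx : x ∈ U) :
    (Spec.map ψ ≫ X.fromSpecStalk x).app U = X.presheaf.germ U x hx ≫ ψ ≫
      (Scheme.ΓSpecIso B).inv ≫ (Spec B).presheaf.map (homOfLE le_top).op := by
  rw [Scheme.Hom.comp_app, Scheme.fromSpecStalk_app hx]
  simp only [Category.assoc, Scheme.Hom.naturality]
  exact congrArg (X.presheaf.germ U x hx ≫ ·)
    (Scheme.ΓSpecIso_inv_naturality_assoc ψ _).symm

theorem SpecMap_fromSpecStalk_preimage {x : X} {B : CommRingCat.{u}}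
    (ψ : X.presheaf.stalk x ⟶ B) {U : X.Opens} (hx : x ∈ U) :
    (Spec.map ψ ≫ X.fromSpecStalk x) ⁻¹ᵁ U = ⊤ := by
  have hU : (X.fromSpecStalk x) ⁻¹ᵁ U = ⊤ := by
    refine Scheme.preimage_eq_top_of_closedPoint_mem (X.fromSpecStalk x) ?_
    rwa [Scheme.fromSpecStalk_closedPoint]
  rw [Scheme.Hom.comp_preimage, hU]; rfl

theorem SpecMap_fromSpecStalk_app_eq_zero_iff {x : X} {B : CommRingCat.{u}}
    (ψ : X.presheaf.stalk x ⟶ B) {U : X.Opens} (hx : x ∈ U) (s : Γ(X, U)) :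
    (Spec.map ψ ≫ X.fromSpecStalk x).app U s = 0 ↔ ψ (X.presheaf.germ U x hx s) = 0 := by
  rw [SpecMap_fromSpecStalk_app ψ hx]
  have : IsIso ((homOfLE (le_top : (Spec.map ψ ≫ X.fromSpecStalk x) ⁻¹ᵁ U ≤ ⊤)).op) := by
    rw [isIso_op_iff]
    exact ⟨homOfLE (SpecMap_fromSpecStalk_preimage ψ hx).ge, rfl, rfl⟩
  have hinj := (ConcreteCategory.bijective_of_isIso ((Scheme.ΓSpecIso B).inv ≫
    (Spec B).presheaf.map (homOfLE
      (le_top : (Spec.map ψ ≫ X.fromSpecStalk x) ⁻¹ᵁ U ≤ ⊤)).op)).1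
  exact map_eq_zero_iff ((Scheme.ΓSpecIso B).inv ≫
    (Spec B).presheaf.map (homOfLE
      (le_top : (Spec.map ψ ≫ X.fromSpecStalk x) ⁻¹ᵁ U ≤ ⊤)).op).hom hinj

/-- Both sides say that Spec B → X factors through the closed subscheme of D. Through this universal
property the behaviour of stalk ideals under pullback and generization becomes formal. -/
theorem le_ker_fromSpecStalk_iff (D : X.IdealSheafData) {x : X} {B : CommRingCat.{u}}
    (ψ : X.presheaf.stalk x ⟶ B) :
    D ≤ (Spec.map ψ ≫ X.fromSpecStalk x).ker ↔ stalkIdeal D x ≤ RingHom.ker ψ.hom := by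
  obtain ⟨U, hU, hx⟩ := exists_isAffineOpen_mem x
  rw [stalkIdeal_eq D hU hx, Ideal.map_le_iff_le_comap, RingHom.comap_ker]
  constructor
  · intro h s hs
    exact (SpecMap_fromSpecStalk_app_eq_zero_iff ψ hx s).1
      (Scheme.Hom.ideal_ker_le _ ⟨U, hU⟩ (h ⟨U, hU⟩ hs))
  · intro h
    have hl : ∀ a ∈ D.ideal ⟨U, hU⟩, (ψ.hom.comp (X.presheaf.germ U x hx).hom) a = 0 :=
      fun a ha => h ha
    -- The factorization is written down on the affine chart of the subscheme lying over U.
    have e1 : Spec.map ψ ≫ X.fromSpecStalk x = (Spec.map (CommRingCat.ofHom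
        (Ideal.Quotient.lift (D.ideal ⟨U, hU⟩) _ hl)) ≫ D.subschemeCover.f ⟨U, hU⟩) ≫
          D.subschemeι := by
      rw [SpecMap_fromSpecStalk_eq ψ hU hx]
      refine Eq.trans ?_ (Category.assoc _ _ _).symm
      refine Eq.trans ?_ (congrArg (fun t => Spec.map (CommRingCat.ofHom
        (Ideal.Quotient.lift (D.ideal ⟨U, hU⟩) _ hl)) ≫ t)
          (subschemeCover_map_subschemeι D ⟨U, hU⟩).symm)
      refine Eq.trans ?_ (congrArg (fun t => Spec.map (CommRingCat.ofHom
        (Ideal.Quotient.lift (D.ideal ⟨U, hU⟩) _ hl)) ≫ t) (glueDataObjι_ι D ⟨U, hU⟩).symm)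
      refine Eq.trans ?_ (Category.assoc _ _ _)
      rw [← Spec.map_comp]
      congr 2
    rw [e1]
    exact (D.ker_subschemeι).ge.trans (Scheme.Hom.le_ker_comp _ _)

/-- Test against the two quotient maps. -/
theorem ideal_eq_of_forall_le_ker {R : CommRingCat.{u}} {I J : Ideal R}
    (h : ∀ (B : CommRingCat.{u}) (ψ : R ⟶ B), I ≤ RingHom.ker ψ.hom ↔ J ≤ RingHom.ker ψ.hom) :
    I = J := by
  apply le_antisymm
  · simpa using (h (.of (R ⧸ J)) (CommRingCat.ofHom (Ideal.Quotient.mk J))).2 (by simp)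
  · simpa using (h (.of (R ⧸ I)) (CommRingCat.ofHom (Ideal.Quotient.mk I))).1 (by simp)

theorem stalkIdeal_comap (D : Y.IdealSheafData) (f : X ⟶ Y) (x : X) :
    stalkIdeal (D.comap f) x = (stalkIdeal D (f x)).map (f.stalkMap x).hom := by
  refine ideal_eq_of_forall_le_ker fun B ψ => ?_
  have h := le_ker_fromSpecStalk_iff (D.comap f) ψ
  rw [← le_map_iff_comap_le, ← Scheme.Hom.ker_comp, Category.assoc,
    ← Scheme.SpecMap_stalkMap_fromSpecStalk, ← Spec.map_comp_assoc, le_ker_fromSpecStalk_iff] at h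
  rw [Ideal.map_le_iff_le_comap, RingHom.comap_ker]
  exact h.symm

theorem stalkIdeal_map_stalkSpecializes (D : X.IdealSheafData) {x y : X} (h : y ⤳ x) :
    (stalkIdeal D x).map (X.presheaf.stalkSpecializes h).hom = stalkIdeal D y := by
  refine ideal_eq_of_forall_le_ker fun B ψ => ?_
  have h1 := le_ker_fromSpecStalk_iff D ψ
  rw [← Scheme.SpecMap_stalkSpecializes_fromSpecStalk h, ← Spec.map_comp_assoc,
    le_ker_fromSpecStalk_iff] at h1
  rw [Ideal.map_le_iff_le_comap, RingHom.comap_ker]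
  exact h1

theorem stalkIdeal_iSup {ι : Type*} (D : ι → X.IdealSheafData) (x : X) :
    stalkIdeal (⨆ i, D i) x = ⨆ i, stalkIdeal (D i) x := by
  obtain ⟨U, hU, hx⟩ := exists_isAffineOpen_mem x
  simp only [stalkIdeal_eq _ hU hx, ideal_iSup, iSup_apply, Ideal.map_iSup]

theorem stalkIdeal_biSup {ι : Type*} (D : ι → X.IdealSheafData) (s : Finset ι) (x : X) :
    stalkIdeal (⨆ i ∈ s, D i) x = ⨆ i ∈ s, stalkIdeal (D i) x := by
  rw [iSup_subtype', iSup_subtype']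
  exact stalkIdeal_iSup (fun i : {i // i ∈ s} => D i) x

theorem stalkIdeal_mono {D E : X.IdealSheafData} (h : D ≤ E) (x : X) :
    stalkIdeal D x ≤ stalkIdeal E x := by
  obtain ⟨U, hU, hx⟩ := exists_isAffineOpen_mem x
  simp only [stalkIdeal_eq _ hU hx]
  exact Ideal.map_mono (h _)

theorem mem_support_iff_stalkIdeal (D : X.IdealSheafData) (x : X) :
    x ∈ D.support ↔ stalkIdeal D x ≤ IsLocalRing.maximalIdeal (X.presheaf.stalk x) := by
  obtain ⟨U, hU, hx⟩ := exists_isAffineOpen_mem x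
  rw [mem_support_iff_of_mem (U := ⟨U, hU⟩) hx, Scheme.mem_zeroLocus_iff, stalkIdeal_eq _ hU hx,
    Ideal.map_le_iff_le_comap]
  refine forall₂_congr fun s hs => ?_
  rw [Scheme.mem_basicOpen X s x hx, Ideal.mem_comap, IsLocalRing.mem_maximalIdeal, mem_nonunits_iff]

theorem notMem_support_iff_stalkIdeal (D : X.IdealSheafData) (x : X) :
    x ∉ D.support ↔ stalkIdeal D x = ⊤ := by
  rw [mem_support_iff_stalkIdeal]
  refine ⟨fun h => by_contra fun h' => h (IsLocalRing.le_maximalIdeal h'), fun h => ?_⟩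
  rw [h, top_le_iff]
  exact (IsLocalRing.maximalIdeal.isMaximal _).ne_top

theorem isLocalization_stalk_germ {U : X.Opens} (hU : IsAffineOpen U) {x : X} (hx : x ∈ U) :
    letI := (X.presheaf.germ U x hx).hom.toAlgebra
    IsLocalization.AtPrime (X.presheaf.stalk x) (hU.primeIdealOf ⟨x, hx⟩).asIdeal :=
  hU.isLocalization_stalk ⟨x, hx⟩

theorem primeIdealOf_asIdeal {U : X.Opens} (hU : IsAffineOpen U) {x : X} (hx : x ∈ U) :
    (hU.primeIdealOf ⟨x, hx⟩).asIdeal =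
      (IsLocalRing.maximalIdeal (X.presheaf.stalk x)).comap (X.presheaf.germ U x hx).hom := by
  rw [hU.primeIdealOf_eq_map_closedPoint ⟨x, hx⟩]
  rfl

theorem stalkIdeal_inf (D E : X.IdealSheafData) (x : X) :
    stalkIdeal (D ⊓ E) x = stalkIdeal D x ⊓ stalkIdeal E x := by
  obtain ⟨U, hU, hx⟩ := exists_isAffineOpen_mem x
  simp only [stalkIdeal_eq _ hU hx, ideal_inf]
  let _ := (X.presheaf.germ U x hx).hom.toAlgebra
  have := isLocalization_stalk_germ hU hx
  exact IsLocalization.map_inf (hU.primeIdealOf ⟨x, hx⟩).asIdeal.primeCompl _ _ _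

theorem stalkIdeal_radical (D : X.IdealSheafData) (x : X) :
    stalkIdeal D.radical x = (stalkIdeal D x).radical := by
  obtain ⟨U, hU, hx⟩ := exists_isAffineOpen_mem x
  simp only [stalkIdeal_eq _ hU hx, radical_ideal]
  let _ := (X.presheaf.germ U x hx).hom.toAlgebra
  have := isLocalization_stalk_germ hU hx
  exact IsLocalization.map_radical (hU.primeIdealOf ⟨x, hx⟩).asIdeal.primeCompl _ _

theorem stalkMap_surjective (j : Y ⟶ X) [IsClosedImmersion j] (y : Y) :
    Function.Surjective (j.stalkMap y).hom :=
  SurjectiveOnStalks.stalkMap_surjective j y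

theorem ker_stalkMap (j : Y ⟶ X) [IsClosedImmersion j] (y : Y) :
    RingHom.ker (j.stalkMap y).hom = stalkIdeal j.ker (j y) := by
  obtain ⟨U, hU, hx⟩ := exists_isAffineOpen_mem (j y)
  rw [stalkIdeal_eq _ hU hx, Scheme.Hom.ker_apply]
  have hV : IsAffineOpen (j ⁻¹ᵁ U) := hU.preimage j
  have hy : y ∈ j ⁻¹ᵁ U := hx
  have hcomm : ∀ a, (j.stalkMap y).hom ((X.presheaf.germ U (j y) hx).hom a) =
      (Y.presheaf.germ (j ⁻¹ᵁ U) y hy).hom ((j.app U).hom a) := fun a =>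
    Scheme.Hom.germ_stalkMap_apply j U y hx a
  apply le_antisymm
  · intro a ha
    let _ := (X.presheaf.germ U (j y) hx).hom.toAlgebra
    have := isLocalization_stalk_germ hU hx
    obtain ⟨b, s, rfl⟩ := IsLocalization.exists_mk'_eq (hU.primeIdealOf ⟨j y, hx⟩).asIdeal.primeCompl a
    have hb : (Y.presheaf.germ (j ⁻¹ᵁ U) y hy).hom ((j.app U).hom b) = 0 := by
      rw [← hcomm]
      have := IsLocalization.mk'_spec (X.presheaf.stalk (j y)) b s
      replace this := congrArg (j.stalkMap y).hom this
      rw [map_mul, RingHom.mem_ker.1 ha, zero_mul] at this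
      exact this.symm
    let _ := (Y.presheaf.germ (j ⁻¹ᵁ U) y hy).hom.toAlgebra
    have h2 := isLocalization_stalk_germ hV (x := y) hy
    -- A germ that vanishes on Y is killed by a denominator t on Y. Since the sections of X surject
    -- onto those of Y, t lifts to a denominator t' on X, and t'b lies in the kernel.
    obtain ⟨t, ht⟩ := (IsLocalization.map_eq_zero_iff
      (hV.primeIdealOf ⟨y, hy⟩).asIdeal.primeCompl _ _).1 hb
    obtain ⟨t', ht'⟩ := j.app_surjective U hU t.1
    refine (IsLocalization.mk'_mem_map_algebraMap_iff
      (hU.primeIdealOf ⟨j y, hx⟩).asIdeal.primeCompl (X.presheaf.stalk (j y)) _ b s).2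
      ⟨t', ?_, ?_⟩
    · intro h
      apply t.2
      rw [primeIdealOf_asIdeal, SetLike.mem_coe, Ideal.mem_comap] at h
      suffices t.1 ∈ (IsLocalRing.maximalIdeal (Y.presheaf.stalk y)).comap
          (Y.presheaf.germ (j ⁻¹ᵁ U) y hy).hom from (primeIdealOf_asIdeal hV hy).ge this
      rw [Ideal.mem_comap, ← ht']
      exact ((hcomm t').symm.trans (by rfl)) ▸ map_nonunit (j.stalkMap y).hom _ h
    · rw [RingHom.mem_ker, map_mul]
      exact (congrArg (· * _) ht').trans ht
  · rw [Ideal.map_le_iff_le_comap]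
    intro a ha
    rw [Ideal.mem_comap, RingHom.mem_ker, hcomm, RingHom.mem_ker.1 ha, map_zero]

theorem germ_comp_stalkSpecializes {U : X.Opens} {x y : X} (h : y ⤳ x) (hx : x ∈ U) (hy : y ∈ U) :
    (X.presheaf.stalkSpecializes h).hom.comp (X.presheaf.germ U x hx).hom =
      (X.presheaf.germ U y hy).hom := by
  rw [← CommRingCat.hom_comp, TopCat.Presheaf.germ_stalkSpecializes]

/-- The prime ideal of `𝒪_{X,x}` corresponding to a generization `y` of `x`. -/
noncomputable def genIdeal {x y : X} (h : y ⤳ x) : Ideal (X.presheaf.stalk x) :=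
  (IsLocalRing.maximalIdeal (X.presheaf.stalk y)).comap (X.presheaf.stalkSpecializes h).hom

instance {x y : X} (h : y ⤳ x) : (genIdeal h).IsPrime :=
  Ideal.IsPrime.comap _

theorem isLocalization_stalkSpecializes {x y : X} (h : y ⤳ x) :
    letI := (X.presheaf.stalkSpecializes h).hom.toAlgebra
    IsLocalization.AtPrime (X.presheaf.stalk y) (genIdeal h) := by
  obtain ⟨U, hU, hx⟩ := exists_isAffineOpen_mem x
  have hy : y ∈ U := h.mem_open U.2 hx
  let _ := (X.presheaf.germ U x hx).hom.toAlgebra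
  let _ := (X.presheaf.germ U y hy).hom.toAlgebra
  let _ := (X.presheaf.stalkSpecializes h).hom.toAlgebra
  have : IsScalarTower Γ(X, U) (X.presheaf.stalk x) (X.presheaf.stalk y) :=
    .of_algebraMap_eq' (germ_comp_stalkSpecializes h hx hy).symm
  have h1 := isLocalization_stalk_germ hU hx
  have h2 := isLocalization_stalk_germ hU hy
  have hle : (hU.primeIdealOf ⟨x, hx⟩).asIdeal.primeCompl ≤
      (hU.primeIdealOf ⟨y, hy⟩).asIdeal.primeCompl := by
    intro a ha hb
    rw [SetLike.mem_coe, primeIdealOf_asIdeal, Ideal.mem_comap, IsLocalRing.mem_maximalIdeal] at hb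
    apply hb
    have : IsUnit ((X.presheaf.germ U x hx).hom a) := by
      by_contra hc
      exact ha (by rwa [SetLike.mem_coe, primeIdealOf_asIdeal, Ideal.mem_comap])
    rw [← germ_comp_stalkSpecializes h hx hy]
    exact this.map (X.presheaf.stalkSpecializes h).hom
  have h3 := IsLocalization.isLocalization_of_submonoid_le (X.presheaf.stalk x)
    (X.presheaf.stalk y) _ _ hle
  -- The stalk at y is already a localization of the stalk at x at germs of sections over U. The
  -- remaining elements outside the prime differ from these by units of the stalk at x.
  refine IsLocalization.of_le_of_exists_dvd ((hU.primeIdealOf ⟨y, hy⟩).asIdeal.primeCompl.map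
    (algebraMap Γ(X, U) (X.presheaf.stalk x))) _ ?_ ?_
  · rintro _ ⟨a, ha, rfl⟩ hb
    apply ha
    rw [SetLike.mem_coe, primeIdealOf_asIdeal, Ideal.mem_comap]
    rw [SetLike.mem_coe, genIdeal, Ideal.mem_comap] at hb
    rw [← germ_comp_stalkSpecializes h hx hy]
    exact hb
  · intro a ha
    obtain ⟨b, s, rfl⟩ := IsLocalization.exists_mk'_eq (hU.primeIdealOf ⟨x, hx⟩).asIdeal.primeCompl a
    refine ⟨algebraMap _ _ b, ⟨b, ?_, rfl⟩, ⟨algebraMap _ _ s.1, (IsLocalization.mk'_spec _ b s).symm⟩⟩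
    intro hb
    apply ha
    rw [SetLike.mem_coe, primeIdealOf_asIdeal, Ideal.mem_comap] at hb
    rw [SetLike.mem_coe, genIdeal, Ideal.mem_comap]
    rw [← germ_comp_stalkSpecializes h hx hy] at hb
    have hs : IsUnit ((X.presheaf.germ U x hx).hom s.1) :=
      IsLocalization.map_units (X.presheaf.stalk x) s
    have := IsLocalization.mk'_spec (X.presheaf.stalk x) b s
    have h5 := congrArg (X.presheaf.stalkSpecializes h).hom this
    rw [map_mul] at h5
    exact ((Ideal.IsPrime.mem_or_mem inferInstance
      ((congrArg (· ∈ IsLocalRing.maximalIdeal (X.presheaf.stalk y)) h5).mpr hb)).resolve_right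
      fun hc => hc (hs.map _))

theorem map_germ_comap_germ {U : X.Opens} (hU : IsAffineOpen U) {x : X} (hx : x ∈ U)
    (I : Ideal (X.presheaf.stalk x)) :
    (I.comap (X.presheaf.germ U x hx).hom).map (X.presheaf.germ U x hx).hom = I := by
  let _ := (X.presheaf.germ U x hx).hom.toAlgebra
  have := isLocalization_stalk_germ hU hx
  exact IsLocalization.map_under (hU.primeIdealOf ⟨x, hx⟩).asIdeal.primeCompl _ I

theorem comap_germ_genIdeal {U : X.Opens} {x y : X} (h : y ⤳ x) (hx : x ∈ U) (hy : y ∈ U) :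
    (genIdeal h).comap (X.presheaf.germ U x hx).hom =
      (IsLocalRing.maximalIdeal (X.presheaf.stalk y)).comap (X.presheaf.germ U y hy).hom := by
  rw [genIdeal, Ideal.comap_comap, germ_comp_stalkSpecializes h hx hy]

theorem exists_genIdeal_eq {x : X} (p : Ideal (X.presheaf.stalk x)) [p.IsPrime] :
    ∃ (y : X) (h : y ⤳ x), genIdeal h = p := by
  obtain ⟨U, hU, hx⟩ := exists_isAffineOpen_mem x
  let q : PrimeSpectrum Γ(X, U) := ⟨p.comap (X.presheaf.germ U x hx).hom, inferInstance⟩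
  have hqx : q ⤳ hU.primeIdealOf ⟨x, hx⟩ := by
    rw [← PrimeSpectrum.le_iff_specializes, ← PrimeSpectrum.asIdeal_le_asIdeal,
      primeIdealOf_asIdeal]
    exact Ideal.comap_mono (IsLocalRing.le_maximalIdeal Ideal.IsPrime.ne_top')
  have h : hU.fromSpec q ⤳ x := by
    have := hqx.map hU.fromSpec.continuous
    rwa [hU.fromSpec_primeIdealOf ⟨x, hx⟩] at this
  have hy := h.mem_open U.2 hx
  have hq : hU.primeIdealOf ⟨_, hy⟩ = q :=
    hU.fromSpec.isOpenEmbedding.injective (hU.fromSpec_primeIdealOf ⟨_, hy⟩)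
  refine ⟨_, h, ?_⟩
  rw [← map_germ_comap_germ hU hx (genIdeal h), comap_germ_genIdeal h hx hy,
    ← primeIdealOf_asIdeal hU hy, hq]
  exact map_germ_comap_germ hU hx p

/-- On an affine chart the ideal of the closure of y is the prime of y. This is the dictionary
between reduced components through x and primes of the stalk. -/
theorem stalkIdeal_vanishingIdeal_closure {x y : X} (h : y ⤳ x) :
    stalkIdeal (vanishingIdeal ⟨closure {y}, isClosed_closure⟩) x = genIdeal h := by
  obtain ⟨U, hU, hx⟩ := exists_isAffineOpen_mem x
  have hy := h.mem_open U.2 hx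
  rw [stalkIdeal_eq _ hU hx, vanishingIdeal_ideal]
  have h2 : PrimeSpectrum.vanishingIdeal (R := Γ(X, U)) (hU.fromSpec ⁻¹' closure {y}) =
      (genIdeal h).comap (X.presheaf.germ U x hx).hom := by
    rw [comap_germ_genIdeal h hx hy, ← primeIdealOf_asIdeal hU hy]
    apply le_antisymm
    · intro s hs
      exact (PrimeSpectrum.mem_vanishingIdeal _ _).1 hs _
        (subset_closure (hU.fromSpec_primeIdealOf ⟨y, hy⟩))
    · intro s hs
      refine (PrimeSpectrum.mem_vanishingIdeal _ _).2 fun p hp => ?_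
      have h3 : hU.primeIdealOf ⟨y, hy⟩ ⤳ p := by
        refine hU.fromSpec.isOpenEmbedding.isInducing.specializes_iff.1 ?_
        exact (hU.fromSpec_primeIdealOf ⟨y, hy⟩).symm ▸ specializes_iff_mem_closure.2 hp
      exact ((PrimeSpectrum.le_iff_specializes _ _).2 h3) hs
  exact (congrArg (Ideal.map _) h2).trans (map_germ_comap_germ hU hx _)

theorem genIdeal_le_iff {x y z : X} (hy : y ⤳ x) (hz : z ⤳ x) :
    genIdeal hy ≤ genIdeal hz ↔ y ⤳ z := by
  constructor
  · intro h
    rw [specializes_iff_mem_closure]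
    have h1 : z ∈ (vanishingIdeal ⟨closure {y}, isClosed_closure⟩ : X.IdealSheafData).support := by
      rw [mem_support_iff_stalkIdeal, ← stalkIdeal_map_stalkSpecializes _ hz,
        stalkIdeal_vanishingIdeal_closure hy, Ideal.map_le_iff_le_comap]
      exact h
    exact h1
  · intro h
    rw [← stalkIdeal_vanishingIdeal_closure hy, ← stalkIdeal_vanishingIdeal_closure hz]
    exact stalkIdeal_mono (vanishingIdeal_antimono (specializes_iff_closure_subset.1 h)) x

/-- Inclusion of primes of the stalk is reverse inclusion of closures; minimal primes therefore
match the components through x, every irreducible closed set having a generic point. -/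
theorem closure_mem_irreducibleComponents_iff {x y : X} (h : y ⤳ x) :
    closure {y} ∈ irreducibleComponents X ↔ genIdeal h ∈ minimalPrimes (X.presheaf.stalk x) := by
  constructor
  · intro hy
    refine ⟨⟨inferInstance, bot_le⟩, fun p hp hle => ?_⟩
    have := hp.1
    obtain ⟨z, hz, rfl⟩ := exists_genIdeal_eq p
    rw [genIdeal_le_iff] at hle ⊢
    have := hy.2 (isIrreducible_singleton (x := z)).closure (specializes_iff_closure_subset.1 hle)
    exact specializes_iff_closure_subset.2 this
  · intro hy
    refine ⟨(isIrreducible_singleton (x := y)).closure, fun C hC hle => ?_⟩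
    obtain ⟨z, hz⟩ := QuasiSober.sober hC.closure isClosed_closure
    have hzy : z ⤳ y := by
      rw [specializes_iff_mem_closure, hz.def]
      exact subset_closure (hle (subset_closure rfl))
    have h2 := hy.2 ⟨inferInstance, bot_le⟩ ((genIdeal_le_iff (hzy.trans h) h).2 hzy)
    rw [genIdeal_le_iff] at h2
    rw [specializes_iff_closure_subset, hz.def] at h2
    exact subset_closure.trans h2

theorem ringKrullDim_stalk_eq_height {x y : X} (h : y ⤳ x) :
    ringKrullDim (X.presheaf.stalk y) = (genIdeal h).height := by
  let _ := (X.presheaf.stalkSpecializes h).hom.toAlgebra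
  have := isLocalization_stalkSpecializes h
  exact IsLocalization.AtPrime.ringKrullDim_eq_height (genIdeal h) _

theorem genIdeal_map (f : X ⟶ Y) {x y : X} (h : y ⤳ x) :
    genIdeal (h.map f.continuous) = (genIdeal h).comap (f.stalkMap x).hom := by
  rw [genIdeal, genIdeal, Ideal.comap_comap, ← CommRingCat.hom_comp,
    ← Scheme.Hom.stalkSpecializes_stalkMap f _ _ h, CommRingCat.hom_comp, ← Ideal.comap_comap]
  have h1 : (IsLocalRing.maximalIdeal (X.presheaf.stalk y)).comap (f.stalkMap y).hom =
      IsLocalRing.maximalIdeal (Y.presheaf.stalk (f y)) :=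
    IsLocalRing.maximalIdeal_comap _
  exact congrArg (Ideal.comap _) h1.symm

end StalkIdeal

/-! ### Local rings and ideals of closed subschemes. -/

section Closed
variable {X Y Z : Scheme.{u}}

/-- At points of Z this is the kernel of a composite of stalk maps; elsewhere both sides are the
unit ideal. -/
theorem stalkIdeal_ker_comp (j : Z ⟶ Y) (k : Y ⟶ X) [IsClosedImmersion j] [IsClosedImmersion k]
    (y : Y) : stalkIdeal (j ≫ k).ker (k y) = (stalkIdeal j.ker y).comap (k.stalkMap y).hom := by
  by_cases hy : y ∈ Set.range j
  · obtain ⟨z, rfl⟩ := hy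
    rw [← ker_stalkMap j z, RingHom.comap_ker, ← CommRingCat.hom_comp]
    have h := ker_stalkMap (j ≫ k) z
    rw [Scheme.Hom.stalkMap_comp] at h
    exact h.symm
  · have h1 : y ∉ j.ker.support := by
      rw [← SetLike.mem_coe, Scheme.Hom.support_ker, j.isClosedEmbedding.isClosed_range.closure_eq]
      exact hy
    have h2 : k y ∉ (j ≫ k).ker.support := by
      rw [← SetLike.mem_coe, Scheme.Hom.support_ker,
        (j ≫ k).isClosedEmbedding.isClosed_range.closure_eq]
      rintro ⟨z, hz⟩
      exact hy ⟨z, k.isClosedEmbedding.injective hz⟩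
    rw [(notMem_support_iff_stalkIdeal _ _).1 h1, (notMem_support_iff_stalkIdeal _ _).1 h2,
      Ideal.comap_top]

theorem mem_range_iff_stalkIdeal (j : Z ⟶ X) [IsClosedImmersion j] (x : X) :
    x ∈ Set.range j ↔ stalkIdeal j.ker x ≤ IsLocalRing.maximalIdeal (X.presheaf.stalk x) := by
  rw [← mem_support_iff_stalkIdeal, ← SetLike.mem_coe, Scheme.Hom.support_ker,
    j.isClosedEmbedding.isClosed_range.closure_eq]

theorem stalkIdeal_ker_fst (i : X ⟶ Y) (h : Z ⟶ Y) [IsClosedImmersion h] (x : X) :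
    stalkIdeal (pullback.fst i h).ker x = (stalkIdeal h.ker (i x)).map (i.stalkMap x).hom := by
  rw [ker_fst_of_isClosedImmersion, stalkIdeal_comap]

/-- The height of the ideal of a closed subscheme of pure codimension at a point where it is
integral. -/
theorem HasPureCodim.height_eq {j : Z ⟶ X} [IsClosedImmersion j] {c : ℕ} (hj : HasPureCodim j c)
    (z : Z) [IsDomain (Z.presheaf.stalk z)] : (stalkIdeal j.ker (j z)).height = c := by
  -- As the stalk is a domain, exactly one component of Z passes through z. The dimension at its
  -- generic point is the height of the prime it defines, namely the kernel of the stalk map.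
  obtain ⟨y, hy, hy0⟩ := exists_genIdeal_eq (⊥ : Ideal (Z.presheaf.stalk z))
  have h1 : closure {y} ∈ irreducibleComponents Z := by
    rw [closure_mem_irreducibleComponents_iff hy, hy0, IsDomain.minimalPrimes_eq_singleton_bot]
    rfl
  have h2 := hj y h1
  rw [ringKrullDim_stalk_eq_height (hy.map j.continuous), genIdeal_map j hy, hy0,
    ← RingHom.ker_eq_comap_bot, ker_stalkMap] at h2
  exact_mod_cast h2

theorem ringKrullDim_stalk_eq_zero {z : Z} (hz : closure {z} ∈ irreducibleComponents Z) :
    ringKrullDim (Z.presheaf.stalk z) = 0 := by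
  have h1 := (closure_mem_irreducibleComponents_iff (specializes_rfl (x := z))).1 hz
  rw [ringKrullDim_stalk_eq_height specializes_rfl]
  rw [Ideal.height_eq_zero_iff.2 h1]
  rfl

/-- The local ring of a closed subscheme as a quotient. -/
noncomputable def stalkQuotientEquiv (j : Z ⟶ X) [IsClosedImmersion j] (z : Z) :
    (X.presheaf.stalk (j z) ⧸ stalkIdeal j.ker (j z)) ≃+* Z.presheaf.stalk z :=
  (Ideal.quotEquivOfEq (ker_stalkMap j z).symm).trans
    (RingHom.quotientKerEquivOfSurjective (stalkMap_surjective j z))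

end Closed

/-! ### Structure maps to stalks and the ideal of a closed fibre. -/

section Fibre
variable {R : Type u} [CommRing R] {X Y : Scheme.{u}}

theorem toStalk_comp (i : X ⟶ Y) (f : Y ⟶ Spec (.of R)) (x : X) :
    toStalk (i ≫ f) x = (i.stalkMap x).hom.comp (toStalk f (i x)) := by
  have h := Scheme.Hom.germ_stalkMap i ⊤ x trivial
  rw [toStalk, toStalk, ← CommRingCat.hom_comp, Scheme.Hom.comp_appTop]
  refine congrArg CommRingCat.Hom.hom ?_
  simp only [Category.assoc]
  exact congrArg ((Scheme.ΓSpecIso (.of R)).inv ≫ f.appTop ≫ ·) h.symm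

theorem toStalk_SpecMap {S : Type u} [CommRing S] (φ : R →+* S) (f : X ⟶ Spec (.of S)) (x : X) :
    toStalk (f ≫ Spec.map (CommRingCat.ofHom φ)) x = (toStalk f x).comp φ := by
  have h := Scheme.ΓSpecIso_inv_naturality (CommRingCat.ofHom φ)
  rw [toStalk, toStalk, Scheme.Hom.comp_appTop]
  refine congrArg CommRingCat.Hom.hom
    (?_ : _ = CommRingCat.ofHom φ ≫ (Scheme.ΓSpecIso (.of S)).inv ≫ f.appTop ≫ _)
  rw [reassoc_of% h]
  simp only [Category.assoc]

theorem stalkIdeal_ker_SpecMap {S : Type u} [CommRing S] (φ : R →+* S) (y : Spec (.of R)) :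
    stalkIdeal (Spec.map (CommRingCat.ofHom φ)).ker y =
      (RingHom.ker φ).map (toStalk (𝟙 (Spec (.of R))) y) := by
  have h := Scheme.ΓSpecIso_inv_naturality (CommRingCat.ofHom φ)
  have hinj : Function.Injective (Scheme.ΓSpecIso (.of S)).inv :=
    (ConcreteCategory.bijective_of_isIso _).1
  rw [stalkIdeal_eq _ (isAffineOpen_top _) trivial, Scheme.Hom.ker_apply]
  have h3 : RingHom.ker ((Spec.map (CommRingCat.ofHom φ)).appTop).hom =
      (RingHom.ker φ).map (Scheme.ΓSpecIso (.of R)).inv.hom := by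
    have hs : Function.Surjective (Scheme.ΓSpecIso (.of R)).inv.hom :=
      (ConcreteCategory.bijective_of_isIso (Scheme.ΓSpecIso (.of R)).inv).2
    apply le_antisymm
    · intro a ha
      obtain ⟨b, rfl⟩ := hs a
      refine Ideal.mem_map_of_mem _ ?_
      rw [RingHom.mem_ker] at ha ⊢
      apply hinj
      have := congrArg (fun t => t.hom b) h
      simp only [CommRingCat.hom_comp, RingHom.comp_apply] at this
      exact (this.trans ha).trans (map_zero (Scheme.ΓSpecIso (.of S)).inv.hom).symm
    · rw [Ideal.map_le_iff_le_comap]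
      intro b hb
      have := congrArg (fun t => t.hom b) h
      simp only [CommRingCat.hom_comp, RingHom.comp_apply] at this
      rw [Ideal.mem_comap, RingHom.mem_ker]
      refine this.symm.trans ?_
      exact (congrArg _ (RingHom.mem_ker.1 hb)).trans (map_zero (Scheme.ΓSpecIso (.of S)).inv.hom)
  refine (congrArg (Ideal.map _) h3).trans ?_
  rw [Ideal.map_map, ← CommRingCat.hom_comp]
  rfl

theorem stalkIdeal_ker_fst_SpecMap {S : Type u} [CommRing S] (φ : R →+* S)
    (hφ : Function.Surjective φ) (f : X ⟶ Spec (.of R)) (x : X) :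
    stalkIdeal (pullback.fst f (Spec.map (CommRingCat.ofHom φ))).ker x =
      (RingHom.ker φ).map (toStalk f x) := by
  have : IsClosedImmersion (Spec.map (CommRingCat.ofHom φ)) :=
    IsClosedImmersion.spec_of_surjective _ hφ
  rw [stalkIdeal_ker_fst, stalkIdeal_ker_SpecMap, Ideal.map_map, ← toStalk_comp, Category.comp_id]

end Fibre

/-! ### Smoothness over a field, read off the stalks. -/

section Smooth

theorem toStalk_id_bijective {L : Type u} [Field L] (y : Spec (.of L)) :
    Function.Bijective (toStalk (𝟙 (Spec (.of L))) y) := by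
  have hU := isAffineOpen_top (Spec (CommRingCat.of L))
  have hf : IsField Γ(Spec (.of L), ⊤) :=
    (Scheme.ΓSpecIso (.of L)).commRingCatIsoToRingEquiv.toMulEquiv.isField (Field.toIsField L)
  let _ := ((Spec (CommRingCat.of L)).presheaf.germ ⊤ y trivial).hom.toAlgebra
  have hloc := isLocalization_stalk_germ hU (x := y) trivial
  have hb : Function.Bijective ((Spec (CommRingCat.of L)).presheaf.germ ⊤ y trivial).hom := by
    refine (IsLocalization.atUnits Γ(Spec (.of L), ⊤) (hU.primeIdealOf ⟨y, trivial⟩).asIdeal.primeCompl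
      (S := (Spec (CommRingCat.of L)).presheaf.stalk y) ?_).bijective
    intro a ha
    have : a ≠ 0 := fun h => ha (h ▸ Ideal.zero_mem _)
    obtain ⟨b, hb⟩ := hf.mul_inv_cancel this
    exact IsUnit.of_mul_eq_one _ hb
  have h2 : Function.Bijective (Scheme.ΓSpecIso (.of L)).inv.hom :=
    ConcreteCategory.bijective_of_isIso (Scheme.ΓSpecIso (.of L)).inv
  have : toStalk (𝟙 (Spec (.of L))) y =
    ((Spec (CommRingCat.of L)).presheaf.germ ⊤ y trivial).hom.comp
      (Scheme.ΓSpecIso (.of L)).inv.hom := by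
    rw [toStalk, ← CommRingCat.hom_comp]
    rfl
  rw [this]
  exact hb.comp h2

theorem formallySmooth_toStalk_iff {L : Type u} [Field L] {W : Scheme.{u}} (g : W ⟶ Spec (.of L))
    (w : W) : (toStalk g w).FormallySmooth ↔ (g.stalkMap w).hom.FormallySmooth := by
  have h : toStalk g w = (g.stalkMap w).hom.comp
      (RingEquiv.ofBijective _ (toStalk_id_bijective (g w))).toRingHom := by
    conv_lhs => rw [← Category.comp_id g, toStalk_comp]
    rfl
  rw [h]
  constructor
  · intro h1
    have := RingHom.FormallySmooth.respectsIso.2 _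
      (RingEquiv.ofBijective _ (toStalk_id_bijective (g w))).symm h1
    convert this
    ext a
    obtain ⟨b, rfl⟩ := (toStalk_id_bijective (g w)).2 a
    simp only [RingEquiv.toRingHom_eq_coe, RingHom.comp_apply, RingEquiv.coe_toRingHom]
    congr 1
    exact (RingEquiv.apply_symm_apply _ _).symm
  · exact RingHom.FormallySmooth.respectsIso.2 _ _

theorem smooth_iff_toStalk {L : Type u} [Field L] {W : Scheme.{u}} (g : W ⟶ Spec (.of L))
    [LocallyOfFinitePresentation g] : Smooth g ↔ ∀ w, (toStalk g w).FormallySmooth := by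
  rw [← Scheme.Hom.smoothLocus_eq_top_iff]
  simp only [formallySmooth_toStalk_iff]
  constructor
  · intro h w
    exact h.ge (Set.mem_univ w)
  · intro h
    exact top_le_iff.1 fun w _ => h w

theorem locallyOfFinitePresentation_of_locallyOfFiniteType {R : Type u} [CommRing R]
    [IsNoetherianRing R] {W : Scheme.{u}} (g : W ⟶ Spec (.of R)) [LocallyOfFiniteType g] :
    LocallyOfFinitePresentation g := by
  have : IsNoetherianRing (CommRingCat.of R) := ‹_›
  infer_instance

/-- Two quotients of R by the same ideal are isomorphic as R-algebras, and then also as F-algebras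
because A surjects onto F. This lets strata with equal local ideals share their smoothness. -/
theorem formallySmooth_of_ker_eq {A F R S₁ S₂ : Type u} [CommRing A] [CommRing F] [CommRing R]
    [CommRing S₁] [CommRing S₂] {α : A →+* R} {β : A →+* F} (hβ : Function.Surjective β)
    {φ₁ : R →+* S₁} {φ₂ : R →+* S₂} (h₁ : Function.Surjective φ₁) (h₂ : Function.Surjective φ₂)
    (hker : RingHom.ker φ₁ = RingHom.ker φ₂) {f₁ : F →+* S₁} {f₂ : F →+* S₂}
    (hf₁ : f₁.comp β = φ₁.comp α) (hf₂ : f₂.comp β = φ₂.comp α) (h : f₁.FormallySmooth) :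
    f₂.FormallySmooth := by
  let e : S₁ ≃+* S₂ := (RingHom.quotientKerEquivOfSurjective h₁).symm.trans
    ((Ideal.quotEquivOfEq hker).trans (RingHom.quotientKerEquivOfSurjective h₂))
  have he : ∀ r, e (φ₁ r) = φ₂ r := by
    intro r
    have : (RingHom.quotientKerEquivOfSurjective h₁).symm (φ₁ r) = Ideal.Quotient.mk _ r := by
      rw [RingEquiv.symm_apply_eq]; rfl
    simp only [e, RingEquiv.trans_apply, this]
    rfl
  have := RingHom.FormallySmooth.respectsIso.1 f₁ e h
  convert this
  ext a
  obtain ⟨b, rfl⟩ := hβ a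
  have h1 := congrArg (fun t => t b) hf₁
  have h2 := congrArg (fun t => t b) hf₂
  simp only [RingHom.comp_apply] at h1 h2
  simp only [RingEquiv.toRingHom_eq_coe, RingHom.comp_apply, RingEquiv.coe_toRingHom]
  rw [h1, h2, he]

/-- Presents the stalk as a quotient of a localized polynomial ring, the form needed for the
Jacobian criterion. -/
theorem exists_localization_surjective {R : Type u} [CommRing R] {W : Scheme.{u}}
    (g : W ⟶ Spec (.of R)) [LocallyOfFiniteType g] (w : W) :
    ∃ (n : ℕ) (q : Ideal (MvPolynomial (Fin n) R)) (_ : q.IsPrime)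
      (φ : Localization.AtPrime q →+* W.presheaf.stalk w), Function.Surjective φ ∧
      φ.comp (algebraMap R _) = toStalk g w := by
  obtain ⟨U, hU, hw⟩ := exists_isAffineOpen_mem w
  have h := g.finiteType_appLE (isAffineOpen_top (Spec (.of R))) hU le_top
  let ρ : R →+* Γ(W, U) := ((Scheme.ΓSpecIso (.of R)).inv ≫ g.appLE ⊤ U le_top).hom
  have hρ : ρ.FiniteType := by
    refine RingHom.FiniteType.comp h (RingHom.FiniteType.of_surjective _ ?_)
    exact (ConcreteCategory.bijective_of_isIso (Scheme.ΓSpecIso (.of R)).inv).2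
  have hgρ : (W.presheaf.germ U w hw).hom.comp ρ = toStalk g w := by
    rw [toStalk]
    refine congrArg CommRingCat.Hom.hom
      (?_ : ((Scheme.ΓSpecIso (.of R)).inv ≫ g.appLE ⊤ U le_top) ≫ W.presheaf.germ U w hw = _)
    rw [Scheme.Hom.appTop, Scheme.Hom.app_eq_appLE,
      ← Scheme.Hom.appLE_map g le_rfl (homOfLE (le_top : U ≤ g ⁻¹ᵁ ⊤)).op, Category.assoc,
      Category.assoc]
    exact congrArg (fun t => (Scheme.ΓSpecIso (.of R)).inv ≫ g.appLE ⊤ _ _ ≫ t)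
      (W.presheaf.germ_res (homOfLE le_top) w hw)
  algebraize [ρ]
  obtain ⟨n, f, hf⟩ := Algebra.FiniteType.iff_quotient_mvPolynomial''.1
    (inferInstance : Algebra.FiniteType R Γ(W, U))
  let _ := (W.presheaf.germ U w hw).hom.toAlgebra
  have hloc := isLocalization_stalk_germ hU hw
  set p := (hU.primeIdealOf ⟨w, hw⟩).asIdeal
  let q := p.comap f.toRingHom
  have hq : ∀ y : q.primeCompl, IsUnit (((W.presheaf.germ U w hw).hom.comp f.toRingHom) y) :=
    fun y => IsLocalization.map_units (W.presheaf.stalk w) (⟨f y.1, y.2⟩ : p.primeCompl)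
  refine ⟨n, q, inferInstance, IsLocalization.lift hq, ?_, ?_⟩
  · intro a
    obtain ⟨b, s, rfl⟩ := IsLocalization.exists_mk'_eq p.primeCompl a
    obtain ⟨b, rfl⟩ := hf b
    obtain ⟨s', hs'⟩ := hf s.1
    refine ⟨IsLocalization.mk' _ b (⟨s', ?_⟩ : q.primeCompl), ?_⟩
    · intro hc
      exact s.2 (hs' ▸ hc)
    · rw [IsLocalization.lift_mk'_spec]
      have := IsLocalization.mk'_spec' (W.presheaf.stalk w) (f b) s
      rw [← hs'] at this
      exact this.symm
  · rw [← hgρ, IsScalarTower.algebraMap_eq R (MvPolynomial (Fin n) R), ← RingHom.comp_assoc,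
      IsLocalization.lift_comp, RingHom.comp_assoc]
    congr 1
    exact f.comp_algebraMap

end Smooth
end Bertini

/-! ### The equation of a hyperplane on the standard charts. -/

namespace Bertini

section HyperplaneEquation
open HomogeneousLocalization

variable {A : Type u} [CommRing A]

/-- The linear form with coefficient vector `a`. -/
noncomputable def linearForm {n : ℕ} (a : Fin n → A) : MvPolynomial (Fin n) A :=
  ∑ i, MvPolynomial.C (a i) * MvPolynomial.X i

theorem linearForm_mem {n : ℕ} (a : Fin n → A) : linearForm a ∈ grading A n 1 :=
  MvPolynomial.IsHomogeneous.sum _ _ _ fun j _ => by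
    simpa using (MvPolynomial.isHomogeneous_C (Fin n) (a j)).mul (MvPolynomial.isHomogeneous_X A j)

theorem linearForm_single {n : ℕ} (i : Fin n) (c : A) :
    linearForm (Pi.single i c : Fin n → A) = MvPolynomial.C c * MvPolynomial.X i := by
  rw [linearForm, Finset.sum_eq_single i] <;> simp +contextual

theorem linearForm_smul {n : ℕ} (c : A) (a : Fin n → A) :
    linearForm (c • a) = MvPolynomial.C c * linearForm a := by
  simp [linearForm, Finset.mul_sum, mul_assoc]

theorem linearForm_sub {n : ℕ} (a b : Fin n → A) :
    linearForm (a - b) = linearForm a - linearForm b := by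
  simp [linearForm, sub_mul]

theorem symAlgHom_X {n m : ℕ} (φ : (Fin n → A) →ₗ[A] (Fin m → A)) (i : Fin n) :
    symAlgHom φ (MvPolynomial.X i) = linearForm (φ (Pi.single i 1)) := by
  rw [symAlgHom, MvPolynomial.aeval_X]
  rfl

theorem symAlgHom_linearForm {n m : ℕ} (φ : (Fin n → A) →ₗ[A] (Fin m → A)) (a : Fin n → A) :
    symAlgHom φ (linearForm a) = linearForm (φ a) := by
  have ha : a = ∑ i, a i • (Pi.single i (1 : A) : Fin n → A) := by
    ext k; simp [Finset.sum_apply, Pi.single_apply]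
  have hsum : ∀ (s : Finset (Fin n)) (f : Fin n → Fin m → A),
      linearForm (∑ i ∈ s, f i) = ∑ i ∈ s, linearForm (f i) := fun s f => by
    simp only [linearForm, Finset.sum_apply, map_sum, Finset.sum_mul]
    exact Finset.sum_comm
  conv_rhs => rw [ha]
  rw [map_sum, hsum, linearForm, map_sum]
  refine Finset.sum_congr rfl fun i _ => ?_
  rw [map_mul, symAlgHom_X, map_smul, linearForm_smul, MvPolynomial.algHom_C,
    MvPolynomial.algebraMap_eq]

variable {n m : ℕ} (φ : (Fin n → A) →ₗ[A] (Fin m → A))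

theorem exists_section_of_surjective (hφ : Function.Surjective φ) :
    ∃ σ : (Fin m → A) →ₗ[A] (Fin n → A), φ ∘ₗ σ = .id :=
  Module.projective_lifting_property φ .id hφ

theorem symAlgHom_comp_section {σ : (Fin m → A) →ₗ[A] (Fin n → A)} (hσ : φ ∘ₗ σ = .id)
    (q : MvPolynomial (Fin m) A) : symAlgHom φ (symAlgHom σ q) = q := by
  have : (symAlgHom φ).comp (symAlgHom σ) = AlgHom.id A _ := MvPolynomial.algHom_ext fun i => by
    rw [AlgHom.comp_apply, symAlgHom_X, symAlgHom_linearForm, ← LinearMap.comp_apply, hσ,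
      LinearMap.id_apply, linearForm_single, map_one, one_mul, AlgHom.id_apply]
  exact DFunLike.congr_fun this q

/-- Choose a linear section σ of φ. Each basis vector differs from its image under σφ by a multiple
of a, so modulo the linear form of a the map Sym(σ)∘Sym(φ) is the identity; an element killed by Sym
φ is therefore zero there. -/
theorem ker_symAlgHom (hφ : Function.Surjective φ) (a : Fin n → A) (ha : LinearMap.ker φ = Submodule.span A {a}) :
    RingHom.ker (symAlgHom φ) = Ideal.span {linearForm a} := by
  obtain ⟨σ, hσ⟩ := exists_section_of_surjective φ hφ
  apply le_antisymm
  · intro p hp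
    have h : (Ideal.Quotient.mkₐ A (Ideal.span {linearForm a})).comp
        ((symAlgHom σ).comp (symAlgHom φ)) = Ideal.Quotient.mkₐ A _ :=
      MvPolynomial.algHom_ext fun i => by
        have h1 : (Pi.single i 1 : Fin n → A) - σ (φ (Pi.single i 1)) ∈ LinearMap.ker φ := by
          rw [LinearMap.mem_ker, map_sub, ← LinearMap.comp_apply φ, hσ, LinearMap.id_apply, sub_self]
        rw [ha, Submodule.mem_span_singleton] at h1
        obtain ⟨c, hc⟩ := h1
        have h2 := congrArg linearForm hc
        rw [linearForm_smul, linearForm_sub, linearForm_single, map_one, one_mul] at h2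
        rw [AlgHom.comp_apply, AlgHom.comp_apply, symAlgHom_X, symAlgHom_linearForm]
        refine (Ideal.Quotient.eq.2 ?_).symm
        rw [← h2]
        exact Ideal.mul_mem_left _ _ (Ideal.mem_span_singleton_self _)
    have h3 := DFunLike.congr_fun h p
    rw [AlgHom.comp_apply, AlgHom.comp_apply, RingHom.mem_ker.1 hp, map_zero, map_zero] at h3
    exact Ideal.Quotient.eq_zero_iff_mem.1 h3.symm
  · rw [Ideal.span_singleton_le_iff_mem, RingHom.mem_ker, symAlgHom_linearForm]
    have : φ a = 0 := by
      rw [← LinearMap.mem_ker, ha]; exact Submodule.mem_span_singleton_self a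
    rw [this]
    simp [linearForm]

/-- Over a principal ideal domain the kernel is free, and its rank is (N + 1) − N. -/
theorem exists_ker_eq_span_singleton [IsDomain A] [IsPrincipalIdealRing A] {N : ℕ}
    (φ : (Fin (N + 1) → A) →ₗ[A] (Fin N → A)) (hφ : Function.Surjective φ) :
    ∃ a, LinearMap.ker φ = Submodule.span A {a} := by
  have h : Module.finrank A (LinearMap.ker φ) = 1 := by
    have h1 := Submodule.finrank_quotient_add_finrank (LinearMap.ker φ)
    rw [(φ.quotKerEquivOfSurjective hφ).finrank_eq] at h1
    simp at h1
    omega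
  obtain ⟨b⟩ := (finrank_eq_one_iff Unit).1 h
  refine ⟨b (), le_antisymm (fun x hx => ?_) ?_⟩
  · have h1 := b.sum_repr ⟨x, hx⟩
    rw [Fintype.sum_unique] at h1
    exact Submodule.mem_span_singleton.2 ⟨_, congrArg Subtype.val h1⟩
  · rw [Submodule.span_singleton_le_iff_mem]
    exact (b ()).2

theorem X_mem_grading (i : Fin n) : MvPolynomial.X i ∈ grading A n 1 :=
  MvPolynomial.isHomogeneous_X A i

theorem awayMap_surjective (hφ : Function.Surjective φ) (i : Fin n) :
    Function.Surjective (Away.map (symHom φ) (MvPolynomial.X i)) := by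
  obtain ⟨σ, hσ⟩ := exists_section_of_surjective φ hφ
  intro z
  have hX := X_mem_grading (A := A) i
  obtain ⟨d, q, hq, rfl⟩ := Away.mk_surjective (grading A m) ((symHom φ).map_mem hX) z
  have hq' : symAlgHom σ q ∈ grading A n (d • 1) := symAlgHom_isHomogeneous σ hq
  refine ⟨Away.mk (grading A n) hX d (symAlgHom σ q) hq', ?_⟩
  rw [Away.map_mk]
  congr 1
  exact symAlgHom_comp_section φ hσ q

theorem ker_awayMap (hφ : Function.Surjective φ) (a : Fin n → A) (ha : LinearMap.ker φ = Submodule.span A {a}) (i : Fin n) :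
    RingHom.ker (Away.map (symHom φ) (MvPolynomial.X i)) =
      Ideal.span {Away.mk (grading A n) (X_mem_grading i) 1 (linearForm a)
        (by simpa using linearForm_mem a)} := by
  have hX := X_mem_grading (A := A) i
  apply le_antisymm
  · intro z hz
    obtain ⟨d, p, hp, rfl⟩ := Away.mk_surjective (grading A n) hX z
    rw [RingHom.mem_ker, Away.map_mk, HomogeneousLocalization.ext_iff_val, Away.val_mk,
      HomogeneousLocalization.val_zero, Localization.mk_eq_mk', IsLocalization.mk'_eq_zero_iff] at hz
    obtain ⟨⟨_, k, rfl⟩, hk⟩ := hz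
    -- One factor X_i more than necessary is used: it keeps the degree at least 1, so that the
    -- cofactor of the linear form has degree k + d in the natural numbers.
    have hk' : (MvPolynomial.X i ^ (k + 1) * p : MvPolynomial (Fin n) A) ∈
        RingHom.ker (symAlgHom φ) := by
      rw [pow_succ', mul_assoc]
      refine Ideal.mul_mem_left _ _ ?_
      rw [RingHom.mem_ker, map_mul, map_pow]
      exact hk
    rw [ker_symAlgHom φ hφ a ha, Ideal.mem_span_singleton] at hk'
    obtain ⟨q, hq⟩ := hk'
    have hp' : (MvPolynomial.X i ^ (k + 1) * p).IsHomogeneous (k + d + 1) := by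
      have := ((MvPolynomial.isHomogeneous_X A i).pow (k + 1)).mul (hp : p.IsHomogeneous _)
      convert this using 1
      simp; ring
    -- The cofactor need not be homogeneous; its component of the right degree serves.
    obtain ⟨q', hq', hqq⟩ : ∃ q' : MvPolynomial (Fin n) A, q'.IsHomogeneous (k + d) ∧
        MvPolynomial.X i ^ (k + 1) * p = linearForm a * q' := by
      refine ⟨DirectSum.decompose (grading A n) q (k + d),
        (DirectSum.decompose (grading A n) q (k + d)).2, ?_⟩
      rw [← DirectSum.coe_decompose_mul_add_of_left_mem (grading A n) (linearForm_mem a), ← hq,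
        add_comm 1]
      exact (DirectSum.decompose_of_mem_same (grading A n) hp').symm
    rw [Ideal.mem_span_singleton]
    refine ⟨Away.mk (grading A n) hX (k + d) q' (by simpa using hq'), ?_⟩
    rw [HomogeneousLocalization.ext_iff_val, HomogeneousLocalization.val_mul, Away.val_mk,
      Away.val_mk, Away.val_mk, Localization.mk_mul, Localization.mk_eq_mk_iff,
      Localization.r_iff_exists]
    refine ⟨1, ?_⟩
    simp only [OneMemClass.coe_one, one_mul, Submonoid.coe_mul, ← hqq]
    ring
  · rw [Ideal.span_singleton_le_iff_mem, RingHom.mem_ker, Away.map_mk]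
    have h1 : symHom φ (linearForm a) = 0 :=
      RingHom.mem_ker.1 ((ker_symAlgHom φ hφ a ha).ge (Ideal.mem_span_singleton_self _))
    rw [HomogeneousLocalization.ext_iff_val, Away.val_mk, h1, Localization.mk_zero,
      HomogeneousLocalization.val_zero]

end HyperplaneEquation

/-! ### The hyperplane as a locally principal closed subscheme of projective space. -/

section HyperplaneScheme

theorem iSup_basicOpen_X (A : Type u) [CommRing A] (n : ℕ) :
    ⨆ i, Proj.basicOpen (grading A n) (MvPolynomial.X i) = ⊤ := by
  refine Proj.iSup_basicOpen_eq_top' _ _ (fun i => ⟨1, X_mem_grading i⟩) ?_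
  rw [eq_top_iff]
  intro p _
  have h : p ∈ Algebra.adjoin A (Set.range (MvPolynomial.X : Fin n → MvPolynomial (Fin n) A)) := by
    rw [MvPolynomial.adjoin_range_X]; trivial
  refine Algebra.adjoin_induction (fun x hx => Algebra.subset_adjoin hx) (fun a => ?_)
    (fun _ _ _ _ => add_mem) (fun _ _ _ _ => mul_mem) h
  exact Subalgebra.algebraMap_mem _ (⟨MvPolynomial.C a, MvPolynomial.isHomogeneous_C _ a⟩ : grading A n 0)

variable {A : Type u} [CommRing A] {N : ℕ} (φ : (Fin (N + 1) → A) →ₗ[A] (Fin N → A))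
  (hφ : Function.Surjective φ)

theorem awayToSection_comp_hyperplane_app (i : Fin (N + 1)) :
    Proj.awayToSection (grading A (N + 1)) (MvPolynomial.X i) ≫
      (hyperplane φ hφ).app (Proj.basicOpen (grading A (N + 1)) (MvPolynomial.X i)) =
    CommRingCat.ofHom (HomogeneousLocalization.Away.map (symHom φ) (MvPolynomial.X i)) ≫
      Proj.awayToSection (grading A N) (symHom φ (MvPolynomial.X i)) := by
  refine Eq.trans ?_ (Proj.awayToSection_comp_appLE (symHom φ) (irrelevant_le_map_symHom φ hφ)
    (X_mem_grading i))
  rw [Scheme.Hom.app_eq_appLE]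
  rfl

theorem isIso_awayToSection {n m : ℕ} {f : MvPolynomial (Fin n) A} (hf : f ∈ grading A n m)
    (hm : 0 < m) : IsIso (Proj.awayToSection (grading A n) f) := by
  rw [← Proj.basicOpenIsoAway_hom _ _ hf hm]
  infer_instance

theorem hyperplane_app_surjective (i : Fin (N + 1)) : Function.Surjective
    ((hyperplane φ hφ).app (Proj.basicOpen (grading A (N + 1)) (MvPolynomial.X i))) := by
  have h1 := isIso_awayToSection (X_mem_grading (A := A) i) Nat.one_pos
  have h2 := isIso_awayToSection ((symHom φ).map_mem (X_mem_grading (A := A) i)) Nat.one_pos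
  have h := awayToSection_comp_hyperplane_app φ hφ i
  have h3 : Function.Surjective (Proj.awayToSection (grading A (N + 1)) (MvPolynomial.X i) ≫
      (hyperplane φ hφ).app (Proj.basicOpen (grading A (N + 1)) (MvPolynomial.X i))) := by
    rw [h]
    exact (ConcreteCategory.bijective_of_isIso
      (Proj.awayToSection (grading A N) (symHom φ (MvPolynomial.X i)))).2.comp
      (awayMap_surjective φ hφ i)
  exact Function.Surjective.of_comp h3

theorem morphismRestrict_appTop_surjective {X Y : Scheme.{u}} (f : X ⟶ Y) (U : Y.Opens)
    (h : Function.Surjective (f.app U)) : Function.Surjective (f ∣_ U).appTop := by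
  rw [morphismRestrict_appTop]
  have hU : U.ι ''ᵁ ⊤ = U := by simp
  have h1 : Function.Surjective (f.app (U.ι ''ᵁ ⊤)) := hU.symm ▸ h
  exact (ConcreteCategory.bijective_of_isIso (X.presheaf.map _)).2.comp h1

instance isClosedImmersion_hyperplane : IsClosedImmersion (hyperplane φ hφ) := by
  refine (IsZariskiLocalAtTarget.iff_of_iSup_eq_top (P := @IsClosedImmersion) _
    (iSup_basicOpen_X A (N + 1))).2 fun i => ?_
  have h1 : IsAffine (Proj.basicOpen (grading A (N + 1)) (MvPolynomial.X i)) :=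
    Proj.isAffineOpen_basicOpen _ _ (X_mem_grading i) Nat.one_pos
  have h2 : IsAffine (hyperplane φ hφ ⁻¹ᵁ Proj.basicOpen (grading A (N + 1)) (MvPolynomial.X i)) :=
    Proj.isAffineOpen_basicOpen _ _ ((symHom φ).map_mem (X_mem_grading i)) Nat.one_pos
  exact IsClosedImmersion.of_surjective_of_isAffine _
    (morphismRestrict_appTop_surjective _ _ (hyperplane_app_surjective φ hφ i))

theorem ker_eq_map_ker_of_comp_eq {R₁ R₂ S₁ S₂ : Type*} [CommRing R₁] [CommRing R₂] [CommRing S₁]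
    [CommRing S₂] {f : R₁ →+* S₁} {g : R₂ →+* S₂} {α : R₁ →+* R₂} {β : S₁ →+* S₂}
    (h : g.comp α = β.comp f) (hα : Function.Surjective α) (hβ : Function.Injective β) :
    RingHom.ker g = (RingHom.ker f).map α := by
  rw [← RingHom.ker_comp_of_injective f hβ, ← h, ← RingHom.comap_ker,
    Ideal.map_comap_of_surjective _ hα]

/-- On the chart where x_i is invertible, the ideal is generated by (∑ a_j x_j)/x_i. -/
theorem exists_stalkIdeal_ker_hyperplane_eq [IsDomain A] [IsPrincipalIdealRing A]
    (y : projSpace A N) : ∃ f, stalkIdeal (hyperplane φ hφ).ker y = Ideal.span {f} := by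
  obtain ⟨a, ha⟩ := exists_ker_eq_span_singleton φ hφ
  have hy : y ∈ ⨆ i, Proj.basicOpen (grading A (N + 1)) (MvPolynomial.X i) := by
    rw [iSup_basicOpen_X]; trivial
  obtain ⟨i, hi⟩ := TopologicalSpace.Opens.mem_iSup.1 hy
  have hU : IsAffineOpen (Proj.basicOpen (grading A (N + 1)) (MvPolynomial.X i)) :=
    Proj.isAffineOpen_basicOpen _ _ (X_mem_grading i) Nat.one_pos
  have h1 := isIso_awayToSection (X_mem_grading (A := A) i) Nat.one_pos
  have h2 := isIso_awayToSection ((symHom φ).map_mem (X_mem_grading (A := A) i)) Nat.one_pos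
  have h : ((hyperplane φ hφ).app
      (Proj.basicOpen (grading A (N + 1)) (MvPolynomial.X i))).hom.comp
        (Proj.awayToSection (grading A (N + 1)) (MvPolynomial.X i)).hom =
      (Proj.awayToSection (grading A N) (symHom φ (MvPolynomial.X i))).hom.comp
        (HomogeneousLocalization.Away.map (symHom φ) (MvPolynomial.X i)) :=
    congrArg CommRingCat.Hom.hom (awayToSection_comp_hyperplane_app φ hφ i)
  have hk := ker_awayMap φ hφ a ha i
  have hker : RingHom.ker ((hyperplane φ hφ).app
      (Proj.basicOpen (grading A (N + 1)) (MvPolynomial.X i))).hom =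
      (RingHom.ker (HomogeneousLocalization.Away.map (symHom φ) (MvPolynomial.X i))).map
        (Proj.awayToSection (grading A (N + 1)) (MvPolynomial.X i)).hom := by
    have hinj := (ConcreteCategory.bijective_of_isIso
      (Proj.awayToSection (grading A N) (symHom φ (MvPolynomial.X i)))).1
    have hsurj := (ConcreteCategory.bijective_of_isIso
      (Proj.awayToSection (grading A (N + 1)) (MvPolynomial.X i))).2
    exact ker_eq_map_ker_of_comp_eq h hsurj hinj
  rw [stalkIdeal_eq _ hU hi, Scheme.Hom.ker_apply, hker, hk, Ideal.map_span, Set.image_singleton,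
    Ideal.map_span, Set.image_singleton]
  exact ⟨_, rfl⟩

theorem algebraMap_grading_zero_surjective (A : Type u) [CommRing A] (n : ℕ) :
    Function.Surjective (algebraMap A (grading A n 0)) := by
  rintro ⟨p, hp⟩
  have hp' : p.IsHomogeneous 0 := hp
  refine ⟨p.coeff 0, Subtype.ext ?_⟩
  exact (MvPolynomial.totalDegree_eq_zero_iff_eq_C.1 
    ((MvPolynomial.totalDegree_zero_iff_isHomogeneous _).2 hp')).symm

instance locallyOfFiniteType_projStr : LocallyOfFiniteType (projStr A N) := by
  have h1 : Algebra.FiniteType (grading A (N + 1) 0) (MvPolynomial (Fin (N + 1)) A) :=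
    RingHom.FiniteType.of_comp_finiteType (f := algebraMap A (grading A (N + 1) 0))
      (g := algebraMap (grading A (N + 1) 0) (MvPolynomial (Fin (N + 1)) A))
      (RingHom.finiteType_algebraMap.2 inferInstance :
        (algebraMap A (MvPolynomial (Fin (N + 1)) A)).FiniteType)
  have h2 : LocallyOfFiniteType
      (Spec.map (CommRingCat.ofHom (algebraMap A (grading A (N + 1) 0)))) := by
    rw [HasRingHomProperty.Spec_iff (P := @LocallyOfFiniteType)]
    exact RingHom.FiniteType.of_surjective _ (algebraMap_grading_zero_surjective A _)
  unfold projStr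
  infer_instance

end HyperplaneScheme

end Bertini

/-! ### The Jacobian criterion and derivations dual to parameters. -/

namespace Bertini

section Jacobian
open TensorProduct KaehlerDifferential IsLocalRing

theorem formallySmooth_of_localization_mvPolynomial {R P : Type u} [CommRing R] [CommRing P] {n : ℕ}
    [Algebra (MvPolynomial (Fin n) R) P] [Algebra R P] [IsScalarTower R (MvPolynomial (Fin n) R) P]
    (M : Submonoid (MvPolynomial (Fin n) R)) [IsLocalization M P] :
    Algebra.FormallySmooth R P ∧ Module.Free P Ω[P⁄R] ∧ Module.Finite P Ω[P⁄R] := by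
  have : Algebra.FormallyEtale (MvPolynomial (Fin n) R) P := .of_isLocalization M
  refine ⟨.comp _ (MvPolynomial (Fin n) R) _, .of_equiv
    (KaehlerDifferential.tensorKaehlerEquivOfFormallyEtale R (MvPolynomial (Fin n) R) P),
    .equiv (KaehlerDifferential.tensorKaehlerEquivOfFormallyEtale R (MvPolynomial (Fin n) R) P)⟩

theorem formallySmooth_of_formallyEtale {R P P' : Type u} [CommRing R] [CommRing P] [CommRing P']
    [Algebra R P] [Algebra P P'] [Algebra R P'] [IsScalarTower R P P'] [Algebra.FormallyEtale P P']
    [Algebra.FormallySmooth R P] [Module.Free P Ω[P⁄R]] [Module.Finite P Ω[P⁄R]] :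
    Algebra.FormallySmooth R P' ∧ Module.Free P' Ω[P'⁄R] ∧ Module.Finite P' Ω[P'⁄R] :=
  ⟨.comp _ P _, .of_equiv (KaehlerDifferential.tensorKaehlerEquivOfFormallyEtale R P P'),
    .equiv (KaehlerDifferential.tensorKaehlerEquivOfFormallyEtale R P P')⟩

/-- Differentials of P' over R are those of P extended to P', because P' is formally étale over P.
-/
theorem exists_derivation_extend {R P P' N : Type u} [CommRing R] [CommRing P] [CommRing P']
    [Algebra R P] [Algebra P P'] [Algebra R P'] [IsScalarTower R P P'] [Algebra.FormallyEtale P P']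
    [AddCommGroup N] [Module P' N] [Module P N] [Module R N] [IsScalarTower P P' N]
    [IsScalarTower R P' N] [IsScalarTower R P N]
    (d : Derivation R P N) : ∃ δ : Derivation R P' N, ∀ x, δ (algebraMap P P' x) = d x := by
  let e := KaehlerDifferential.tensorKaehlerEquivOfFormallyEtale R P P'
  let l : Ω[P'⁄R] →ₗ[P'] N :=
    (LinearMap.liftBaseChange P' d.liftKaehlerDifferential) ∘ₗ e.symm.toLinearMap
  refine ⟨l.compDer (KaehlerDifferential.D R P'), fun i => ?_⟩
  simp [l, e, KaehlerDifferential.tensorKaehlerEquivOfFormallyEtale_symm_D_algebraMap]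

theorem tmul_D_eq_zero_of_mem_sq {R P K : Type u} [CommRing R] [CommRing P] [IsLocalRing P]
    [Algebra R P] [Field K] [Algebra P K]
    (hK : maximalIdeal P ≤ RingHom.ker (algebraMap P K)) {y : P} (hy : y ∈ maximalIdeal P ^ 2) :
    (1 : K) ⊗ₜ[P] KaehlerDifferential.D R P y = 0 := by
  rw [pow_two] at hy
  refine Submodule.mul_induction_on hy (fun a ha b hb => ?_) (fun a b ha hb => ?_)
  · rw [Derivation.leibniz, TensorProduct.tmul_add, ← TensorProduct.smul_tmul,
      ← TensorProduct.smul_tmul, Algebra.smul_def, Algebra.smul_def, RingHom.mem_ker.1 (hK ha),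
      RingHom.mem_ker.1 (hK hb)]
    simp
  · rw [map_add, TensorProduct.tmul_add, ha, hb, add_zero]

variable {R P S K : Type u} [CommRing R] [CommRing P] [CommRing S] [IsLocalRing S] [Field K]
  [Algebra R P] [Algebra P S] [Algebra R S] [IsScalarTower R P S] [Algebra S K] [Algebra P K]
  [IsScalarTower P S K] [Algebra.FormallySmooth R P] [Module.Free P Ω[P⁄R]] [Module.Finite P Ω[P⁄R]]

/-- The Jacobian criterion for smoothness in terms of derivations. -/
theorem formallySmooth_of_derivation [Algebra R K] [IsScalarTower R P K]
    (hS : Function.Surjective (algebraMap P S))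
    (hK : maximalIdeal S ≤ RingHom.ker (algebraMap S K)) {ι : Type} [Finite ι] (g : ι → P)
    (hg : RingHom.ker (algebraMap P S) = Ideal.span (Set.range g))
    (δ : ι → Derivation R P K)
    (hδ : ∀ a : ι →₀ K, (∀ i, (a.sum fun j r => r * δ i (g j)) = 0) → a = 0) :
    Algebra.FormallySmooth R S := by
  -- Smoothness means that J/J² injects into the differentials after base change to K, where J is
  -- the kernel. A kernel element is a combination of the g_j, and the derivations detect its
  -- coefficients.
  rw [Algebra.FormallySmooth.iff_injective_cotangentComplexBaseChange (R := R) P K hS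
    (by rw [hg]; exact ⟨(Set.finite_range g).toFinset, by simp⟩) hK, injective_iff_map_eq_zero]
  intro x hx
  have hgm : ∀ j, g j ∈ RingHom.ker (algebraMap P S) := fun j => by
    rw [hg]; exact Ideal.subset_span ⟨j, rfl⟩
  let g' : ι → RingHom.ker (algebraMap P S) := fun j => ⟨g j, hgm j⟩
  have hspan : Submodule.span P (Set.range g') = ⊤ := by
    rw [eq_top_iff]
    rintro ⟨y, hy⟩ -
    rw [hg] at hy
    obtain ⟨c, hc⟩ := (Finsupp.mem_span_range_iff_exists_finsupp).1 hy
    refine (Finsupp.mem_span_range_iff_exists_finsupp).2 ⟨c, Subtype.ext ?_⟩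
    refine Eq.trans ?_ hc
    simp [Finsupp.sum, g']
  have hspan' : Submodule.span K (Set.range fun j => (1 : K) ⊗ₜ[P] g' j) = ⊤ := by
    have := Submodule.baseChange_span (R := P) (A := K) (Set.range g')
    rw [hspan, Submodule.baseChange_top, ← Set.range_comp] at this
    exact this.symm
  obtain ⟨a, rfl⟩ := (Finsupp.mem_span_range_iff_exists_finsupp).1
    (hspan'.ge (Submodule.mem_top (x := x)))
  have ha : a = 0 := by
    refine hδ a fun i => ?_
    have := congrArg (LinearMap.liftBaseChange K (δ i).liftKaehlerDifferential) hx
    rw [map_zero, map_finsuppSum, map_finsuppSum] at this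
    rw [← this]
    refine Finsupp.sum_congr fun j _ => ?_
    rw [map_smul, map_smul, cotangentComplexBaseChange_tmul]
    simp [g']
  simp [ha]

theorem mem_maximalIdeal_smul_of_tmul_eq_zero {P K M : Type u} [CommRing P] [IsLocalRing P]
    [Field K] [Algebra P K] (hK : Function.Surjective (algebraMap P K)) [AddCommGroup M]
    [Module P M] {x : M} (h : (1 : K) ⊗ₜ[P] x = 0) : x ∈ maximalIdeal P • (⊤ : Submodule P M) := by
  have hker : RingHom.ker (algebraMap P K) = maximalIdeal P :=
    IsLocalRing.eq_maximalIdeal (RingHom.ker_isMaximal_of_surjective _ hK)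
  let e : (P ⧸ maximalIdeal P) ≃ₗ[P] K :=
    ((Ideal.quotientEquivAlgOfEq P hker.symm).trans
      (Ideal.quotientKerAlgEquivOfSurjective (f := Algebra.ofId P K) hK)).toLinearEquiv
  have h2 : (e.symm.rTensor M) ((1 : K) ⊗ₜ[P] x) = (1 : P ⧸ maximalIdeal P) ⊗ₜ[P] x := by
    simp only [LinearEquiv.rTensor_tmul]
    congr 1
    rw [LinearEquiv.symm_apply_eq]
    exact (map_one ((Ideal.quotientEquivAlgOfEq P hker.symm).trans
      (Ideal.quotientKerAlgEquivOfSurjective (f := Algebra.ofId P K) hK))).symm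
  rw [h, map_zero] at h2
  have h3 := congrArg (TensorProduct.quotTensorEquivQuotSMul M (maximalIdeal P)) h2
  rw [map_zero] at h3
  have h4 : TensorProduct.quotTensorEquivQuotSMul M (maximalIdeal P)
      ((1 : P ⧸ maximalIdeal P) ⊗ₜ[P] x) = Submodule.Quotient.mk x := by
    exact (TensorProduct.quotTensorEquivQuotSMul_mk_tmul (maximalIdeal P) (1 : P) x).trans
      (congrArg _ (one_smul P x))
  rw [h4] at h3
  exact (Submodule.Quotient.mk_eq_zero _).1 h3.symm

theorem algebraMap_residueField_surjective (hS : Function.Surjective (algebraMap P S)) :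
    Function.Surjective (algebraMap P (ResidueField S)) := by
  rw [IsScalarTower.algebraMap_eq P S (ResidueField S)]
  exact residue_surjective.comp hS

section
variable [IsRegularLocalRing P]

/-- For a smooth quotient, an element of the kernel J with vanishing differential at the closed
point has zero class in J/mJ. -/
theorem mem_smul_of_D_eq_zero (hS : Function.Surjective (algebraMap P S))
    (h : Algebra.FormallySmooth R S) {y : P} (hy : y ∈ RingHom.ker (algebraMap P S))
    (hD : (1 : ResidueField S) ⊗ₜ[P] KaehlerDifferential.D R P y = 0) :
    y ∈ maximalIdeal P * RingHom.ker (algebraMap P S) := by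
  rw [Algebra.FormallySmooth.iff_injective_cotangentComplexBaseChange_residueField (R := R) P hS
    (IsNoetherian.noetherian _), injective_iff_map_eq_zero] at h
  have h1 := h ((1 : ResidueField S) ⊗ₜ[P] ⟨y, hy⟩) (by
    rw [cotangentComplexBaseChange_tmul, one_smul]
    exact hD)
  have h2 := mem_maximalIdeal_smul_of_tmul_eq_zero (algebraMap_residueField_surjective hS) h1
  have h3 := Submodule.mem_map_of_mem (f := (RingHom.ker (algebraMap P S)).subtype) h2
  rw [Submodule.map_smul'', Submodule.map_top, Submodule.range_subtype] at h3
  exact h3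

/-- A formally smooth local quotient of a regular local ring that is formally smooth over the base
is regular. -/
theorem isRegularLocalRing_of_formallySmooth
    (hS : Function.Surjective (algebraMap P S)) (h : Algebra.FormallySmooth R S) :
    IsRegularLocalRing S := by
  set J := RingHom.ker (algebraMap P S) with hJ
  have hJm : J ≤ maximalIdeal P := by
    refine le_maximalIdeal (RingHom.ker_ne_top _)
  obtain ⟨c, k, u, s, hu, hJu, hspan, hck⟩ := IsLocalRing.exists_generators_adapted J hJm
  have hker : RingHom.ker (algebraMap P (ResidueField S)) = maximalIdeal P :=
    IsLocalRing.eq_maximalIdeal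
      (RingHom.ker_isMaximal_of_surjective _ (algebraMap_residueField_surjective hS))
  -- Write x = a + b with a in (u) and b in m². Then b lies in J and has zero differential at the
  -- closed point, so it lies in mJ; by Nakayama the parameters u generate J.
  have hle : J ≤ Ideal.span (Set.range u) ⊔ maximalIdeal P * J := by
    intro x hx
    obtain ⟨a, ha, b, hb, rfl⟩ := Submodule.mem_sup.1 (hJu hx)
    have haJ : a ∈ J := (Ideal.span_le.2 (by rintro _ ⟨i, rfl⟩; exact hu i)) ha
    have hbJ : b ∈ J := by simpa using sub_mem hx haJ
    exact add_mem (Ideal.mem_sup_left ha) (Ideal.mem_sup_right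
      (mem_smul_of_D_eq_zero (R := R) hS h hbJ (tmul_D_eq_zero_of_mem_sq hker.ge hb)))
  have hJeq : J = Ideal.span (Set.range u) := by
    apply le_antisymm
    · refine Submodule.le_of_le_smul_of_le_jacobson_bot (IsNoetherian.noetherian J)
        (IsLocalRing.maximalIdeal_le_jacobson _) ?_
      exact hle
    · exact Ideal.span_le.2 (by rintro _ ⟨i, rfl⟩; exact hu i)
  have hu' : IsPartRSP u := ⟨k, s, hspan, by
    rw [← (isRegularLocalRing_iff P).1 inferInstance, ← hck]
    simp⟩
  have := isNoetherianRing_of_surjective P S _ hS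
  exact (IsPartRSP.of_surjective hu'.sumEmpty (algebraMap P S) hS hJeq).1.isRegularLocalRing

/-- Linear independence of parameters modulo m²: if a_i were a unit, t_i would be superfluous by
Nakayama, leaving fewer generators of the maximal ideal than the dimension. -/
theorem _root_.IsPartRSP.mem_maximalIdeal_of_sum_mem_sq {R : Type*} [CommRing R] [IsLocalRing R]
    [IsNoetherianRing R] {ι : Type*} [Fintype ι] {t : ι → R} (h : IsPartRSP t) (a : ι → R)
    (ha : ∑ i, a i * t i ∈ maximalIdeal R ^ 2) (i : ι) : a i ∈ maximalIdeal R := by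
  classical
  by_contra hi
  rw [IsLocalRing.mem_maximalIdeal, mem_nonunits_iff, not_not] at hi
  obtain ⟨k, s, hs, hd⟩ := h
  let t' : {j // j ≠ i} → R := fun j => t j
  let I := Ideal.span (Set.range (Sum.elim t' s))
  have hti : t i ∈ I ⊔ maximalIdeal R • maximalIdeal R := by
    have h1 : a i * t i ∈ I ⊔ maximalIdeal R • maximalIdeal R := by
      rw [← Finset.add_sum_erase _ _ (Finset.mem_univ i)] at ha
      have h2 : ∑ j ∈ Finset.univ.erase i, a j * t j ∈ I := Ideal.sum_mem _ fun j hj =>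
        Ideal.mul_mem_left _ _ (Ideal.subset_span ⟨Sum.inl ⟨j, Finset.ne_of_mem_erase hj⟩, rfl⟩)
      have h3 := sub_mem (Ideal.mem_sup_right ha : _ ∈ I ⊔ maximalIdeal R ^ 2) (Ideal.mem_sup_left h2)
      rw [add_sub_cancel_right, pow_two] at h3
      exact h3
    exact (Ideal.unit_mul_mem_iff_mem _ hi).1 h1
  have hIm : I ≤ maximalIdeal R := by
    rw [← hs]
    refine Ideal.span_mono ?_
    rintro _ ⟨j | j, rfl⟩
    · exact Or.inl ⟨j, rfl⟩
    · exact Or.inr ⟨j, rfl⟩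
  have hle : maximalIdeal R ≤ I ⊔ maximalIdeal R • maximalIdeal R := by
    conv_lhs => rw [← hs]
    refine Ideal.span_le.2 ?_
    rintro _ (⟨j, rfl⟩ | ⟨j, rfl⟩)
    · by_cases hj : j = i
      · rw [hj]; exact hti
      · exact Ideal.mem_sup_left (Ideal.subset_span ⟨Sum.inl ⟨j, hj⟩, rfl⟩)
    · exact Ideal.mem_sup_left (Ideal.subset_span ⟨Sum.inr j, rfl⟩)
  have hI : I = maximalIdeal R := le_antisymm hIm
    (Submodule.le_of_le_smul_of_le_jacobson_bot (IsNoetherian.noetherian _)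
      (IsLocalRing.maximalIdeal_le_jacobson _) hle)
  have h1 := IsLocalRing.spanFinrank_maximalIdeal_le_of_span_eq _ hI
  have h2 := ringKrullDim_le_spanFinrank_maximalIdeal R
  rw [hd] at h2
  have h3 : Nat.card ι + k ≤ Nat.card ({j // j ≠ i} ⊕ Fin k) := by
    refine le_trans ?_ h1
    exact_mod_cast h2
  rw [Nat.card_sum, Nat.card_eq_fintype_card, Nat.card_eq_fintype_card, Nat.card_eq_fintype_card,
    Fintype.card_subtype_compl, Fintype.card_fin] at h3
  have : 0 < Fintype.card ι := Fintype.card_pos_iff.2 ⟨i⟩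
  simp at h3
  omega

/-- A relation between the differentials lifts to ∑ a_j g_j with zero differential at the closed
point. This sum lies in mJ, hence in m², so all a_j lie in m. -/
theorem linearIndependent_tmul_D (hS : Function.Surjective (algebraMap P S))
    (h : Algebra.FormallySmooth R S) {ι : Type} [Fintype ι] (g : ι → P) (hg : IsPartRSP g)
    (hker : RingHom.ker (algebraMap P S) = Ideal.span (Set.range g)) :
    LinearIndependent (ResidueField S)
      fun j => (1 : ResidueField S) ⊗ₜ[P] KaehlerDifferential.D R P (g j) := by
  have hκ := algebraMap_residueField_surjective hS
  have hkerκ : RingHom.ker (algebraMap P (ResidueField S)) = maximalIdeal P :=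
    IsLocalRing.eq_maximalIdeal (RingHom.ker_isMaximal_of_surjective _ hκ)
  rw [Fintype.linearIndependent_iff]
  intro c hc
  choose a ha using fun i => hκ (c i)
  have hgJ : ∀ j, g j ∈ RingHom.ker (algebraMap P S) := fun j => by
    rw [hker]; exact Ideal.subset_span ⟨j, rfl⟩
  have hy : ∑ j, a j * g j ∈ RingHom.ker (algebraMap P S) :=
    Ideal.sum_mem _ fun j _ => Ideal.mul_mem_left _ _ (hgJ j)
  have hD : (1 : ResidueField S) ⊗ₜ[P] KaehlerDifferential.D R P (∑ j, a j * g j) = 0 := by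
    rw [← hc, map_sum, TensorProduct.tmul_sum]
    refine Finset.sum_congr rfl fun j _ => ?_
    have h1 : algebraMap P (ResidueField S) (g j) = 0 := by
      rw [IsScalarTower.algebraMap_apply P S, RingHom.mem_ker.1 (hgJ j), map_zero]
    rw [Derivation.leibniz, TensorProduct.tmul_add, ← TensorProduct.smul_tmul,
      ← TensorProduct.smul_tmul, Algebra.smul_def, Algebra.smul_def, h1, ha, zero_mul,
      TensorProduct.zero_tmul, add_zero, mul_one, TensorProduct.smul_tmul', smul_eq_mul, mul_one]
  have h2 := mem_smul_of_D_eq_zero (R := R) hS h hy hD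
  have h3 : ∑ j, a j * g j ∈ maximalIdeal P ^ 2 := by
    rw [pow_two]
    exact Ideal.mul_mono_right (le_maximalIdeal (RingHom.ker_ne_top _)) h2
  intro i
  rw [← ha i]
  exact RingHom.mem_ker.1 (hkerκ.ge (hg.mem_maximalIdeal_of_sum_mem_sq a h3 i))

theorem exists_dual_derivation [Algebra R (ResidueField S)] [IsScalarTower R P (ResidueField S)]
    (hS : Function.Surjective (algebraMap P S))
    (h : Algebra.FormallySmooth R S) {ι : Type} [Fintype ι] [DecidableEq ι] (g : ι → P)
    (hg : IsPartRSP g) (hker : RingHom.ker (algebraMap P S) = Ideal.span (Set.range g)) :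
    ∃ δ : ι → Derivation R P (ResidueField S), ∀ i j, δ i (g j) = if i = j then 1 else 0 := by
  have hv := linearIndependent_tmul_D hS h g hg hker
  choose f hf using fun i => LinearMap.exists_extend (p := Submodule.span (ResidueField S)
    (Set.range fun j => (1 : ResidueField S) ⊗ₜ[P] KaehlerDifferential.D R P (g j)))
    ((Finsupp.lapply i : (ι →₀ ResidueField S) →ₗ[ResidueField S] ResidueField S) ∘ₗ
      hv.repr)
  refine ⟨fun i => (((f i).restrictScalars P) ∘ₗ
    TensorProduct.mk P (ResidueField S) Ω[P⁄R] 1).compDer (KaehlerDifferential.D R P), ?_⟩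
  intro i j
  have h1 := congrArg (fun t => t ⟨_, Submodule.subset_span ⟨j, rfl⟩⟩) (hf i)
  simp only [LinearMap.comp_apply, Submodule.subtype_apply] at h1
  refine Eq.trans h1 ?_
  rw [hv.repr_eq_single j _ rfl, Finsupp.lapply_apply,
    Finsupp.single_apply]
  simp [eq_comm]

end

end Jacobian
end Bertini

/-! ### Smoothness outside π = 0 when π is a product of parameters. -/

namespace Bertini

section GenericSmoothness
open TensorProduct KaehlerDifferential IsLocalRing

/-- Derivations dual to the parameters exist on C₀ with values in the residue field, since S₀ is
smooth. As the differentials of C are projective, these lift to derivations of C into itself. -/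
theorem exists_dual_derivation_of_residue {A F C C₀ S₀ : Type u} [CommRing A] [Field F] [Algebra A F]
    [CommRing C] [IsLocalRing C] [Algebra A C] [Module.Projective C Ω[C⁄A]]
    [CommRing C₀] [IsRegularLocalRing C₀] [Algebra F C₀] [Algebra.FormallySmooth F C₀]
    [Module.Free C₀ Ω[C₀⁄F]] [Module.Finite C₀ Ω[C₀⁄F]]
    [Algebra C C₀] [Algebra A C₀] [IsScalarTower A C C₀] [IsScalarTower A F C₀]
    (hC : Function.Surjective (algebraMap C C₀))
    [CommRing S₀] [IsLocalRing S₀] [Algebra C₀ S₀] [Algebra F S₀] [IsScalarTower F C₀ S₀]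
    (hS : Function.Surjective (algebraMap C₀ S₀)) (hsm : Algebra.FormallySmooth F S₀)
    {κ : Type} [Fintype κ] [DecidableEq κ] (h : κ → C)
    (hh : IsPartRSP fun j => algebraMap C C₀ (h j))
    (hker : RingHom.ker (algebraMap C₀ S₀) = Ideal.span (Set.range fun j => algebraMap C C₀ (h j))) :
    ∃ δ : κ → Derivation A C C, ∀ i j, δ i (h j) = if i = j then 1 else 0 := by
  obtain ⟨δ₀, hδ₀⟩ := exists_dual_derivation (R := F) hS hsm _ hh hker
  let K := ResidueField S₀
  let _ : Algebra C K := ((algebraMap C₀ K).comp (algebraMap C C₀)).toAlgebra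
  have : IsScalarTower C C₀ K := .of_algebraMap_eq fun _ => rfl
  let _ : Algebra A K := ((algebraMap C K).comp (algebraMap A C)).toAlgebra
  have : IsScalarTower A C K := .of_algebraMap_eq fun _ => rfl
  have : IsScalarTower A C₀ K := .of_algebraMap_eq fun a => by
    change algebraMap C₀ K (algebraMap C C₀ (algebraMap A C a)) = _
    rw [← IsScalarTower.algebraMap_apply A C C₀]
  have : IsScalarTower A F K := .of_algebraMap_eq fun a => by
    rw [IsScalarTower.algebraMap_apply A C₀ K, IsScalarTower.algebraMap_apply A F C₀,
      ← IsScalarTower.algebraMap_apply F C₀ K]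
  have hCK : Function.Surjective (algebraMap C K) :=
    (algebraMap_residueField_surjective hS).comp hC
  have hkerK : RingHom.ker (algebraMap C K) = maximalIdeal C :=
    IsLocalRing.eq_maximalIdeal (RingHom.ker_isMaximal_of_surjective _ hCK)
  let d : κ → Derivation A C K := fun i => ((δ₀ i).restrictScalars A).compAlgebraMap C
  choose l hl using fun i => Module.projective_lifting_property (Algebra.linearMap C K)
    (d i).liftKaehlerDifferential hCK
  let δ₁ : κ → Derivation A C C := fun i => (l i).compDer (KaehlerDifferential.D A C)
  let M : Matrix κ κ C := fun i j => δ₁ i (h j)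
  have hM : ∀ i j, algebraMap C K (M i j) = if i = j then 1 else 0 := fun i j => by
    rw [← hδ₀ i j]
    exact (LinearMap.congr_fun (hl i) (KaehlerDifferential.D A C (h j))).trans
      ((d i).liftKaehlerDifferential_comp_D _)
  have hdet : IsUnit M.det := by
    by_contra hdet
    have h1 : algebraMap C K M.det = 0 := RingHom.mem_ker.1 (hkerK.ge hdet)
    rw [RingHom.map_det] at h1
    have h2 : (algebraMap C K).mapMatrix M = 1 := by
      ext i j
      simp [hM, Matrix.one_apply]
    rw [h2, Matrix.det_one] at h1
    exact one_ne_zero h1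
  -- The matrix of lifted derivations on h is the identity modulo the maximal ideal, so it is
  -- invertible; its inverse corrects them to be exactly dual.
  refine ⟨fun i => (∑ k, M⁻¹ i k • l k).compDer (KaehlerDifferential.D A C), fun i j => ?_⟩
  refine (LinearMap.sum_apply _ _ _).trans ?_
  have h1 := congrFun (congrFun (Matrix.nonsing_inv_mul M hdet) i) j
  rw [Matrix.mul_apply, Matrix.one_apply] at h1
  exact h1

/-- The Jacobian criterion at a point Q other than the closed one: C is localized at the preimage of
Q, and the derivations are extended to that localization with values in the residue field. -/
theorem formallySmooth_localization_of_derivation {A C S S' : Type u} [CommRing A]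
    [CommRing C] [Algebra A C] [Algebra.FormallySmooth A C] [Module.Free C Ω[C⁄A]]
    [Module.Finite C Ω[C⁄A]] [CommRing S] [Algebra A S] [Algebra C S] [IsScalarTower A C S]
    (hS : Function.Surjective (algebraMap C S)) (Q : Ideal S) [Q.IsPrime] [CommRing S'] [Algebra S S']
    [IsLocalization.AtPrime S' Q] [Algebra A S'] [IsScalarTower A S S'] {ι : Type} [Fintype ι] (g : ι → C)
    (hg : RingHom.ker (algebraMap C S) = Ideal.span (Set.range g)) (δ : ι → Derivation A C C)
    (hδ : ∀ (K : Type u) [Field K] [Algebra S K] (_ : RingHom.ker (algebraMap S K) = Q) (a : ι → K),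
      (∀ i, ∑ j, a j * algebraMap S K (algebraMap C S (δ i (g j))) = 0) → a = 0) :
    Algebra.FormallySmooth A S' := by
  have := IsLocalization.AtPrime.isLocalRing S' Q
  let q : Ideal C := Q.comap (algebraMap C S)
  let C' := Localization.AtPrime q
  let K := ResidueField S'
  let φ : C' →+* S' := IsLocalization.map S' (algebraMap C S) (M := q.primeCompl)
    (T := Q.primeCompl) (fun x hx => hx)
  have hmap : q.primeCompl.map (algebraMap C S) = Q.primeCompl := by
    ext y
    constructor
    · rintro ⟨x, hx, rfl⟩
      exact hx
    · intro hy
      obtain ⟨x, rfl⟩ := hS y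
      exact ⟨x, hy, rfl⟩
  have hφ : Function.Surjective φ := by
    intro y
    obtain ⟨b, s, rfl⟩ := IsLocalization.exists_mk'_eq Q.primeCompl y
    obtain ⟨b, rfl⟩ := hS b
    obtain ⟨s', hs'⟩ := hS s.1
    refine ⟨IsLocalization.mk' _ b (⟨s', fun hc => s.2 (hs' ▸ hc)⟩ : q.primeCompl), ?_⟩
    refine (IsLocalization.map_mk' _ _ _).trans (congrArg _ ?_)
    exact Subtype.ext hs'
  have hker : RingHom.ker φ = Ideal.span (Set.range fun j => algebraMap C C' (g j)) := by
    refine (IsLocalization.ker_map S' (algebraMap C S) hmap).trans ?_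
    rw [hg, Ideal.map_span, ← Set.range_comp]
    rfl
  let _ : Algebra C' S' := φ.toAlgebra
  let _ : Algebra C S' := ((algebraMap S S').comp (algebraMap C S)).toAlgebra
  have : IsScalarTower C S S' := .of_algebraMap_eq fun _ => rfl
  have : IsScalarTower C C' S' := .of_algebraMap_eq fun x => (IsLocalization.map_eq _ _).symm
  have : IsScalarTower A C S' := .of_algebraMap_eq fun a => by
    rw [IsScalarTower.algebraMap_apply A S S', IsScalarTower.algebraMap_apply A C S,
      ← IsScalarTower.algebraMap_apply C S S']
  have : IsScalarTower A C' S' := .of_algebraMap_eq fun a => by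
    rw [IsScalarTower.algebraMap_apply A C C', ← IsScalarTower.algebraMap_apply C C' S',
      ← IsScalarTower.algebraMap_apply A C S']
  have : Algebra.FormallyEtale C C' := .of_isLocalization q.primeCompl
  obtain ⟨h1, h2, h3⟩ := formallySmooth_of_formallyEtale (R := A) (P := C) (P' := C')
  let d : ι → Derivation A C K := fun i =>
    ((Algebra.linearMap C K) ∘ₗ (δ i).liftKaehlerDifferential).compDer (KaehlerDifferential.D A C)
  choose d' hd' using fun i => exists_derivation_extend (P' := C') (d i)
  have hK : maximalIdeal S' ≤ RingHom.ker (algebraMap S' K) := fun x hx =>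
    (residue_eq_zero_iff x).2 hx
  refine formallySmooth_of_derivation (P := C') (K := K) hφ hK _ hker d' fun a ha => ?_
  refine Finsupp.ext fun j => congrFun (hδ K ?_ (fun j => a j) fun i => ?_) j
  · ext x
    rw [RingHom.mem_ker, IsScalarTower.algebraMap_apply S S' K,
      ← IsLocalization.AtPrime.to_map_mem_maximal_iff S' Q x]
    exact residue_eq_zero_iff _
  · rw [← ha i, Finsupp.sum_fintype _ _ (fun _ => zero_mul _)]
    refine Finset.sum_congr rfl fun j _ => congrArg _ ?_
    rw [hd']
    change _ = algebraMap C K ((δ i).liftKaehlerDifferential (KaehlerDifferential.D A C (g j)))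
    rw [Derivation.liftKaehlerDifferential_comp_D, IsScalarTower.algebraMap_apply C S' K,
      IsScalarTower.algebraMap_apply C S S', ← IsScalarTower.algebraMap_apply S S' K]

theorem _root_.IsPartRSP.congr_span {R : Type*} [CommRing R] [IsLocalRing R] {ι κ : Type*}
    {t : ι → R} {t' : κ → R} (h : IsPartRSP t) (hc : Nat.card ι = Nat.card κ)
    (hs : Ideal.span (Set.range t) = Ideal.span (Set.range t')) : IsPartRSP t' := by
  obtain ⟨k, s, h1, h2⟩ := h
  exact ⟨k, s, by rw [← h1, Ideal.span_union, Ideal.span_union, hs], by rw [h2, hc]⟩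

theorem _root_.Derivation.map_prod_eq_zero {A C M : Type*} [CommRing A] [CommRing C] [Algebra A C]
    [AddCommGroup M] [Module A M] [Module C M] (δ : Derivation A C M) {ι : Type*} (s : Finset ι)
    (τ : ι → C) (h : ∀ i ∈ s, δ (τ i) = 0) : δ (∏ i ∈ s, τ i) = 0 := by
  classical
  induction s using Finset.induction_on with
  | empty => simp
  | insert i s hi ih =>
    rw [Finset.prod_insert hi, Derivation.leibniz, h i (Finset.mem_insert_self _ _),
      ih fun j hj => h j (Finset.mem_insert_of_mem hj), smul_zero, smul_zero, add_zero]

section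

variable {A F C C₀ S S₀ : Type u} [CommRing A] [Field F] [Algebra A F]
    [CommRing C] [IsRegularLocalRing C] [Algebra A C] [Algebra.FormallySmooth A C]
    [Module.Free C Ω[C⁄A]] [Module.Finite C Ω[C⁄A]]
    [CommRing C₀] [IsRegularLocalRing C₀] [Algebra F C₀] [Algebra.FormallySmooth F C₀]
    [Module.Free C₀ Ω[C₀⁄F]] [Module.Finite C₀ Ω[C₀⁄F]]
    [Algebra C C₀] [Algebra A C₀] [IsScalarTower A C C₀] [IsScalarTower A F C₀]
    [CommRing S] [IsRegularLocalRing S] [Algebra C S] [Algebra A S] [IsScalarTower A C S]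
    [CommRing S₀] [IsLocalRing S₀] [Algebra C₀ S₀] [Algebra F S₀] [IsScalarTower F C₀ S₀]
    [Algebra S S₀] [Algebra C S₀] [IsScalarTower C S S₀] [IsScalarTower C C₀ S₀]

/-- Write S = C/J. Generators of J are chosen so that, together with lifts τ of the t_i, they lead
to coordinates (u, τ) modulo π on which dual derivations exist. Off π = 0 the Jacobian matrix of J
is then invertible. -/
theorem formallySmooth_localization_of_prod_eq
    (hC : Function.Surjective (algebraMap C C₀)) (hS : Function.Surjective (algebraMap C S))
    (hS₀ : Function.Surjective (algebraMap S S₀))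
    (hsm : Algebra.FormallySmooth F S₀) (ϖ : A)
    (hϖ : RingHom.ker (algebraMap C C₀) = Ideal.span {algebraMap A C ϖ})
    {ι : Type} [Fintype ι] [Nonempty ι] (t : ι → S) (ht : IsPartRSP t)
    (hker : RingHom.ker (algebraMap S S₀) = Ideal.span (Set.range t))
    (hprod : algebraMap A S ϖ = ∏ i, t i)
    (Q : Ideal S) [Q.IsPrime] (hQ : algebraMap A S ϖ ∉ Q) (S' : Type u) [CommRing S'] [Algebra S S']
    [IsLocalization.AtPrime S' Q] [Algebra A S'] [IsScalarTower A S S'] :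
    Algebra.FormallySmooth A S' := by
  classical
  have := IsRegularLocalRing.isDomain S
  have := IsRegularLocalRing.isDomain C
  have hCS₀ : Function.Surjective (algebraMap C S₀) := by
    rw [IsScalarTower.algebraMap_eq C S S₀]; exact hS₀.comp hS
  have hC₀S₀ : Function.Surjective (algebraMap C₀ S₀) := by
    rw [IsScalarTower.algebraMap_eq C C₀ S₀] at hCS₀; exact .of_comp hCS₀
  have hϖS : algebraMap A S ϖ ≠ 0 := fun h => hQ (h ▸ Q.zero_mem)
  have hϖC : algebraMap A C ϖ ≠ 0 := fun h => hϖS (by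
    rw [IsScalarTower.algebraMap_apply A C S, h, map_zero])
  have hdim : ringKrullDim C₀ + (Nat.card Unit : ℕ) ≤ ringKrullDim C := by
    have h1 := ringKrullDim_quotient_succ_le_of_nonZeroDivisor (mem_nonZeroDivisors_of_ne_zero hϖC)
    rw [← hϖ, ringKrullDim_eq_of_ringEquiv (RingHom.quotientKerEquivOfSurjective hC)] at h1
    simpa using h1
  have hϖC₀ : RingHom.ker (algebraMap C C₀) =
      Ideal.span (Set.range fun _ : Unit => algebraMap A C ϖ) := by
    rw [hϖ, Set.range_const]
  -- Once π is split off as a parameter, the remaining generators cut out S₀ in C₀ = C/π, and dual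
  -- derivations can be lifted from there.
  have key : ∀ (κ : Type) [Fintype κ] (g : κ → C), IsPartRSP (Sum.elim (fun _ : Unit => algebraMap A C ϖ) g) →
      RingHom.ker (algebraMap C S₀) =
        Ideal.span (Set.range (Sum.elim (fun _ : Unit => algebraMap A C ϖ) g)) →
      ∃ δ : κ → Derivation A C C, ∀ i j, δ i (g j) = if i = j then 1 else 0 := by
    intro κ _ g hg hgker
    refine exists_dual_derivation_of_residue (F := F) hC hC₀S₀ hsm g
      (hg.of_surjective _ hC hϖC₀).1 ?_
    have h1 : RingHom.ker (algebraMap C₀ S₀) =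
        (RingHom.ker (algebraMap C S₀)).map (algebraMap C C₀) := by
      rw [IsScalarTower.algebraMap_eq C C₀ S₀, ← RingHom.comap_ker, Ideal.map_comap_of_surjective _ hC]
    rw [h1, hgker, Set.Sum.elim_range, Ideal.span_union, Ideal.map_sup, ← hϖC₀,
      (Ideal.map_eq_bot_iff_le_ker _).2 le_rfl, bot_sup_eq, Ideal.map_span, ← Set.range_comp]
    rfl
  have hcomap : ∀ τ : ι → C, (∀ i, algebraMap C S (τ i) = t i) → RingHom.ker (algebraMap C S₀) =
      Ideal.span (Set.range τ) ⊔ RingHom.ker (algebraMap C S) := by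
    intro τ hτ
    have h1 : (Ideal.span (Set.range τ)).map (algebraMap C S) = RingHom.ker (algebraMap S S₀) := by
      rw [hker, Ideal.map_span, ← Set.range_comp]
      exact congrArg (fun u => Ideal.span (Set.range u)) (funext hτ)
    rw [IsScalarTower.algebraMap_eq C S S₀, ← RingHom.comap_ker, ← h1,
      Ideal.comap_map_of_surjective' _ hS]
  have hlift : ∀ {κ : Type} [Finite κ] (g : κ → C) (τ : ι → C), IsPartRSP g →
      RingHom.ker (algebraMap C S) = Ideal.span (Set.range g) →
      (∀ i, algebraMap C S (τ i) = t i) → IsPartRSP (Sum.elim g τ) := by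
    intro κ _ g τ hg hJ hτ
    refine IsPartRSP.of_surjective_of_ringKrullDim (algebraMap C S) hS hJ ?_
      (hg.sumEmpty.of_surjective _ hS hJ).2.ge
    exact (congrArg IsPartRSP (funext hτ)).mpr ht
  have ht0 : ∀ i, t i ∉ Q := fun i hi => hQ (by
    rw [hprod, ← Finset.mul_prod_erase _ _ (Finset.mem_univ i)]
    exact Q.mul_mem_right _ hi)
  rcases subsingleton_or_nontrivial ι with hι | hι
  -- With a single parameter, π itself lifts t, and the generators of J already have dual
  -- derivations.
  · have hτ : ∀ i, algebraMap C S ((fun _ => algebraMap A C ϖ) i) = t i := fun i => by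
      rw [← IsScalarTower.algebraMap_apply A C S, hprod, Fintype.prod_subsingleton _ i]
    obtain ⟨c, g, hg, hJ⟩ := IsRegularLocalRing.exists_isPartRSP_of_surjective _ hS
    have h1 := hlift g _ hg hJ hτ
    let i₀ : ι := Classical.arbitrary ι
    have hrange : Set.range (fun _ : ι => algebraMap A C ϖ) =
        Set.range (fun _ : Unit => algebraMap A C ϖ) := by
      rw [Set.range_const, Set.range_const]
    obtain ⟨δ, hδ⟩ := key (Fin c) g (h1.congr_span (by
        rw [Nat.card_sum, Nat.card_sum, Nat.card_of_subsingleton i₀, Nat.card_of_subsingleton (), add_comm])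
        (by rw [Set.Sum.elim_range, Set.Sum.elim_range, Set.union_comm, hrange]))
      (by rw [hcomap _ hτ, hJ, hrange, Set.Sum.elim_range, Ideal.span_union])
    refine formallySmooth_localization_of_derivation hS Q g hJ δ fun K _ _ _ a ha => ?_
    ext i
    simpa [hδ] using ha i
  · choose τ hτ using fun i => hS (t i)
    obtain ⟨i₀, i₁, hi⟩ := exists_pair_ne ι
    -- The equation of J that involves π. With at least two factors the product lies in m², whereas
    -- π does not, so x is a parameter and can be completed by some u to parameters generating J.
    let x : C := algebraMap A C ϖ - ∏ i, τ i
    have hxJ : x ∈ RingHom.ker (algebraMap C S) := by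
      rw [RingHom.mem_ker, map_sub, map_prod, ← IsScalarTower.algebraMap_apply A C S, hprod,
        sub_eq_zero]
      exact Finset.prod_congr rfl fun i _ => (hτ i).symm
    have hmS : ∀ y : C, algebraMap C S y ∈ maximalIdeal S → y ∈ maximalIdeal C := fun y hy => by
      have := hS.isLocalHom
      rwa [← Ideal.mem_comap, IsLocalRing.maximalIdeal_comap] at hy
    have hϖsq : algebraMap A C ϖ ∉ maximalIdeal C ^ 2 := fun h => by
      have h1 : IsPartRSP (Sum.elim (fun _ : Unit => algebraMap A C ϖ) (Empty.elim : Empty → C)) :=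
        IsPartRSP.of_surjective_of_ringKrullDim _ hC hϖC₀ (.of_isRegularLocalRing _) hdim
      have h2 := h1.inl.mem_maximalIdeal_of_sum_mem_sq (fun _ => 1) (by simpa using h) ()
      exact (Ideal.ne_top_iff_one _).1 (maximalIdeal.isMaximal C).ne_top h2
    have hxsq : x ∉ maximalIdeal C ^ 2 := fun h => hϖsq (by
      have h1 : ∏ i, τ i ∈ maximalIdeal C ^ 2 := by
        rw [← Finset.mul_prod_erase _ _ (Finset.mem_univ i₀),
          ← Finset.mul_prod_erase _ _ (Finset.mem_erase.2 ⟨hi.symm, Finset.mem_univ i₁⟩), ← mul_assoc,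
          pow_two]
        exact Ideal.mul_mem_right _ _ (Ideal.mul_mem_mul
          (hmS _ (by rw [hτ]; exact ht.mem _)) (hmS _ (by rw [hτ]; exact ht.mem _)))
      simpa [x] using add_mem h h1)
    have hxm : x ∈ maximalIdeal C := hmS _ (by rw [RingHom.mem_ker.1 hxJ]; exact zero_mem _)
    have hx := isPartRSP_of_mem_of_notMem_sq hxm hxsq
    obtain ⟨hloc, -, hxdim⟩ := hx.sumEmpty.quotient
    have hxreg : IsRegularLocalRing (C ⧸ Ideal.span (Set.range fun _ : Unit => x)) :=
      (hx.sumEmpty.of_surjective _ Ideal.Quotient.mk_surjective Ideal.mk_ker).1.isRegularLocalRing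
    have hxle : ∀ y ∈ Ideal.span (Set.range fun _ : Unit => x), algebraMap C S y = 0 := by
      have : Ideal.span (Set.range fun _ : Unit => x) ≤ RingHom.ker (algebraMap C S) := by
        rw [Set.range_const, Ideal.span_singleton_le_iff_mem]
        exact hxJ
      exact this
    let ψ : C ⧸ Ideal.span (Set.range fun _ : Unit => x) →+* S := Ideal.Quotient.lift _ _ hxle
    have hψ : Function.Surjective ψ := Ideal.Quotient.lift_surjective_of_surjective _ _ hS
    obtain ⟨c, u', hu', hψker⟩ := IsRegularLocalRing.exists_isPartRSP_of_surjective ψ hψ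
    choose u hu using fun i => Ideal.Quotient.mk_surjective (u' i)
    have hxu : IsPartRSP (Sum.elim (fun _ : Unit => x) u) :=
      IsPartRSP.of_surjective_of_ringKrullDim _ Ideal.Quotient.mk_surjective Ideal.mk_ker
        ((congrArg IsPartRSP (funext hu)).mpr hu') hxdim.ge
    have hJ : RingHom.ker (algebraMap C S) =
        Ideal.span (Set.range (Sum.elim (fun _ : Unit => x) u)) := by
      have h1 : algebraMap C S = ψ.comp (Ideal.Quotient.mk _) := rfl
      have h2 : (Ideal.span (Set.range u)).map (Ideal.Quotient.mk _) = RingHom.ker ψ := by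
        rw [hψker, Ideal.map_span, ← Set.range_comp]
        exact congrArg (fun u => Ideal.span (Set.range u)) (funext hu)
      rw [h1, ← RingHom.comap_ker, ← h2, Ideal.comap_map_of_surjective' _ Ideal.Quotient.mk_surjective,
        Ideal.mk_ker, Set.Sum.elim_range, Ideal.span_union, sup_comm]
    have h1 := hlift _ τ hxu hJ hτ
    have hprodτ : ∏ i, τ i ∈ Ideal.span (Set.range τ) := by
      rw [← Finset.mul_prod_erase _ _ (Finset.mem_univ i₀)]
      exact Ideal.mul_mem_right _ _ (Ideal.subset_span ⟨i₀, rfl⟩)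
    -- In the presence of τ, the elements x and π are interchangeable, since they differ by the
    -- product of the τ_i.
    have hspan : Ideal.span (Set.range τ) ⊔ Ideal.span (Set.range (Sum.elim (fun _ : Unit => x) u)) =
        Ideal.span (Set.range (Sum.elim (fun _ : Unit => algebraMap A C ϖ) (Sum.elim u τ))) := by
      rw [Set.Sum.elim_range, Set.Sum.elim_range, Set.Sum.elim_range, Set.range_const,
        Set.range_const, Ideal.span_union, Ideal.span_union, Ideal.span_union, sup_comm, sup_assoc,
        sup_comm (Ideal.span {x}), sup_comm (Ideal.span {_}), sup_assoc, sup_assoc]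
      congr 1
      apply le_antisymm
      · refine sup_le le_sup_left ((Ideal.span_singleton_le_iff_mem _).2 ?_)
        exact sub_mem (Ideal.mem_sup_right (Ideal.mem_span_singleton_self _))
          (Ideal.mem_sup_left hprodτ)
      · refine sup_le le_sup_left ((Ideal.span_singleton_le_iff_mem _).2 ?_)
        rw [← sub_add_cancel (algebraMap A C ϖ) (∏ i, τ i)]
        exact add_mem (Ideal.mem_sup_right (Ideal.mem_span_singleton_self _))
          (Ideal.mem_sup_left hprodτ)
    obtain ⟨δ, hδ⟩ := key (Fin c ⊕ ι) (Sum.elim u τ) (h1.congr_span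
        (by simp only [Nat.card_sum, add_assoc])
        (by rw [← hspan, Set.Sum.elim_range, Ideal.span_union, sup_comm]))
      (by rw [hcomap _ hτ, hJ, hspan])
    have hδτ : ∀ i, δ (.inr i₀) (τ i) = if i₀ = i then 1 else 0 := fun i => by
      simpa using hδ (.inr i₀) (.inr i)
    -- Derivation along τ at one fixed index: π is a constant and the product rule leaves only the
    -- other factors.
    have hx₀ : δ (.inr i₀) x = -∏ i ∈ Finset.univ.erase i₀, τ i := by
      have h2 := (δ (.inr i₀)).map_prod_eq_zero (Finset.univ.erase i₀) τ fun i hi => by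
        rw [hδτ, if_neg (Finset.ne_of_mem_erase hi).symm]
      rw [map_sub, Derivation.map_algebraMap, ← Finset.mul_prod_erase _ _ (Finset.mem_univ i₀),
        Derivation.leibniz, h2, hδτ, if_pos rfl]
      simp
    have hxj : ∀ j, δ (.inl j) x = 0 := fun j => by
      rw [map_sub, Derivation.map_algebraMap, (δ (.inl j)).map_prod_eq_zero _ τ fun i _ => by
        simpa using hδ (.inl j) (.inr i), sub_zero]
    have huj : ∀ i j, δ (.inl i) (u j) = if i = j then 1 else 0 := fun i j => by
      simpa using hδ (.inl i) (.inl j)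
    have hu₀ : ∀ j, δ (.inr i₀) (u j) = 0 := fun j => by simpa using hδ (.inr i₀) (.inl j)
    -- On (x, u) the Jacobian matrix is diagonal: its entry at x is minus a product of lifts of t_i
    -- outside Q, the entries at u are 1.
    refine formallySmooth_localization_of_derivation hS Q _ hJ
      (Sum.elim (fun _ => δ (.inr i₀)) fun j => δ (.inl j)) fun K _ _ hK a ha => ?_
    have ha₀ := ha (.inl ())
    rw [Fintype.sum_sum_type] at ha₀
    simp only [Sum.elim_inl, Sum.elim_inr, hu₀, hx₀, map_zero, mul_zero, Finset.sum_const_zero,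
      add_zero, Finset.univ_unique, Finset.sum_singleton, map_neg, map_prod, hτ, mul_neg,
      neg_eq_zero, mul_eq_zero, Finset.prod_eq_zero_iff] at ha₀
    ext (j | j)
    · refine ha₀.resolve_right ?_
      rintro ⟨i, -, hi⟩
      exact ht0 i (hK ▸ hi)
    · simpa [Fintype.sum_sum_type, hxj, huj] using ha (.inr j)

end

end GenericSmoothness
end Bertini

/-! ### Smooth and regular over fields; the semistable case with a polynomial presentation. -/

namespace Bertini

section SmoothnessOverFields
open TensorProduct KaehlerDifferential IsLocalRing

theorem isRegularLocalRing_localization_mvPolynomial (R : Type u) [CommRing R] [IsRegularRing R]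
    {n : ℕ} (q : Ideal (MvPolynomial (Fin n) R)) [q.IsPrime] :
    IsRegularLocalRing (Localization.AtPrime q) :=
  have := MvPolynomial.isRegularRing_of_isRegularRing R (ι := Fin n)
  inferInstance

theorem isRegularLocalRing_stalk_of_smooth {L : Type u} [Field L] {W : Scheme.{u}}
    (g : W ⟶ Spec (.of L)) [Smooth g] (w : W) : IsRegularLocalRing (W.presheaf.stalk w) := by
  obtain ⟨n, q, hq, φ, hφ, hφg⟩ := exists_localization_surjective g w
  have h := (smooth_iff_toStalk g).1 inferInstance w
  have := isRegularLocalRing_localization_mvPolynomial L q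
  let _ := φ.toAlgebra
  let _ := (toStalk g w).toAlgebra
  have : IsScalarTower L (Localization.AtPrime q) (W.presheaf.stalk w) :=
    .of_algebraMap_eq' hφg.symm
  obtain ⟨h1, h2, h3⟩ := formallySmooth_of_localization_mvPolynomial (R := L)
    (P := Localization.AtPrime q) q.primeCompl
  exact isRegularLocalRing_of_formallySmooth (R := L) (P := Localization.AtPrime q) hφ h

/-- Over a perfect field the residue field is smooth, so a full regular system of parameters of C
has dual derivations. Those belonging to the equations of S in C verify the Jacobian criterion. -/
theorem smooth_of_isRegularScheme {L : Type u} [Field L] [CharZero L] {W : Scheme.{u}}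
    (g : W ⟶ Spec (.of L)) [LocallyOfFiniteType g] (hW : IsRegularScheme W) : Smooth g := by
  have := locallyOfFinitePresentation_of_locallyOfFiniteType g
  refine (smooth_iff_toStalk g).2 fun w => ?_
  obtain ⟨n, q, hq, φ, hφ, hφg⟩ := exists_localization_surjective g w
  have := isRegularLocalRing_localization_mvPolynomial L q
  have := hW w
  let C := Localization.AtPrime q
  let S := W.presheaf.stalk w
  let _ : Algebra C S := φ.toAlgebra
  let _ : Algebra L S := (toStalk g w).toAlgebra
  have : IsScalarTower L C S := .of_algebraMap_eq' hφg.symm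
  obtain ⟨h1, h2, h3⟩ := formallySmooth_of_localization_mvPolynomial (R := L)
    (P := C) q.primeCompl
  let κ := ResidueField S
  have hκ : Function.Surjective (algebraMap C κ) := algebraMap_residueField_surjective hφ
  have : Algebra.EssFiniteType L C := .comp L (MvPolynomial (Fin n) L) C
  have : Algebra.EssFiniteType L κ := .of_surjective (IsScalarTower.toAlgHom L C κ) hκ
  have hsm : Algebra.FormallySmooth L κ := .of_perfectField
  obtain ⟨c, g, ⟨k, s, hspan, hd⟩, hker⟩ :=
    IsRegularLocalRing.exists_isPartRSP_of_surjective (algebraMap C S) hφ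
  have hgs : IsPartRSP (Sum.elim g s) := ⟨0, Fin.elim0, by
    rw [Set.range_eq_empty (Fin.elim0 : Fin 0 → C), Set.union_empty, Set.Sum.elim_range, hspan], by
    rw [hd]; simp⟩
  obtain ⟨δ, hδ⟩ := exists_dual_derivation (R := L) hκ hsm _ hgs (by
    rw [IsLocalRing.eq_maximalIdeal (RingHom.ker_isMaximal_of_surjective _ hκ),
      Set.Sum.elim_range, hspan])
  -- The dual derivations take values in the residue field of the quotient, and here the quotient is
  -- the field κ itself.
  let K := ResidueField κ
  refine formallySmooth_of_derivation (R := L) (P := C) (S := S) (K := K) hφ ?_ g hker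
    (fun i => δ (.inl i)) fun a ha => ?_
  · intro x hx
    rw [RingHom.mem_ker, IsScalarTower.algebraMap_apply S κ K]
    have : algebraMap S κ x = 0 := (residue_eq_zero_iff x).2 hx
    rw [this, map_zero]
  · ext i
    have := ha i
    rw [Finsupp.sum_fintype _ _ (fun _ => zero_mul _)] at this
    have h1 : ∀ j, δ (.inl i) (g j) = if i = j then 1 else 0 := fun j => by
      simpa using hδ (.inl i) (.inl j)
    simpa [h1] using this

/-- Supplies the ring C₀ over the residue field: it is C modulo the uniformizer, identified with a
localization of the polynomial ring over F, so it is regular and smooth there. -/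
theorem formallySmooth_localization_of_semistable {A : Type u} [CommRing A] [IsDomain A]
    [IsDiscreteValuationRing A] {S S₀ S' : Type u} [CommRing S] [IsRegularLocalRing S]
    {n : ℕ} (q : Ideal (MvPolynomial (Fin n) A)) [q.IsPrime] (φ : Localization.AtPrime q →+* S)
    (hφ : Function.Surjective φ) [CommRing S₀] [IsLocalRing S₀] (β : S →+* S₀)
    (hβ : Function.Surjective β) (γ : ResidueField A →+* S₀) (hγ : γ.FormallySmooth)
    (hcomp : γ.comp (residue A) = (β.comp φ).comp (algebraMap A _)) {ϖ : A}
    (hϖ : Irreducible ϖ) {ι : Type} [Fintype ι] [Nonempty ι] (t : ι → S) (ht : IsPartRSP t)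
    (hker : RingHom.ker β = Ideal.span (Set.range t))
    (hprod : φ (algebraMap A _ ϖ) = ∏ i, t i) (Q : Ideal S) [Q.IsPrime]
    (hQ : φ (algebraMap A _ ϖ) ∉ Q) [CommRing S'] [Algebra S S'] [IsLocalization.AtPrime S' Q] :
    ((algebraMap S S').comp (φ.comp (algebraMap A _))).FormallySmooth := by
  classical
  let C := Localization.AtPrime q
  let F := ResidueField A
  have := isRegularLocalRing_localization_mvPolynomial A q
  let ρ : MvPolynomial (Fin n) A →+* MvPolynomial (Fin n) F := MvPolynomial.map (residue A)
  have hρ : Function.Surjective ρ := MvPolynomial.map_surjective _ residue_surjective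
  have hρker : RingHom.ker ρ = Ideal.span {algebraMap A _ ϖ} := by
    rw [MvPolynomial.ker_map, ker_residue, hϖ.maximalIdeal_eq, Ideal.map_span, Set.image_singleton]
    rfl
  have hϖq : algebraMap A (MvPolynomial (Fin n) A) ϖ ∈ q := by
    have h1 : φ (algebraMap A C ϖ) ∈ maximalIdeal S := by
      obtain ⟨i⟩ := (inferInstance : Nonempty ι)
      rw [hprod, ← Finset.mul_prod_erase _ _ (Finset.mem_univ i)]
      exact Ideal.mul_mem_right _ _ (ht.mem i)
    have := hφ.isLocalHom
    rw [← Ideal.mem_comap, IsLocalRing.maximalIdeal_comap,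
      IsScalarTower.algebraMap_apply A (MvPolynomial (Fin n) A) C] at h1
    exact (IsLocalization.AtPrime.to_map_mem_maximal_iff C q _).1 h1
  have hρq : RingHom.ker ρ ≤ q := by
    rw [hρker, Ideal.span_singleton_le_iff_mem]; exact hϖq
  let q₀ := q.map ρ
  have : q₀.IsPrime := Ideal.map_isPrime_of_surjective hρ hρq
  have hq₀ : q = q₀.comap ρ := by
    rw [Ideal.comap_map_of_surjective' _ hρ, sup_eq_left.2 hρq]
  let C₀ := Localization.AtPrime q₀
  have := isRegularLocalRing_localization_mvPolynomial F q₀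
  let χ : C →+* C₀ := Localization.localRingHom q q₀ ρ hq₀
  have hχA : χ.comp (algebraMap A C) = (algebraMap F C₀).comp (residue A) := by
    ext a
    rw [RingHom.comp_apply, IsScalarTower.algebraMap_apply A (MvPolynomial (Fin n) A) C,
      Localization.localRingHom_to_map, RingHom.comp_apply,
      IsScalarTower.algebraMap_apply F (MvPolynomial (Fin n) F) C₀]
    congr 1
    exact MvPolynomial.map_C _ _
  have hmap : q.primeCompl.map ρ = q₀.primeCompl := by
    ext y
    constructor
    · rintro ⟨x, hx, rfl⟩ hy
      exact hx (hq₀.ge hy)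
    · intro hy
      obtain ⟨x, rfl⟩ := hρ y
      exact ⟨x, fun hx => hy (hq₀.le hx), rfl⟩
  have hχker : RingHom.ker χ = Ideal.span {algebraMap A C ϖ} := by
    refine (IsLocalization.ker_map C₀ ρ hmap).trans ?_
    rw [hρker, Ideal.map_span, Set.image_singleton, ← IsScalarTower.algebraMap_apply]
  have hχ : Function.Surjective χ := by
    intro y
    obtain ⟨b, s, rfl⟩ := IsLocalization.exists_mk'_eq q₀.primeCompl y
    obtain ⟨b, rfl⟩ := hρ b
    obtain ⟨s', hs'⟩ := hρ s.1
    refine ⟨IsLocalization.mk' _ b (⟨s', fun hc => s.2 (hs' ▸ hq₀.le hc)⟩ : q.primeCompl), ?_⟩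
    exact (IsLocalization.map_mk' _ _ _).trans (congrArg _ (Subtype.ext hs'))
  have hle : RingHom.ker χ ≤ RingHom.ker (β.comp φ) := by
    rw [hχker, Ideal.span_singleton_le_iff_mem]
    change ((β.comp φ).comp (algebraMap A C)) ϖ = 0
    rw [← hcomp, RingHom.comp_apply, (residue_eq_zero_iff _).2, map_zero]
    rw [hϖ.maximalIdeal_eq]
    exact Ideal.mem_span_singleton_self _
  let θ : C₀ →+* S₀ := RingHom.liftOfSurjective χ hχ ⟨β.comp φ, hle⟩
  have hθ : θ.comp χ = β.comp φ := RingHom.liftOfRightInverse_comp _ _ _ _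
  have hθF : θ.comp (algebraMap F C₀) = γ := by
    rw [← RingHom.cancel_right (residue_surjective (R := A)), hcomp, ← hθ, RingHom.comp_assoc, ← hχA,
      RingHom.comp_assoc]
  let _ : Algebra C S := φ.toAlgebra
  let _ : Algebra A S := (φ.comp (algebraMap A C)).toAlgebra
  have : IsScalarTower A C S := .of_algebraMap_eq' rfl
  let _ : Algebra S S₀ := β.toAlgebra
  let _ : Algebra C S₀ := (β.comp φ).toAlgebra
  have : IsScalarTower C S S₀ := .of_algebraMap_eq' rfl
  let _ : Algebra C C₀ := χ.toAlgebra
  let _ : Algebra C₀ S₀ := θ.toAlgebra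
  have : IsScalarTower C C₀ S₀ := .of_algebraMap_eq' hθ.symm
  let _ : Algebra F S₀ := γ.toAlgebra
  have : IsScalarTower F C₀ S₀ := .of_algebraMap_eq' hθF.symm
  have : IsScalarTower A F C₀ := inferInstance
  have : IsScalarTower A C C₀ := .of_algebraMap_eq' (by
    rw [IsScalarTower.algebraMap_eq A F C₀]; exact hχA.symm)
  let _ : Algebra A S' := ((algebraMap S S').comp (φ.comp (algebraMap A C))).toAlgebra
  have : IsScalarTower A S S' := .of_algebraMap_eq' rfl
  obtain ⟨h1, h2, h3⟩ := formallySmooth_of_localization_mvPolynomial (R := A) (P := C) q.primeCompl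
  obtain ⟨h4, h5, h6⟩ := formallySmooth_of_localization_mvPolynomial (R := F) (P := C₀) q₀.primeCompl
  exact formallySmooth_localization_of_prod_eq (C := C) (C₀ := C₀) (F := F) hχ hφ hβ hγ ϖ hχker t ht
    hker hprod Q hQ S'

end SmoothnessOverFields
end Bertini

/-! ### Transversality in terms of parameters. -/

namespace Bertini
open Scheme.IdealSheafData

section Transversality

variable {W X Y Z : Scheme.{u}}

theorem stalkIdeal_ker_of_isPullback {w : W ⟶ Y} {v : W ⟶ Z} {k : Y ⟶ X} {j : Z ⟶ X}
    (h : IsPullback w v k j) [IsClosedImmersion j] (y : Y) :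
    stalkIdeal w.ker y = (stalkIdeal j.ker (k y)).map (k.stalkMap y).hom := by
  rw [← stalkIdeal_ker_fst, ← h.isoPullback_hom_fst, Scheme.Hom.ker_comp_of_isIso]

theorem mem_range_of_isPullback {w : W ⟶ Y} {v : W ⟶ Z} {k : Y ⟶ X} {j : Z ⟶ X}
    (h : IsPullback w v k j) [IsClosedImmersion j] {y : Y} (hy : k y ∈ Set.range j) :
    y ∈ Set.range w := by
  have : IsClosedImmersion w := MorphismProperty.of_isPullback h.flip inferInstance
  rw [mem_range_iff_stalkIdeal] at hy ⊢
  rw [stalkIdeal_ker_of_isPullback h, Ideal.map_le_iff_le_comap, IsLocalRing.maximalIdeal_comap]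
  exact hy

/-- A regular quotient of a regular ring is cut out by parameters, and their number is the height of
the ideal, which the codimension determines. -/
theorem exists_isPartRSP_of_hasPureCodim {j : Z ⟶ X} [IsClosedImmersion j] {c : ℕ}
    (hj : HasPureCodim j c) (hX : IsRegularScheme X) (hZ : IsRegularScheme Z) {x : X}
    (hx : x ∈ Set.range j) : ∃ u : Fin c → X.presheaf.stalk x, IsPartRSP u ∧
      stalkIdeal j.ker x = Ideal.span (Set.range u) := by
  obtain ⟨z, rfl⟩ := hx
  have := hX (j z)
  have := hZ z
  have := IsRegularLocalRing.isDomain (Z.presheaf.stalk z)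
  obtain ⟨c', u, hu, hker⟩ := IsRegularLocalRing.exists_isPartRSP_of_surjective _
    (stalkMap_surjective j z)
  rw [ker_stalkMap] at hker
  have h := hj.height_eq z
  rw [hker, hu.height_span, Nat.card_fin] at h
  obtain rfl : c' = c := by exact_mod_cast h
  exact ⟨u, hu, hker⟩

/-- The equation a restricts to a parameter of the regular quotient by t; parameters of a quotient
lift and combine with those that define it. -/
theorem isPartRSP_sumElim_of_isPullback {w : W ⟶ Y} {v : W ⟶ Z} {k : Y ⟶ X} {j : Z ⟶ X}
    [IsClosedImmersion j] [IsClosedImmersion k] (h : IsPullback w v k j) (hX : IsRegularScheme X)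
    (hY : IsRegularScheme Y) (hW : IsRegularScheme W) (hw : HasPureCodim w 1) {x : X}
    (hk : x ∈ Set.range k) (hj : x ∈ Set.range j) {ι : Type*} [Finite ι]
    {t : ι → X.presheaf.stalk x}
    (ht : IsPartRSP t) (hker : stalkIdeal k.ker x = Ideal.span (Set.range t))
    {a : X.presheaf.stalk x} (ha : stalkIdeal j.ker x = Ideal.span {a}) :
    IsPartRSP (Sum.elim t fun _ : Unit => a) := by
  have : IsClosedImmersion w := MorphismProperty.of_isPullback h.flip inferInstance
  obtain ⟨y, rfl⟩ := hk
  obtain ⟨u, hu, hwu⟩ := exists_isPartRSP_of_hasPureCodim hw hY hW (mem_range_of_isPullback h hj)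
  rw [stalkIdeal_ker_of_isPullback h, ha, Ideal.map_span, Set.image_singleton] at hwu
  have := hX (k y)
  have hk' := (ker_stalkMap k y).trans hker
  refine IsPartRSP.of_surjective_of_ringKrullDim _ (stalkMap_surjective k y) hk' ?_
    (ht.sumEmpty.of_surjective _ (stalkMap_surjective k y) hk').2.ge
  refine hu.congr_span (by simp) ?_
  rw [← hwu]
  congr 1
  ext b
  simp [eq_comm]

end Transversality

/-! ### Local parameters along the special fibre. -/

section LocalStructure

variable {A : Type u} [CommRing A] [IsDomain A] [IsDiscreteValuationRing A] {X : Scheme.{u}}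
  {f : X ⟶ Spec (.of A)}

instance isClosedImmersion_closedPt : IsClosedImmersion (closedPt A) :=
  IsClosedImmersion.spec_of_surjective _ IsLocalRing.residue_surjective

theorem IsQuasiSemistable.locallyOfFiniteType (hX : IsQuasiSemistable f) :
    LocallyOfFiniteType f := by
  obtain ⟨N, i, hi, rfl⟩ := hX.quasiProjective
  infer_instance

theorem stalkIdeal_ker_specialFibre {ϖ : A} (hϖ : Irreducible ϖ) (x : X) :
    stalkIdeal (pullback.fst f (closedPt A)).ker x = Ideal.span {toStalk f x ϖ} := by
  rw [stalkIdeal_ker_fst_SpecMap _ IsLocalRing.residue_surjective, IsLocalRing.ker_residue,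
    hϖ.maximalIdeal_eq, Ideal.map_span, Set.image_singleton]

theorem mem_range_specialFibre_iff {ϖ : A} (hϖ : Irreducible ϖ) (x : X) :
    x ∈ Set.range (pullback.fst f (closedPt A)) ↔
      toStalk f x ϖ ∈ IsLocalRing.maximalIdeal (X.presheaf.stalk x) := by
  rw [mem_range_iff_stalkIdeal, stalkIdeal_ker_specialFibre hϖ, Ideal.span_singleton_le_iff_mem]

/-- The inclusion of the stratum `Y_I` of the special fibre into `X`. -/
noncomputable abbrev stratumToTotal (f : X ⟶ Spec (.of A))
    (I : Finset (Set (pullback f (closedPt A) : Scheme.{u}))) :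
    stratum (pullback f (closedPt A)) I ⟶ X :=
  stratumι (pullback f (closedPt A)) I ≫ pullback.fst f (closedPt A)

theorem IsQuasiSemistable.isRegularScheme_stratum (hX : IsQuasiSemistable f)
    {I : Finset (Set (pullback f (closedPt A) : Scheme.{u}))} (hI : I.Nonempty)
    (hI' : (I : Set (Set (pullback f (closedPt A) : Scheme.{u}))) ⊆ irreducibleComponents _) :
    IsRegularScheme (stratum (pullback f (closedPt A)) I) := fun w =>
  have := (hX.components I hI hI').1
  isRegularLocalRing_stalk_of_smooth
    (stratumι (pullback f (closedPt A)) I ≫ pullback.snd f (closedPt A)) w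

theorem stalkIdeal_stratumIdeal {X : Scheme.{u}} {ι : Type*} (J : Finset ι) [DecidableEq (Set X)]
    {y : X} {ξ : ι → X} (hξ : ∀ k, ξ k ⤳ y) :
    stalkIdeal (stratumIdeal X (J.image fun k => closure {ξ k})) y = ⨆ k ∈ J, genIdeal (hξ k) := by
  rw [stratumIdeal, stalkIdeal_biSup, Finset.iSup_finset_image]
  refine iSup_congr fun k => iSup_congr fun _ => ?_
  rw [← stalkIdeal_vanishingIdeal_closure (hξ k)]
  congr 2
  exact TopologicalSpace.Closeds.ext closure_closure

/-- Minimal primes over π are the components through x. Codimension 1 makes each principal, and the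
regular intersection of all r of them, of codimension r, makes their generators part of a regular
system of parameters. -/
theorem exists_parameters_of_mem_range (hX : IsQuasiSemistable f) {x : X}
    (hx : x ∈ Set.range (pullback.fst f (closedPt A))) :
    ∃ (r : ℕ) (C : Fin r → Set (pullback f (closedPt A) : Scheme.{u}))
      (t : Fin r → X.presheaf.stalk x), 0 < r ∧ Function.Injective C ∧
      (∀ k, C k ∈ irreducibleComponents (pullback f (closedPt A) : Scheme.{u})) ∧ IsPartRSP t ∧
      (∀ ϖ : A, Irreducible ϖ → (Ideal.span {toStalk f x ϖ}).minimalPrimes =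
        Set.range fun k => Ideal.span {t k}) ∧
      ∀ (J : Finset (Fin r)) (I : Finset (Set (pullback f (closedPt A) : Scheme.{u}))),
        J.Nonempty → (I : Set (Set (pullback f (closedPt A) : Scheme.{u}))) = C '' J →
        stalkIdeal (stratumToTotal f I).ker x = Ideal.span (t '' J) := by
  classical
  obtain ⟨ϖ, hϖ⟩ := IsDiscreteValuationRing.exists_irreducible A
  obtain ⟨y, rfl⟩ := hx
  set c := pullback.fst f (closedPt A) with hc
  have hcs := stalkMap_surjective c y
  have := hX.regular (c y)
  have hkerc : RingHom.ker (c.stalkMap y).hom = Ideal.span {toStalk f (c y) ϖ} := by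
    rw [ker_stalkMap, stalkIdeal_ker_specialFibre hϖ]
  have hfin : (Ideal.span {toStalk f (c y) ϖ}).minimalPrimes.Finite :=
    Ideal.finite_minimalPrimes_of_isNoetherianRing _ _
  have hmin : (Ideal.span {toStalk f (c y) ϖ}).minimalPrimes =
      Ideal.comap (c.stalkMap y).hom '' minimalPrimes ((pullback f (closedPt A)).presheaf.stalk y) := by
    rw [← hkerc, RingHom.ker_eq_comap_bot, Ideal.comap_minimalPrimes_eq_of_surjective hcs]
  obtain ⟨r, p, hr, hp, hprange⟩ : ∃ (r : ℕ) (p : Fin r → Ideal (X.presheaf.stalk (c y))), 0 < r ∧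
      Function.Injective p ∧ Set.range p = (Ideal.span {toStalk f (c y) ϖ}).minimalPrimes := by
    have : Finite (Ideal.span {toStalk f (c y) ϖ}).minimalPrimes := hfin
    have : Nonempty (Ideal.span {toStalk f (c y) ϖ}).minimalPrimes :=
      Ideal.nonempty_minimalPrimes (hkerc ▸ RingHom.ker_ne_top _)
    let e := Finite.equivFin (Ideal.span {toStalk f (c y) ϖ}).minimalPrimes
    exact ⟨_, Subtype.val ∘ e.symm, Nat.card_pos, Subtype.val_injective.comp e.symm.injective, by
      rw [EquivLike.range_comp, Subtype.range_coe]⟩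
  have hpq : ∀ k, ∃ q ∈ minimalPrimes ((pullback f (closedPt A)).presheaf.stalk y),
      q.comap (c.stalkMap y).hom = p k := fun k => by
    have : p k ∈ (Ideal.span {toStalk f (c y) ϖ}).minimalPrimes := hprange ▸ Set.mem_range_self k
    rwa [hmin] at this
  choose q hq hqp using hpq
  have hξ : ∀ k, ∃ (ξ : (pullback f (closedPt A) : Scheme.{u})) (h : ξ ⤳ y), genIdeal h = q k :=
    fun k => have := (hq k).1.1; exists_genIdeal_eq (q k)
  choose ξ hξ hξq using hξ
  let C : Fin r → Set (pullback f (closedPt A) : Scheme.{u}) := fun k => closure {ξ k}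
  have hC : Function.Injective C := fun k l hkl => hp (by
    rw [← hqp, ← hqp, ← hξq, ← hξq, ← stalkIdeal_vanishingIdeal_closure,
      ← stalkIdeal_vanishingIdeal_closure]
    congr 3
    exact TopologicalSpace.Closeds.ext hkl)
  have hCirr : ∀ k, C k ∈ irreducibleComponents (pullback f (closedPt A) : Scheme.{u}) := fun k =>
    (closure_mem_irreducibleComponents_iff (hξ k)).2 ((hξq k).symm ▸ hq k)
  have hsub : ∀ J : Finset (Fin r), ((J.image C : Finset _) : Set (Set _)) ⊆
      irreducibleComponents (pullback f (closedPt A) : Scheme.{u}) := fun J => by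
    rw [Finset.coe_image]
    rintro _ ⟨k, -, rfl⟩
    exact hCirr k
  have hstr : ∀ J : Finset (Fin r),
      stalkIdeal (stratumι (pullback f (closedPt A)) (J.image C)).ker y = ⨆ k ∈ J, q k := fun J => by
    rw [ker_subschemeι, stalkIdeal_stratumIdeal J hξ]
    simp only [hξq]
  have htot : ∀ J : Finset (Fin r), stalkIdeal (stratumToTotal f (J.image C)).ker (c y) =
      (⨆ k ∈ J, q k).comap (c.stalkMap y).hom := fun J => by
    rw [stalkIdeal_ker_comp, hstr]
  have hmem : ∀ J : Finset (Fin r), c y ∈ Set.range (stratumToTotal f (J.image C)) := fun J => by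
    rw [mem_range_iff_stalkIdeal, htot, ← IsLocalRing.maximalIdeal_comap (c.stalkMap y).hom]
    refine Ideal.comap_mono (iSup₂_le fun k _ => ?_)
    have := (hq k).1.1
    exact IsLocalRing.le_maximalIdeal this.ne_top
  -- Distinct minimal primes give distinct components, so the codimension of the stratum is the
  -- cardinality of J.
  have hGL : ∀ J : Finset (Fin r), J.Nonempty → ∃ u : Fin J.card → X.presheaf.stalk (c y),
      IsPartRSP u ∧ (⨆ k ∈ J, q k).comap (c.stalkMap y).hom = Ideal.span (Set.range u) := by
    intro J hJ
    have h := (hX.components (J.image C) (hJ.image C) (hsub J)).2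
    rw [Finset.card_image_of_injective J hC] at h
    rw [← htot]
    exact exists_isPartRSP_of_hasPureCodim h hX.regular
      (hX.isRegularScheme_stratum (hJ.image C) (hsub J)) (hmem J)
  have ht : ∀ k, ∃ a, p k = Ideal.span {a} := fun k => by
    obtain ⟨u, -, hu⟩ := hGL {k} (Finset.singleton_nonempty k)
    simp only [Finset.mem_singleton, iSup_iSup_eq_left, hqp] at hu
    have : Set.range u = {u ⟨0, by simp⟩} := by
      ext a
      constructor
      · rintro ⟨i, rfl⟩
        rw [Set.mem_singleton_iff]
        congr 1
        exact Fin.ext (by have := i.2; simp at this; omega)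
      · rintro rfl
        exact ⟨_, rfl⟩
    exact ⟨_, this ▸ hu⟩
  choose t ht using ht
  -- Nonemptiness of J matters: the preimage also contains π, which already lies in each single
  -- (t_k).
  have hspan : ∀ J : Finset (Fin r), J.Nonempty →
      (⨆ k ∈ J, q k).comap (c.stalkMap y).hom = Ideal.span (t '' J) := by
    intro J ⟨k₀, hk₀⟩
    have h1 : ∀ k, q k = (Ideal.span {t k}).map (c.stalkMap y).hom := fun k => by
      rw [← ht, ← hqp, Ideal.map_comap_of_surjective _ hcs]
    have h2 : ⨆ k ∈ J, q k = (Ideal.span (t '' J)).map (c.stalkMap y).hom := by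
      simp only [h1, ← Ideal.map_iSup]
      rw [Ideal.span, Submodule.span_eq_iSup_of_singleton_spans, iSup_image]
      rfl
    rw [h2, Ideal.comap_map_of_surjective' _ hcs, sup_eq_left, hkerc]
    have h3 : p k₀ ∈ (Ideal.span {toStalk f (c y) ϖ}).minimalPrimes :=
      hprange ▸ Set.mem_range_self k₀
    refine h3.1.2.trans ?_
    rw [ht]
    exact Ideal.span_mono (Set.singleton_subset_iff.2 ⟨k₀, hk₀, rfl⟩)
  have hr' : (Finset.univ : Finset (Fin r)).Nonempty := ⟨⟨0, hr⟩, Finset.mem_univ _⟩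
  refine ⟨r, C, t, hr, hC, hCirr, ?_, fun ϖ' hϖ' => ?_, fun J I hJ hI => ?_⟩
  · obtain ⟨u, hu, hu'⟩ := hGL _ hr'
    refine hu.congr_span (by simp) ?_
    rw [← hu', hspan _ hr', Finset.coe_univ, Set.image_univ]
  · rw [← stalkIdeal_ker_specialFibre hϖ', stalkIdeal_ker_specialFibre hϖ, ← hprange]
    congr 1
    exact funext ht
  · obtain rfl : I = J.image C := Finset.coe_injective (by rw [hI, Finset.coe_image])
    rw [htot, hspan J hJ]

end LocalStructure

/-! ### Divisibility by, and radicals of, products of parameters. -/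

section ProductsOfParameters

variable {R : Type*} [CommRing R] [IsLocalRing R] [IsNoetherianRing R] {ι : Type*} {t : ι → R}

theorem _root_.IsPartRSP.ne_zero [Finite ι] (h : IsPartRSP t) (i : ι) : t i ≠ 0 := fun h0 =>
  h.notMem_span_image (Set.notMem_empty i) (h0 ▸ Ideal.zero_mem _)

theorem _root_.IsPartRSP.prime [Finite ι] (h : IsPartRSP t) (i : ι) : Prime (t i) := by
  rw [← Ideal.span_singleton_prime (h.ne_zero i), ← Set.image_singleton]
  exact h.isPrime_span_image {i}

theorem _root_.IsPartRSP.not_dvd [Finite ι] (h : IsPartRSP t) {i j : ι} (hij : i ≠ j) : ¬ t i ∣ t j := by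
  rw [← Ideal.mem_span_singleton, ← Set.image_singleton]
  exact h.notMem_span_image (by simpa using hij.symm)

/-- The parameters are primes, none dividing another. -/
theorem _root_.IsPartRSP.prod_dvd [Finite ι] (h : IsPartRSP t) (J : Finset ι) {x : R}
    (hx : ∀ i ∈ J, t i ∣ x) : ∏ i ∈ J, t i ∣ x := by
  classical
  induction J using Finset.induction_on with
  | empty => simp
  | insert i J hi ih =>
    obtain ⟨b, rfl⟩ := ih fun k hk => hx k (Finset.mem_insert_of_mem hk)
    rw [Finset.prod_insert hi, mul_comm]
    refine mul_dvd_mul_left _ (((h.prime i).dvd_or_dvd (hx i (Finset.mem_insert_self _ _))).resolve_left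
      fun hd => ?_)
    obtain ⟨k, hk, hd⟩ := (h.prime i).exists_mem_finset_dvd hd
    exact h.not_dvd (fun hik : i = k => hi (by rwa [hik])) hd

theorem _root_.IsPartRSP.span_prod_eq_iInf [Fintype ι] (h : IsPartRSP t) :
    Ideal.span {∏ i, t i} = ⨅ i, Ideal.span {t i} := by
  ext x
  simp only [Ideal.mem_iInf, Ideal.mem_span_singleton]
  exact ⟨fun hx i => (Finset.dvd_prod_of_mem t (Finset.mem_univ i)).trans hx,
    fun hx => h.prod_dvd _ fun i _ => hx i⟩

theorem _root_.IsPartRSP.radical_eq [Fintype ι] (h : IsPartRSP t) {a : R}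
    (hmin : (Ideal.span {a}).minimalPrimes = Set.range fun i => Ideal.span {t i}) :
    (Ideal.span {a}).radical = Ideal.span {∏ i, t i} := by
  rw [← Ideal.sInf_minimalPrimes, hmin, sInf_range, h.span_prod_eq_iInf]

theorem _root_.IsPartRSP.isRadical_span_prod [Fintype ι] (h : IsPartRSP t) :
    (Ideal.span {∏ i, t i}).IsRadical := by
  rw [h.span_prod_eq_iInf]
  refine Ideal.isRadical_iInf _ fun i => ?_
  exact ((Ideal.span_singleton_prime (h.ne_zero i)).2 (h.prime i)).isRadical

theorem _root_.IsPartRSP.minimalPrimes_span_unit_mul_prod_pow [Fintype ι] (h : IsPartRSP t)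
    {v : R} (hv : IsUnit v) {e : ι → ℕ} (he : ∀ i, 1 ≤ e i) :
    (Ideal.span {v * ∏ i, t i ^ e i}).minimalPrimes = Set.range fun i => Ideal.span {t i} := by
  have hp : ∀ i, (Ideal.span {t i}).IsPrime := fun i =>
    (Ideal.span_singleton_prime (h.ne_zero i)).2 (h.prime i)
  have hmem : ∀ q : Ideal R, q.IsPrime → Ideal.span {v * ∏ i, t i ^ e i} ≤ q → ∃ i, t i ∈ q := by
    intro q hq hle
    rw [Ideal.span_singleton_le_iff_mem, Ideal.unit_mul_mem_iff_mem _ hv, hq.prod_mem_iff] at hle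
    obtain ⟨i, -, hi⟩ := hle
    exact ⟨i, hq.mem_of_pow_mem _ hi⟩
  have hle : ∀ i, Ideal.span {v * ∏ i, t i ^ e i} ≤ Ideal.span {t i} := fun i => by
    rw [Ideal.span_singleton_le_span_singleton]
    exact (dvd_pow_self _ (Nat.one_le_iff_ne_zero.1 (he i))).trans
      ((Finset.dvd_prod_of_mem _ (Finset.mem_univ i)).mul_left v)
  ext q
  constructor
  · intro hq
    obtain ⟨i, hi⟩ := hmem q hq.1.1 hq.1.2
    have h1 := (Ideal.span_singleton_le_iff_mem _).2 hi
    exact ⟨i, le_antisymm h1 (hq.2 ⟨hp i, hle i⟩ h1)⟩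
  · rintro ⟨i, rfl⟩
    refine ⟨⟨hp i, hle i⟩, fun q hq hqi => ?_⟩
    obtain ⟨j, hj⟩ := hmem q hq.1 hq.2
    have hij : j = i := by
      by_contra hij
      exact h.not_dvd (Ne.symm hij) (Ideal.mem_span_singleton.1 (hqi hj))
    exact (Ideal.span_singleton_le_iff_mem _).2 (hij ▸ hj)

/-- Brings parameters into the indexed shape used in the definition of a normal crossing divisor. -/
theorem _root_.IsPartRSP.exists_fin {R : Type*} [CommRing R] [IsLocalRing R] {ι : Type*} {t : ι → R}
    [Fintype ι] [Nonempty ι] (h : IsPartRSP t) :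
    ∃ (d : ℕ) (s : Fin d → R) (J : Finset (Fin d)), ringKrullDim R = d ∧
      Ideal.span (Set.range s) = IsLocalRing.maximalIdeal R ∧ J.Nonempty ∧
      ∏ j ∈ J, s j = ∏ i, t i := by
  classical
  obtain ⟨k, s, hs, hd⟩ := h
  let e : ι ⊕ Fin k ≃ Fin (Nat.card ι + k) :=
    (Equiv.sumCongr (Finite.equivFin ι) (Equiv.refl _)).trans finSumFinEquiv
  refine ⟨Nat.card ι + k, Sum.elim t s ∘ e.symm, Finset.univ.image fun i => e (.inl i), hd, ?_, Finset.univ_nonempty.image _, ?_⟩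
  · rw [EquivLike.range_comp, Set.Sum.elim_range, hs]
  · rw [Finset.prod_image fun i _ j _ hij => Sum.inl_injective (e.injective hij)]
    simp

end ProductsOfParameters

/-! ### Strata of a scheme whose minimal primes over π are known. -/

section Strata

variable {A : Type u} [CommRing A] [IsDomain A] [IsDiscreteValuationRing A] {Z : Scheme.{u}}
  {g : Z ⟶ Spec (.of A)}

/-- Each member of I passes through y, so its generic point gives a minimal prime over π, that is,
one (s_k). Different members give different k. No quasi-semistability is assumed, so this applies to
the hyperplane section before it is known to be quasi-semistable. -/
theorem exists_stalkIdeal_stratum_eq {ϖ : A} (hϖ : Irreducible ϖ)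
    {y : (pullback g (closedPt A) : Scheme.{u})} {r : ℕ}
    {s : Fin r → Z.presheaf.stalk (pullback.fst g (closedPt A) y)}
    (hmin : (Ideal.span {toStalk g (pullback.fst g (closedPt A) y) ϖ}).minimalPrimes =
      Set.range fun k => Ideal.span {s k})
    {I : Finset (Set (pullback g (closedPt A) : Scheme.{u}))} (hI : I.Nonempty)
    (hI' : (I : Set (Set (pullback g (closedPt A) : Scheme.{u}))) ⊆ irreducibleComponents _)
    (hy : y ∈ (stratumIdeal (pullback g (closedPt A)) I).support) :
    ∃ J : Finset (Fin r), J.Nonempty ∧ J.card = I.card ∧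
      stalkIdeal (stratumToTotal g I).ker (pullback.fst g (closedPt A) y) =
        Ideal.span (s '' J) := by
  classical
  let c := pullback.fst g (closedPt A)
  have hcs := stalkMap_surjective c y
  have hkerc : RingHom.ker (c.stalkMap y).hom = Ideal.span {toStalk g (c y) ϖ} := by
    rw [ker_stalkMap, stalkIdeal_ker_specialFibre hϖ]
  have hgen : ∀ D : I, ∃ (ξ : (pullback g (closedPt A) : Scheme.{u})) (_ : ξ ⤳ y),
      closure {ξ} = D.1 := fun D => by
    obtain ⟨ξ, hξ⟩ := QuasiSober.sober (hI' D.2).1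
      (isClosed_of_mem_irreducibleComponents _ (hI' D.2))
    refine ⟨ξ, ?_, hξ⟩
    have h1 : y ∈ (vanishingIdeal ⟨closure D.1, isClosed_closure⟩ :
        (pullback g (closedPt A)).IdealSheafData).support := by
      rw [mem_support_iff_stalkIdeal] at hy ⊢
      refine (stalkIdeal_mono ?_ y).trans hy
      exact le_iSup₂_of_le (f := fun (D : Set (pullback g (closedPt A) : Scheme.{u})) (_ : D ∈ I) =>
        vanishingIdeal ⟨closure D, isClosed_closure⟩) D.1 D.2 le_rfl
    rw [specializes_iff_mem_closure]
    have h2 : y ∈ closure D.1 := h1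
    rwa [← (show closure {ξ} = D.1 from hξ), closure_closure] at h2
  choose ξ hξ hξD using hgen
  have hq : ∀ D, genIdeal (hξ D) ∈ minimalPrimes ((pullback g (closedPt A)).presheaf.stalk y) :=
    fun D => (closure_mem_irreducibleComponents_iff (hξ D)).1 (by rw [hξD]; exact hI' D.2)
  have hk : ∀ D, ∃ k, Ideal.span {s k} = (genIdeal (hξ D)).comap (c.stalkMap y).hom := fun D => by
    have : (genIdeal (hξ D)).comap (c.stalkMap y).hom ∈
        (Ideal.span {toStalk g (c y) ϖ}).minimalPrimes := by
      rw [← hkerc, RingHom.ker_eq_comap_bot, Ideal.comap_minimalPrimes_eq_of_surjective hcs]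
      exact ⟨_, hq D, rfl⟩
    rwa [hmin] at this
  choose k hk using hk
  have hkinj : Function.Injective k := fun D E hDE => Subtype.ext (by
    have h1 := hk D
    rw [hDE, hk E] at h1
    have h2 := Ideal.comap_injective_of_surjective _ hcs h1
    rw [← hξD, ← hξD]
    exact (Set.Subset.antisymm ((specializes_iff_closure_subset).1 ((genIdeal_le_iff _ _).1 h2.le))
      ((specializes_iff_closure_subset).1 ((genIdeal_le_iff _ _).1 h2.ge))))
  have hstr : stalkIdeal (stratumIdeal (pullback g (closedPt A)) I) y = ⨆ D, genIdeal (hξ D) := by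
    rw [stratumIdeal, stalkIdeal_biSup, iSup_subtype']
    refine iSup_congr fun D => ?_
    rw [← stalkIdeal_vanishingIdeal_closure (hξ D)]
    congr 2
    refine TopologicalSpace.Closeds.ext ?_
    change closure D.1 = closure {ξ D}
    rw [← hξD, closure_closure]
  obtain ⟨D₀, hD₀⟩ := hI
  refine ⟨Finset.univ.image k, ⟨k ⟨D₀, hD₀⟩, Finset.mem_image_of_mem _ (Finset.mem_univ _)⟩, ?_, ?_⟩
  · rw [Finset.card_image_of_injective _ hkinj, Finset.card_univ, Fintype.card_coe]
  · have h1 : ∀ D, genIdeal (hξ D) = (Ideal.span {s (k D)}).map (c.stalkMap y).hom := fun D => by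
      rw [hk, Ideal.map_comap_of_surjective _ hcs]
    have h2 : ⨆ D, genIdeal (hξ D) = (Ideal.span (s '' (Finset.univ.image k : Finset (Fin r)))).map
        (c.stalkMap y).hom := by
      simp only [h1, ← Ideal.map_iSup]
      rw [Finset.coe_image, Finset.coe_univ, Set.image_univ, ← Set.range_comp, Ideal.span,
        Submodule.span_eq_iSup_of_singleton_spans, iSup_range]
      rfl
    rw [stalkIdeal_ker_comp, ker_subschemeι, hstr, h2, Ideal.comap_map_of_surjective' _ hcs,
      sup_eq_left, hkerc]
    have h3 : Ideal.span {s (k ⟨D₀, hD₀⟩)} ∈ (Ideal.span {toStalk g (c y) ϖ}).minimalPrimes :=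
      hmin ▸ Set.mem_range_self _
    refine h3.1.2.trans (Ideal.span_mono (Set.singleton_subset_iff.2 ?_))
    exact ⟨_, Finset.mem_coe.2 (Finset.mem_image_of_mem _ (Finset.mem_univ _)), rfl⟩

end Strata

/-! ### Flatness over a discrete valuation ring. -/

section FlatStalk

theorem exists_isLocalization_toStalk_id {R : Type u} [CommRing R] (y : Spec (.of R)) :
    letI := (toStalk (𝟙 (Spec (.of R))) y).toAlgebra
    ∃ M : Submonoid R, IsLocalization M ((Spec (.of R)).presheaf.stalk y) :=
  let p : PrimeSpectrum R := y
  ⟨p.asIdeal.primeCompl, StructureSheaf.IsLocalization.to_stalk R p⟩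

theorem flat_of_flat_toStalk {R : Type u} [CommRing R] {W : Scheme.{u}} (g : W ⟶ Spec (.of R))
    (h : ∀ w, (toStalk g w).Flat) : Flat g := by
  rw [Flat.iff_flat_stalkMap]
  intro w
  have hc : toStalk g w = (g.stalkMap w).hom.comp (toStalk (𝟙 (Spec (.of R))) (g w)) := by
    conv_lhs => rw [← Category.comp_id g, toStalk_comp]
  let _ := (toStalk (𝟙 (Spec (.of R))) (g w)).toAlgebra
  let _ := (g.stalkMap w).hom.toAlgebra
  let _ := (toStalk g w).toAlgebra
  have : IsScalarTower R ((Spec (.of R)).presheaf.stalk (g w)) (W.presheaf.stalk w) :=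
    .of_algebraMap_eq' hc
  obtain ⟨M, hM⟩ := exists_isLocalization_toStalk_id (g w)
  exact (Module.flat_iff_of_isLocalization ((Spec (.of R)).presheaf.stalk (g w))
    M (W.presheaf.stalk w)).2 (h w)

/-- Every nonzero element is a unit times a power of the uniformizer, so A injects into the domain
S, which is torsion-free. -/
theorem flat_of_irreducible_ne_zero {A S : Type u} [CommRing A] [IsDomain A]
    [IsDiscreteValuationRing A] [CommRing S] [IsDomain S] {ϖ : A} (hϖ : Irreducible ϖ)
    (φ : A →+* S) (h : φ ϖ ≠ 0) : φ.Flat := by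
  have hinj : Function.Injective φ := by
    rw [injective_iff_map_eq_zero]
    intro a ha
    by_contra h0
    obtain ⟨n, v, rfl⟩ := IsDiscreteValuationRing.eq_unit_mul_pow_irreducible h0 hϖ
    rw [map_mul, map_pow, (v.isUnit.map φ).mul_right_eq_zero] at ha
    exact h (eq_zero_of_pow_eq_zero ha)
  let _ := φ.toAlgebra
  have : FaithfulSMul A S := (faithfulSMul_iff_algebraMap_injective A S).2 hinj
  have : Module.IsTorsionFree A S := inferInstance
  exact (inferInstance : Module.Flat A S)

end FlatStalk

/-! ### Divisors cut out by a regular parameter. -/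

section RegularDivisor

variable {X Z : Scheme.{u}} {j : Z ⟶ X}

/-- The closed subscheme `j : Z ⟶ X` is locally the vanishing locus of a regular parameter. -/
def IsRegularDivisor {X Z : Scheme.{u}} (j : Z ⟶ X) : Prop :=
  ∀ z : Z, ∃ a, stalkIdeal j.ker (j z) = Ideal.span {a} ∧ IsPartRSP fun _ : Unit => a

theorem IsRegularDivisor.isRegularScheme_and_ringKrullDim [IsClosedImmersion j]
    (h : IsRegularDivisor j) (hX : IsRegularScheme X) (z : Z) :
    IsRegularLocalRing (Z.presheaf.stalk z) ∧
      ringKrullDim (X.presheaf.stalk (j z)) = ringKrullDim (Z.presheaf.stalk z) + 1 := by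
  obtain ⟨a, ha, hpa⟩ := h z
  have := hX (j z)
  have h1 := hpa.sumEmpty.of_surjective (j.stalkMap z).hom (stalkMap_surjective j z)
    (by rw [ker_stalkMap, ha, Set.range_const])
  refine ⟨?_, by simpa using h1.2⟩
  have := isNoetherianRing_of_surjective _ _ (j.stalkMap z).hom (stalkMap_surjective j z)
  exact h1.1.isRegularLocalRing

theorem IsRegularDivisor.isRegularScheme [IsClosedImmersion j]
    (h : IsRegularDivisor j) (hX : IsRegularScheme X) : IsRegularScheme Z := fun z =>
  (h.isRegularScheme_and_ringKrullDim hX z).1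

theorem IsRegularDivisor.hasPureCodim [IsClosedImmersion j]
    (h : IsRegularDivisor j) (hX : IsRegularScheme X) : HasPureCodim j 1 := fun z hz => by
  rw [(h.isRegularScheme_and_ringKrullDim hX z).2, ringKrullDim_stalk_eq_zero hz, zero_add]
  rfl

theorem isRegularDivisor_of_hasPureCodim [IsClosedImmersion j] (hj : HasPureCodim j 1)
    (hX : IsRegularScheme X) (hZ : IsRegularScheme Z) : IsRegularDivisor j := fun z => by
  obtain ⟨u, hu, hk⟩ := exists_isPartRSP_of_hasPureCodim hj hX hZ ⟨z, rfl⟩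
  refine ⟨u 0, by rw [hk, Set.range_unique]; rfl, ?_⟩
  convert hu.comp_equiv (Equiv.ofUnique Unit (Fin 1)) using 2
  exact congrArg u (Subsingleton.elim _ _)

end RegularDivisor

/-! ### Divisors transversal to all strata of the special fibre. -/

section Strata

variable {A : Type u} [CommRing A] [IsDomain A] [IsDiscreteValuationRing A] {X Z : Scheme.{u}}
  {f : X ⟶ Spec (.of A)} {j : Z ⟶ X}

/-- The closed subscheme `j : Z ⟶ X` meets all strata of the special fibre of `X` in smooth schemes
of pure codimension `1`. -/
def MeetsStrata (f : X ⟶ Spec (.of A)) (j : Z ⟶ X) : Prop :=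
  ∀ I : Finset (Set (pullback f (closedPt A) : Scheme.{u})), I.Nonempty →
    (I : Set (Set (pullback f (closedPt A) : Scheme.{u}))) ⊆ irreducibleComponents _ →
    ∃ (W : Scheme.{u}) (w : W ⟶ stratum (pullback f (closedPt A)) I) (v : W ⟶ Z),
      IsPullback w v (stratumToTotal f I) j ∧
      Smooth (w ≫ stratumι _ I ≫ pullback.snd f (closedPt A)) ∧ HasPureCodim w 1

/-- Transversality to the smallest stratum through x, the intersection of all components there, is
the only case needed. -/
theorem exists_parameters_of_meetsStrata [IsClosedImmersion j] (hX : IsQuasiSemistable f)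
    (hs : MeetsStrata f j) {x : X}
    (hx : x ∈ Set.range (pullback.fst f (closedPt A))) (hj : x ∈ Set.range j)
    {a : X.presheaf.stalk x} (ha : stalkIdeal j.ker x = Ideal.span {a}) :
    ∃ (r : ℕ) (C : Fin r → Set (pullback f (closedPt A) : Scheme.{u}))
      (t : Fin r → X.presheaf.stalk x), 0 < r ∧ Function.Injective C ∧
      (∀ k, C k ∈ irreducibleComponents (pullback f (closedPt A) : Scheme.{u})) ∧
      IsPartRSP (Sum.elim t fun _ : Unit => a) ∧
      (∀ ϖ : A, Irreducible ϖ → (Ideal.span {toStalk f x ϖ}).minimalPrimes =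
        Set.range fun k => Ideal.span {t k}) ∧
      ∀ (J : Finset (Fin r)) (I : Finset (Set (pullback f (closedPt A) : Scheme.{u}))),
        J.Nonempty → (I : Set (Set (pullback f (closedPt A) : Scheme.{u}))) = C '' J →
        stalkIdeal (stratumToTotal f I).ker x = Ideal.span (t '' J) := by
  classical
  obtain ⟨r, C, t, hr, hC, hC', ht, hmin, hstr⟩ := exists_parameters_of_mem_range hX hx
  refine ⟨r, C, t, hr, hC, hC', ?_, hmin, hstr⟩
  have hne : (Finset.univ : Finset (Fin r)).Nonempty := ⟨⟨0, hr⟩, Finset.mem_univ _⟩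
  have hI : ((Finset.univ.image C : Finset _) : Set (Set (pullback f (closedPt A) : Scheme.{u}))) ⊆
      irreducibleComponents _ := by
    rw [Finset.coe_image]
    rintro _ ⟨k, -, rfl⟩
    exact hC' k
  obtain ⟨W, w, v, hp, hsm, hw⟩ := hs _ (hne.image C) hI
  have hker := hstr Finset.univ _ hne (Finset.coe_image (f := C))
  rw [Finset.coe_univ, Set.image_univ] at hker
  have := hX.regular x
  refine isPartRSP_sumElim_of_isPullback hp hX.regular
    (hX.isRegularScheme_stratum (hne.image C) hI)
    (fun y => isRegularLocalRing_stalk_of_smooth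
      (w ≫ stratumι _ _ ≫ pullback.snd f (closedPt A)) y) hw ?_ hj ht hker ha
  rw [mem_range_iff_stalkIdeal, hker, Ideal.span_le]
  rintro _ ⟨k, rfl⟩
  exact ht.mem k

/-- If π lay in the prime (a), then (a) would contain some t_k, contradicting that t and a are parts
of one system of parameters. Away from the special fibre π is a unit. -/
theorem toStalk_comp_ne_zero [IsClosedImmersion j] (hX : IsQuasiSemistable f)
    (hs : MeetsStrata f j) (hj : IsRegularDivisor j) {ϖ : A} (hϖ : Irreducible ϖ) (z : Z) :
    toStalk (j ≫ f) z ϖ ≠ 0 := by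
  rw [toStalk_comp]
  change toStalk f (j z) ϖ ∉ RingHom.ker (j.stalkMap z).hom
  obtain ⟨a, ha, hpa⟩ := hj z
  rw [ker_stalkMap, ha]
  have := hX.regular (j z)
  by_cases hz : j z ∈ Set.range (pullback.fst f (closedPt A))
  · obtain ⟨r, C, t, hr, hC, hC', ht, hmin, hstr⟩ :=
      exists_parameters_of_meetsStrata hX hs hz ⟨z, rfl⟩ ha
    intro hmem
    have hP : (Ideal.span {a}).IsPrime :=
      (Ideal.span_singleton_prime (hpa.ne_zero ())).2 (hpa.prime ())
    obtain ⟨q, hq, hle⟩ := Ideal.exists_minimalPrimes_le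
      ((Ideal.span_singleton_le_iff_mem _).2 hmem)
    rw [hmin ϖ hϖ] at hq
    obtain ⟨k, rfl⟩ := hq
    refine ht.notMem_span_image (J := {Sum.inr ()}) (i := Sum.inl k) (by simp) ?_
    simpa using hle
  · rw [mem_range_specialFibre_iff hϖ] at hz
    intro hmem
    refine hz ((Ideal.span_singleton_le_iff_mem _).2 (hpa.mem ()) hmem)

theorem flat_of_meetsStrata [IsClosedImmersion j] (hX : IsQuasiSemistable f)
    (hs : MeetsStrata f j) (hj : IsRegularDivisor j) : Flat (j ≫ f) := by
  obtain ⟨ϖ, hϖ⟩ := IsDiscreteValuationRing.exists_irreducible A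
  refine flat_of_flat_toStalk _ fun z => ?_
  have := hj.isRegularScheme hX.regular z
  have := IsRegularLocalRing.isDomain (Z.presheaf.stalk z)
  exact flat_of_irreducible_ne_zero hϖ _ (toStalk_comp_ne_zero hX hs hj hϖ z)

end Strata

theorem isPullback_baseChange {X P S T : Scheme.{u}} (i : X ⟶ P) (p : P ⟶ S) (t : T ⟶ S) :
    IsPullback (baseChange i p t) (pullback.fst (i ≫ p) t) (pullback.fst p t) i := by
  refine IsPullback.of_right (h₁₂ := pullback.snd p t) (v₁₃ := t) (h₂₂ := p) ?_
    (pullback.lift_fst _ _ _) (IsPullback.of_hasPullback p t).flip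
  rw [pullback.lift_snd]
  exact (IsPullback.of_hasPullback (i ≫ p) t).flip

theorem HasSeparableResidueField.of_comp {L : Type u} [Field L] {X Y : Scheme.{u}} (m : Y ⟶ X)
    {f : X ⟶ Spec (.of L)} {g : Y ⟶ Spec (.of L)} (h : m ≫ f = g) {y : Y}
    (hy : HasSeparableResidueField g y) : HasSeparableResidueField f (m y) := by
  subst h
  have hc : (m.residueFieldMap y).hom.comp (toResidue f (m y)) = toResidue (m ≫ f) y := by
    rw [toResidue, toResidue, ← CommRingCat.hom_comp, Category.assoc, Category.assoc,
      Scheme.Γevaluation_naturality, Scheme.Hom.comp_appTop, Category.assoc]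
  unfold HasSeparableResidueField at hy ⊢
  let _ := (toResidue f (m y)).toAlgebra
  let _ := (toResidue (m ≫ f) y).toAlgebra
  exact Algebra.IsSeparable.of_algHom L (Y.residueField y)
    { (m.residueFieldMap y).hom with commutes' := fun a => congrArg (fun t => t a) hc }

theorem exists_surjective_stalk {X W : Scheme.{u}} (k : W ⟶ X) [IsClosedImmersion k] {x : X} {w : W}
    (h : k w = x) : ∃ φ : X.presheaf.stalk x →+* W.presheaf.stalk w, Function.Surjective φ ∧
      RingHom.ker φ = stalkIdeal k.ker x ∧
      ∀ {R : Type u} [CommRing R] (f : X ⟶ Spec (.of R)),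
        φ.comp (toStalk f x) = toStalk (k ≫ f) w := by
  subst h
  exact ⟨(k.stalkMap w).hom, stalkMap_surjective k w, ker_stalkMap k w,
    fun f => (toStalk_comp k f w).symm⟩

/-! ### The divisor inherits quasi-semistability and forms a normal crossing divisor. -/

section RegularSections

variable {A : Type u} [CommRing A] [IsDomain A] [IsDiscreteValuationRing A] {X Z : Scheme.{u}}
  {f : X ⟶ Spec (.of A)} {j : Z ⟶ X}

/-- For closed subschemes of the special fibre, smoothness over the residue field at a point depends
only on the ideal in the local ring of the total space. -/
theorem formallySmooth_toStalk_of_stalkIdeal_eq {W₁ W₂ : Scheme.{u}} {k₁ : W₁ ⟶ X} {k₂ : W₂ ⟶ X}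
    [IsClosedImmersion k₁] [IsClosedImmersion k₂]
    {g₁ : W₁ ⟶ Spec (.of (IsLocalRing.ResidueField A))}
    {g₂ : W₂ ⟶ Spec (.of (IsLocalRing.ResidueField A))} (h₁ : k₁ ≫ f = g₁ ≫ closedPt A)
    (h₂ : k₂ ≫ f = g₂ ≫ closedPt A) {x : X} {w₁ : W₁} {w₂ : W₂} (hw₁ : k₁ w₁ = x) (hw₂ : k₂ w₂ = x)
    (h : stalkIdeal k₁.ker x = stalkIdeal k₂.ker x) (hs : (toStalk g₁ w₁).FormallySmooth) :
    (toStalk g₂ w₂).FormallySmooth := by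
  obtain ⟨φ₁, hφ₁, hk₁, hc₁⟩ := exists_surjective_stalk k₁ hw₁
  obtain ⟨φ₂, hφ₂, hk₂, hc₂⟩ := exists_surjective_stalk k₂ hw₂
  refine formallySmooth_of_ker_eq (α := toStalk f x) (β := IsLocalRing.residue A)
    IsLocalRing.residue_surjective hφ₁ hφ₂ (by rw [hk₁, hk₂, h]) ?_ ?_ hs
  · rw [hc₁, ← toStalk_SpecMap]
    congr 1
    exact h₁.symm
  · rw [hc₂, ← toStalk_SpecMap]
    congr 1
    exact h₂.symm

/-- Reducing modulo a keeps t part of a regular system of parameters, and the monomial form of π is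
transported along the stalk map. -/
theorem exists_parameters_of_isRegularDivisor [IsClosedImmersion j] (hX : IsQuasiSemistable f)
    (hs : MeetsStrata f j) (hj : IsRegularDivisor j) {z : Z}
    (hz : z ∈ Set.range (pullback.fst (j ≫ f) (closedPt A))) :
    ∃ (r : ℕ) (C : Fin r → Set (pullback f (closedPt A) : Scheme.{u}))
      (t : Fin r → X.presheaf.stalk (j z)) (a : X.presheaf.stalk (j z)),
      Function.Injective C ∧
      (∀ k, C k ∈ irreducibleComponents (pullback f (closedPt A) : Scheme.{u})) ∧
      stalkIdeal j.ker (j z) = Ideal.span {a} ∧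
      IsPartRSP (Sum.elim t fun _ : Unit => a) ∧ IsPartRSP ((j.stalkMap z).hom ∘ t) ∧
      (∀ ϖ : A, Irreducible ϖ → (Ideal.span {toStalk f (j z) ϖ}).minimalPrimes =
        Set.range fun k => Ideal.span {t k}) ∧
      (∀ ϖ : A, Irreducible ϖ → ∃ (e : Fin r → ℕ) (v : Z.presheaf.stalk z), IsUnit v ∧
        (∀ i, 1 ≤ e i) ∧
        toStalk (j ≫ f) z ϖ = v * ∏ i, ((j.stalkMap z).hom ∘ t) i ^ e i) ∧
      (∀ ϖ : A, Irreducible ϖ → (Ideal.span {toStalk (j ≫ f) z ϖ}).minimalPrimes =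
        Set.range fun k => Ideal.span {((j.stalkMap z).hom ∘ t) k}) ∧
      ∀ (J : Finset (Fin r)) (I : Finset (Set (pullback f (closedPt A) : Scheme.{u}))),
        J.Nonempty → (I : Set (Set (pullback f (closedPt A) : Scheme.{u}))) = C '' J →
        stalkIdeal (stratumToTotal f I).ker (j z) = Ideal.span (t '' J) := by
  obtain ⟨a, ha, hpa⟩ := hj z
  obtain ⟨ϖ₀, hϖ₀⟩ := IsDiscreteValuationRing.exists_irreducible A
  have hx : j z ∈ Set.range (pullback.fst f (closedPt A)) := by
    rw [mem_range_specialFibre_iff hϖ₀] at hz ⊢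
    rw [toStalk_comp] at hz
    rw [← IsLocalRing.maximalIdeal_comap (j.stalkMap z).hom]
    exact hz
  obtain ⟨r, C, t, hr, hC, hC', ht, hmin, hstr⟩ :=
    exists_parameters_of_meetsStrata hX hs hx ⟨z, rfl⟩ ha
  have := hX.regular (j z)
  have := hj.isRegularScheme hX.regular z
  have hφt : IsPartRSP ((j.stalkMap z).hom ∘ t) := by
    have h1 : IsPartRSP (Sum.elim (fun _ : Unit => a) t) := by
      have := ht.comp_equiv (Equiv.sumComm Unit (Fin r))
      convert this using 1
      ext (k | k) <;> rfl
    exact (h1.of_surjective _ (stalkMap_surjective j z)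
      (by rw [ker_stalkMap, ha, Set.range_const])).1
  have hfac : ∀ ϖ : A, Irreducible ϖ → ∃ (e : Fin r → ℕ) (v : Z.presheaf.stalk z), IsUnit v ∧
      (∀ i, 1 ≤ e i) ∧ toStalk (j ≫ f) z ϖ = v * ∏ i, ((j.stalkMap z).hom ∘ t) i ^ e i := by
    intro ϖ hϖ
    have h0 := toStalk_comp_ne_zero hX hs hj hϖ z
    have hc : toStalk (j ≫ f) z ϖ = (j.stalkMap z).hom (toStalk f (j z) ϖ) := by
      rw [toStalk_comp]; rfl
    obtain ⟨e, v, hv, he, hev⟩ := ht.inl.exists_eq_unit_mul_prod_pow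
      (fun h => h0 (by rw [hc, h, map_zero])) (hmin ϖ hϖ)
    refine ⟨e, _, hv.map (j.stalkMap z).hom, he, ?_⟩
    rw [hc, hev, map_mul, map_prod]
    simp only [map_pow, Function.comp]
  refine ⟨r, C, t, a, hC, hC', ha, ht, hφt, hmin, hfac, fun ϖ hϖ => ?_, hstr⟩
  obtain ⟨e, v, hv, he, hev⟩ := hfac ϖ hϖ
  rw [hev]
  exact hφt.minimalPrimes_span_unit_mul_prod_pow hv he

theorem isReduced_specialFibre_iff {ϖ : A} (hϖ : Irreducible ϖ) :
    IsReduced (pullback f (closedPt A)) ↔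
      ∀ x ∈ Set.range (pullback.fst f (closedPt A)), (Ideal.span {toStalk f x ϖ}).IsRadical := by
  have h : ∀ y : (pullback f (closedPt A) : Scheme.{u}),
      (_root_.IsReduced ((pullback f (closedPt A)).presheaf.stalk y) ↔
      (Ideal.span {toStalk f (pullback.fst f (closedPt A) y) ϖ}).IsRadical) := fun y => by
    rw [← stalkIdeal_ker_specialFibre hϖ, Ideal.isRadical_iff_quotient_reduced]
    exact ⟨fun _ => isReduced_of_injective _ (stalkQuotientEquiv (pullback.fst f (closedPt A)) y).injective,
      fun _ => isReduced_of_injective _ (stalkQuotientEquiv (pullback.fst f (closedPt A)) y).symm.injective⟩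
  constructor
  · rintro hr _ ⟨y, rfl⟩
    exact (h y).1 inferInstance
  · intro hr
    have := fun y => (h y).2 (hr _ ⟨y, rfl⟩)
    exact isReduced_of_isReduced_stalk _

theorem span_toStalk_eq_span_prod [IsReduced (pullback f (closedPt A))] {ϖ : A}
    (hϖ : Irreducible ϖ) {x : X} (hx : x ∈ Set.range (pullback.fst f (closedPt A)))
    [IsNoetherianRing (X.presheaf.stalk x)] {r : ℕ}
    {t : Fin r → X.presheaf.stalk x} (ht : IsPartRSP t)
    (hmin : (Ideal.span {toStalk f x ϖ}).minimalPrimes = Set.range fun k => Ideal.span {t k}) :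
    Ideal.span {toStalk f x ϖ} = Ideal.span {∏ i, t i} := by
  rw [← ht.radical_eq hmin, ((isReduced_specialFibre_iff hϖ).1 ‹_› x hx).radical]

theorem isReduced_specialFibre_of_meetsStrata [IsClosedImmersion j] (hX : IsQuasiSemistable f)
    (hs : MeetsStrata f j) (hj : IsRegularDivisor j) [IsReduced (pullback f (closedPt A))] :
    IsReduced (pullback (j ≫ f) (closedPt A)) := by
  obtain ⟨ϖ, hϖ⟩ := IsDiscreteValuationRing.exists_irreducible A
  rw [isReduced_specialFibre_iff hϖ]
  intro z hz
  obtain ⟨r, C, t, a, hC, hC', ha, ht, hφt, hmin, -⟩ :=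
    exists_parameters_of_isRegularDivisor hX hs hj hz
  have hx : j z ∈ Set.range (pullback.fst f (closedPt A)) := by
    rw [mem_range_specialFibre_iff hϖ] at hz ⊢
    rw [toStalk_comp] at hz
    rw [← IsLocalRing.maximalIdeal_comap (j.stalkMap z).hom]
    exact hz
  have := hX.regular (j z)
  have := hj.isRegularScheme hX.regular z
  have h := congrArg (Ideal.map (j.stalkMap z).hom)
    (span_toStalk_eq_span_prod hϖ hx ht.inl (hmin ϖ hϖ))
  rw [Ideal.map_span, Ideal.map_span, Set.image_singleton, Set.image_singleton, map_prod] at h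
  rw [toStalk_comp]
  exact h ▸ hφt.isRadical_span_prod

theorem stalkIdeal_specialFibreRed {ϖ : A} (hϖ : Irreducible ϖ) (x : X) :
    stalkIdeal (specialFibreRed f) x = (Ideal.span {toStalk f x ϖ}).radical := by
  rw [← stalkIdeal_ker_specialFibre hϖ, ← stalkIdeal_radical, ← vanishingIdeal_support,
    specialFibreRed]
  congr 2
  exact TopologicalSpace.Closeds.ext (Scheme.Hom.support_ker _).symm

/-- At a common point the divisor is given by a·∏ t_k, on the special fibre alone by ∏ t_k, on Z
alone by a. -/
theorem isSNCDivisor_of_meetsStrata [IsClosedImmersion j] (hX : IsQuasiSemistable f)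
    (hs : MeetsStrata f j) (hj : IsRegularDivisor j) :
    IsSNCDivisor (j.ker ⊓ specialFibreRed f) := fun x hx => by
  obtain ⟨ϖ, hϖ⟩ := IsDiscreteValuationRing.exists_irreducible A
  have hreg := hX.regular x
  refine ⟨hreg, ?_⟩
  have htop : ∀ I : Ideal (X.presheaf.stalk x), ¬ I ≤ IsLocalRing.maximalIdeal _ → I = ⊤ :=
    fun I hI => by_contra fun h => hI (IsLocalRing.le_maximalIdeal h)
  suffices H : ∃ (ι : Type) (_ : Fintype ι) (_ : Nonempty ι) (t : ι → X.presheaf.stalk x),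
      IsPartRSP t ∧ stalkIdeal (j.ker ⊓ specialFibreRed f) x = Ideal.span {∏ i, t i} by
    obtain ⟨ι, _, _, t, ht, h⟩ := H
    obtain ⟨d, s, J, hd, hs, hJ, hJs⟩ := ht.exists_fin
    exact ⟨d, s, J, hd, hs, hJ, by rw [h, hJs]⟩
  rw [mem_support_iff_stalkIdeal] at hx
  rw [stalkIdeal_inf, stalkIdeal_specialFibreRed hϖ] at hx ⊢
  by_cases h1 : x ∈ Set.range (pullback.fst f (closedPt A))
  · by_cases h2 : x ∈ Set.range j
    · obtain ⟨z, rfl⟩ := h2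
      obtain ⟨a, ha, hpa⟩ := hj z
      obtain ⟨r, C, t, hr, hC, hC', ht, hmin, hstr⟩ :=
        exists_parameters_of_meetsStrata hX hs h1 ⟨z, rfl⟩ ha
      refine ⟨_, inferInstance, ⟨Sum.inr ()⟩, _, ht, ?_⟩
      rw [ht.span_prod_eq_iInf, iInf_sum, ht.inl.radical_eq (hmin ϖ hϖ),
        ht.inl.span_prod_eq_iInf, ha, inf_comm]
      simp
    · obtain ⟨r, C, t, hr, hC, hC', ht, hmin, hstr⟩ := exists_parameters_of_mem_range hX h1
      refine ⟨_, inferInstance, ⟨⟨0, hr⟩⟩, _, ht, ?_⟩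
      rw [mem_range_iff_stalkIdeal] at h2
      rw [htop _ h2, top_inf_eq, ht.radical_eq (hmin ϖ hϖ)]
  · rw [mem_range_specialFibre_iff hϖ, ← Ideal.span_singleton_le_iff_mem] at h1
    rw [htop _ h1, Ideal.radical_top, inf_top_eq] at hx ⊢
    rw [← mem_range_iff_stalkIdeal] at hx
    obtain ⟨z, rfl⟩ := hx
    obtain ⟨a, ha, hpa⟩ := hj z
    exact ⟨Unit, inferInstance, inferInstance, _, hpa, by simpa using ha⟩

/-- Separability of the residue field passes to the image point on X, where the model supplies A'.
The exponents and the number of variables are then computed afresh on Z. -/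
theorem hasModelCompletion_of_meetsStrata [IsClosedImmersion j] (hX : IsQuasiSemistable f)
    (hs : MeetsStrata f j) (hj : IsRegularDivisor j)
    {y : (pullback (j ≫ f) (closedPt A) : Scheme.{u})} (hy : IsClosed {y})
    (hsep : HasSeparableResidueField (pullback.snd (j ≫ f) (closedPt A)) y) :
    HasModelCompletion (j ≫ f) (pullback.fst (j ≫ f) (closedPt A) y) := by
  let m := baseChange j f (closedPt A)
  have : IsClosedImmersion m := 
    MorphismProperty.of_isPullback (isPullback_baseChange j f (closedPt A)).flip inferInstance
  have hmc := hX.completion (m y) (by simpa using m.isClosedMap _ hy)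
    (hsep.of_comp m (pullback.lift_snd _ _ _))
  have hmy : pullback.fst f (closedPt A) (m y) = j (pullback.fst (j ≫ f) (closedPt A) y) := by
    rw [← Scheme.Hom.comp_apply, ← Scheme.Hom.comp_apply, pullback.lift_fst]
  rw [hmy] at hmc
  obtain ⟨z, hz⟩ : ∃ z, z = pullback.fst (j ≫ f) (closedPt A) y := ⟨_, rfl⟩
  have hzr : z ∈ Set.range (pullback.fst (j ≫ f) (closedPt A)) := ⟨y, hz.symm⟩
  rw [← hz] at hmc ⊢
  obtain ⟨A', _, _, _, _, _, π, r₀, n₀, e₀, v₀, hπ, -, -, iso, hiso⟩ := hmc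
  obtain ⟨r, C, t, a, hC, hC', ha, ht, hφt, hmin, hfac, -⟩ :=
    exists_parameters_of_isRegularDivisor hX hs hj hzr
  have := hX.regular (j z)
  have := hj.isRegularScheme hX.regular z
  obtain ⟨e, w, hw, he, hew⟩ := hfac π hπ
  have hmem : toStalk (j ≫ f) z π ∈ IsLocalRing.maximalIdeal _ :=
    (mem_range_specialFibre_iff hπ z).1 hzr
  rw [toStalk_comp] at hmem hew
  obtain ⟨n, s, hspan, hdim⟩ := hφt
  rw [Nat.card_fin] at hdim
  obtain ⟨v, hv, iso', hiso'⟩ := exists_modelRing_equiv_of_surjective (j.stalkMap z).hom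
    (stalkMap_surjective j z) (toStalk f (j z))
    (iso.symm.toRingHom.comp (Ideal.Quotient.mk _))
    (iso.symm.surjective.comp Ideal.Quotient.mk_surjective)
    (fun a => (iso.symm_apply_eq).2 (hiso a).symm) hπ hmem _ s hspan hdim e he hw hew
  refine ⟨A', inferInstance, inferInstance, inferInstance, inferInstance, inferInstance, π, r, n,
    e, v, hπ, he, hv, iso', fun a => ?_⟩
  rw [toStalk_comp]
  exact hiso' a

theorem components_of_meetsStrata [IsClosedImmersion j] (hX : IsQuasiSemistable f)
    (hs : MeetsStrata f j) (hj : IsRegularDivisor j)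
    {I : Finset (Set (pullback (j ≫ f) (closedPt A) : Scheme.{u}))} (hI : I.Nonempty)
    (hI' : (I : Set (Set (pullback (j ≫ f) (closedPt A) : Scheme.{u}))) ⊆
      irreducibleComponents _) :
    Smooth (stratumι (pullback (j ≫ f) (closedPt A)) I ≫ pullback.snd (j ≫ f) (closedPt A)) ∧
    HasPureCodim (stratumToTotal (j ≫ f) I) I.card := by
  classical
  have := hX.locallyOfFiniteType
  obtain ⟨ϖ, hϖ⟩ := IsDiscreteValuationRing.exists_irreducible A
  have hsupp : ∀ w : stratum (pullback (j ≫ f) (closedPt A)) I,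
      stratumι (pullback (j ≫ f) (closedPt A)) I w ∈
        (stratumIdeal (pullback (j ≫ f) (closedPt A)) I).support := fun w => by
    rw [← SetLike.mem_coe, ← range_subschemeι]
    exact ⟨w, rfl⟩
  constructor
  · have := locallyOfFinitePresentation_of_locallyOfFiniteType
      (stratumι (pullback (j ≫ f) (closedPt A)) I ≫ pullback.snd (j ≫ f) (closedPt A))
    rw [smooth_iff_toStalk]
    intro w
    obtain ⟨r, C, t, a, hC, hC', ha, ht, hφt, -, -, hmin, hstr⟩ :=
      exists_parameters_of_isRegularDivisor hX hs hj ⟨_, rfl⟩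
    obtain ⟨J, hJ, hJc, hJs⟩ := exists_stalkIdeal_stratum_eq hϖ (hmin ϖ hϖ) hI hI' (hsupp w)
    have hCJ : ((J.image C : Finset _) : Set (Set (pullback f (closedPt A) : Scheme.{u}))) ⊆
        irreducibleComponents _ := by
      rw [Finset.coe_image]
      rintro _ ⟨k, -, rfl⟩
      exact hC' k
    obtain ⟨W, k, v, hp, hsm, hw⟩ := hs _ (hJ.image C) hCJ
    have hker := hstr J _ hJ (Finset.coe_image (f := C))
    obtain ⟨y, hy⟩ : j (pullback.fst (j ≫ f) (closedPt A) (stratumι _ I w)) ∈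
        Set.range (stratumToTotal f (J.image C)) := by
      rw [mem_range_iff_stalkIdeal, hker, Ideal.span_le]
      rintro _ ⟨k, -, rfl⟩
      exact ht.inl.mem k
    obtain ⟨ω, rfl⟩ := mem_range_of_isPullback hp (y := y) ⟨_, hy.symm⟩
    have : IsClosedImmersion k := MorphismProperty.of_isPullback hp.flip inferInstance
    -- The intersection of H with the stratum of X has local ideal (t_J, a), the same as the stratum
    -- of Z viewed in X. Smoothness of the former is the hypothesis, and transfers.
    have hker' : stalkIdeal (k ≫ stratumToTotal f (J.image C)).ker
        (j (pullback.fst (j ≫ f) (closedPt A) (stratumι _ I w))) =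
        Ideal.span (t '' J) ⊔ Ideal.span {a} := by
      rw [← hker, ← ha, ← hy, stalkIdeal_ker_comp, stalkIdeal_ker_of_isPullback hp,
        Ideal.comap_map_of_surjective' _ (stalkMap_surjective _ _), ker_stalkMap, sup_comm]
    refine formallySmooth_toStalk_of_stalkIdeal_eq (f := f)
      (k₁ := k ≫ stratumToTotal f (J.image C)) (k₂ := stratumToTotal (j ≫ f) I ≫ j)
      (g₁ := k ≫ stratumι _ _ ≫ pullback.snd f (closedPt A)) ?_ ?_ (w₁ := ω) ?_ rfl ?_
      ((smooth_iff_toStalk _).1 hsm ω)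
    · simp only [Category.assoc, pullback.condition]
    · simp only [Category.assoc, pullback.condition]
    · rw [Scheme.Hom.comp_apply, hy]
      rfl
    · refine hker'.trans (Eq.symm ((stalkIdeal_ker_comp (stratumToTotal (j ≫ f) I) j
        (pullback.fst (j ≫ f) (closedPt A) (stratumι _ I w))).trans ?_))
      refine (congrArg (Ideal.comap _) hJs).trans ?_
      rw [Set.image_comp, ← Ideal.map_span,
        Ideal.comap_map_of_surjective' _ (stalkMap_surjective _ _), ker_stalkMap, ha]
  -- At a generic point of the stratum its local ring has dimension 0, so the ambient dimension
  -- equals the number of parameters cutting it out.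
  · intro w hw
    obtain ⟨r, C, t, a, hC, hC', ha, ht, hφt, -, -, hmin, hstr⟩ :=
      exists_parameters_of_isRegularDivisor hX hs hj ⟨_, rfl⟩
    obtain ⟨J, hJ, hJc, hJs⟩ := exists_stalkIdeal_stratum_eq hϖ (hmin ϖ hϖ) hI hI' (hsupp w)
    have : IsRegularLocalRing (Z.presheaf.stalk (pullback.fst (j ≫ f) (closedPt A)
        (stratumι _ I w))) := hj.isRegularScheme hX.regular _
    have h := hφt.ringKrullDim_image J
    rw [← hJs, Set.ncard_coe_finset, hJc] at h
    have h2 := ringKrullDim_eq_of_ringEquiv (stalkQuotientEquiv (stratumToTotal (j ≫ f) I) w)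
    rw [ringKrullDim_stalk_eq_zero hw] at h2
    exact h.trans ((congrArg (· + _) h2).trans (zero_add _))

theorem IsQuasiSemistable.of_meetsStrata [IsClosedImmersion j] (hX : IsQuasiSemistable f)
    (hs : MeetsStrata f j) (hj : IsRegularDivisor j) : IsQuasiSemistable (j ≫ f) where
  quasiProjective := by
    obtain ⟨N, i, hi, hif⟩ := hX.quasiProjective
    exact ⟨N, j ≫ i, inferInstance, by rw [Category.assoc, hif]⟩
  regular := hj.isRegularScheme hX.regular
  flat := flat_of_meetsStrata hX hs hj
  completion _ := hasModelCompletion_of_meetsStrata hX hs hj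
  components _ := components_of_meetsStrata hX hs hj

theorem IsSemistable.of_meetsStrata [IsClosedImmersion j] (hX : IsSemistable f)
    (hs : MeetsStrata f j) (hj : IsRegularDivisor j) : IsSemistable (j ≫ f) where
  toIsQuasiSemistable := hX.toIsQuasiSemistable.of_meetsStrata hs hj
  reduced :=
    have := hX.reduced
    isReduced_specialFibre_of_meetsStrata hX.toIsQuasiSemistable hs hj

end RegularSections

/-! ### Invariance under open immersions. -/

section OpenImmersion

theorem _root_.IsPartRSP.map_ringEquiv {R S : Type*} [CommRing R] [IsLocalRing R] [CommRing S]
    [IsLocalRing S] {ι : Type*} {t : ι → R} (h : IsPartRSP t) (e : R ≃+* S) :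
    IsPartRSP (e ∘ t) := by
  obtain ⟨k, s, hs, hd⟩ := h
  refine ⟨k, e ∘ s, ?_, (ringKrullDim_eq_of_ringEquiv e).symm.trans hd⟩
  rw [Set.range_comp, Set.range_comp, ← Set.image_union]
  have := congrArg (Ideal.map (e : R →+* S)) hs
  rw [Ideal.map_span] at this
  refine this.trans ?_
  rw [Ideal.map_comap_of_equiv]
  exact IsLocalRing.maximalIdeal_comap (e.symm : S →+* R)

/-- The ideal sheaf `D` is generated at `x` by a regular parameter. -/
def IsRegularDivisorAt {X : Scheme.{u}} (D : X.IdealSheafData) (x : X) : Prop :=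
  ∃ a, stalkIdeal D x = Ideal.span {a} ∧ IsPartRSP fun _ : Unit => a

variable {X Y Z W : Scheme.{u}} {w : W ⟶ Y} {v : W ⟶ Z} {g : Y ⟶ X} {j : Z ⟶ X}

theorem isRegularDivisorAt_iff_of_isPullback (h : IsPullback w v g j) [IsClosedImmersion j]
    [IsOpenImmersion g] (y : Y) :
    IsRegularDivisorAt w.ker y ↔ IsRegularDivisorAt j.ker (g y) := by
  let e := (asIso (g.stalkMap y)).commRingCatIsoToRingEquiv
  have he : stalkIdeal w.ker y = (stalkIdeal j.ker (g y)).map (e : X.presheaf.stalk (g y) →+* Y.presheaf.stalk y) :=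
    stalkIdeal_ker_of_isPullback h y
  constructor
  · rintro ⟨a, ha, hpa⟩
    refine ⟨e.symm a, ?_, hpa.map_ringEquiv e.symm⟩
    have := congrArg (Ideal.map (e.symm : Y.presheaf.stalk y →+* X.presheaf.stalk (g y))) (he.symm.trans ha)
    rw [Ideal.map_map, Ideal.map_span, Set.image_singleton] at this
    simpa using this
  · rintro ⟨a, ha, hpa⟩
    refine ⟨e a, ?_, hpa.map_ringEquiv e⟩
    rw [he, ha, Ideal.map_span, Set.image_singleton]
    rfl

theorem IsRegularDivisor.of_isPullback (hj : IsRegularDivisor j) (h : IsPullback w v g j)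
    [IsClosedImmersion j] [IsOpenImmersion g] : IsRegularDivisor w := fun z => by
  change IsRegularDivisorAt _ _
  rw [isRegularDivisorAt_iff_of_isPullback h, ← Scheme.Hom.comp_apply, h.w,
    Scheme.Hom.comp_apply]
  exact hj (v z)

theorem IsRegularScheme.of_isOpenImmersion (hX : IsRegularScheme X) (g : Y ⟶ X)
    [IsOpenImmersion g] : IsRegularScheme Y := fun y =>
  have := hX (g y)
  .of_ringEquiv (asIso (g.stalkMap y)).commRingCatIsoToRingEquiv

end OpenImmersion

/-! ### The generic fibre as an open subscheme, and specialization in the proper case. -/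

section GenericFibre

variable {A : Type u} [CommRing A] [IsDomain A] [IsDiscreteValuationRing A]

/-- Inverting one uniformizer inverts every nonzero element; this makes the generic fibre open in X.
-/
theorem isLocalization_away_fractionRing {ϖ : A} (hϖ : Irreducible ϖ) :
    IsLocalization.Away ϖ (FractionRing A) := by
  have : IsLocalization (nonZeroDivisors A) (Localization.Away ϖ) := by
    refine IsLocalization.of_le_of_exists_dvd (Submonoid.powers ϖ) _ ?_ fun a ha => ?_
    · rw [Submonoid.powers_le]
      exact mem_nonZeroDivisors_of_ne_zero hϖ.ne_zero
    · obtain ⟨n, v, rfl⟩ := IsDiscreteValuationRing.eq_unit_mul_pow_irreducible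
        (nonZeroDivisors.ne_zero ha) hϖ
      exact ⟨ϖ ^ n, ⟨n, rfl⟩, (v.isUnit.mul_left_dvd).2 dvd_rfl⟩
  exact IsLocalization.isLocalization_of_algEquiv _
    (IsLocalization.algEquiv (nonZeroDivisors A) (Localization.Away ϖ) (FractionRing A))

instance isOpenImmersion_genPt : IsOpenImmersion (genPt A) := by
  obtain ⟨ϖ, hϖ⟩ := IsDiscreteValuationRing.exists_irreducible A
  have := isLocalization_away_fractionRing hϖ
  exact IsOpenImmersion.of_isLocalization ϖ

theorem range_closedPt {ϖ : A} (hϖ : Irreducible ϖ) :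
    Set.range (closedPt A) = PrimeSpectrum.zeroLocus {ϖ} := by
  refine (range_comap_of_surjective _ _ IsLocalRing.residue_surjective).trans ?_
  rw [IsLocalRing.ker_residue, hϖ.maximalIdeal_eq, PrimeSpectrum.zeroLocus_span]

theorem range_genPt {ϖ : A} (hϖ : Irreducible ϖ) :
    Set.range (genPt A) = (PrimeSpectrum.zeroLocus {ϖ})ᶜ := by
  have := isLocalization_away_fractionRing hϖ
  rw [← PrimeSpectrum.basicOpen_eq_zeroLocus_compl]
  exact PrimeSpectrum.localization_away_comap_range (FractionRing A) ϖ

variable {X Z : Scheme.{u}} {f : X ⟶ Spec (.of A)} {j : Z ⟶ X}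

theorem mem_range_specialFibre_or_genericFibre (f : X ⟶ Spec (.of A)) (x : X) :
    x ∈ Set.range (pullback.fst f (closedPt A)) ∨ x ∈ Set.range (pullback.fst f (genPt A)) := by
  obtain ⟨ϖ, hϖ⟩ := IsDiscreteValuationRing.exists_irreducible A
  rw [Scheme.Pullback.range_fst, Scheme.Pullback.range_fst, range_closedPt hϖ, range_genPt hϖ]
  exact em _

theorem isRegularDivisor_of_generic [IsClosedImmersion j] (hX : IsQuasiSemistable f)
    (hs : MeetsStrata f j) (hp : ∀ x, ∃ a, stalkIdeal j.ker x = Ideal.span {a}) {W : Scheme.{u}}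
    {w : W ⟶ pullback f (genPt A)} {v : W ⟶ Z} (h : IsPullback w v (pullback.fst f (genPt A)) j)
    (hW : IsRegularScheme W) (hw : HasPureCodim w 1) : IsRegularDivisor j := fun z => by
  obtain hz | ⟨y, hy⟩ := mem_range_specialFibre_or_genericFibre f (j z)
  · obtain ⟨a, ha⟩ := hp (j z)
    obtain ⟨r, C, t, -, -, -, ht, -⟩ := exists_parameters_of_meetsStrata hX hs hz ⟨z, rfl⟩ ha
    have := hX.regular (j z)
    exact ⟨a, ha, ht.inr⟩
  · have : IsClosedImmersion w := MorphismProperty.of_isPullback h.flip inferInstance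
    obtain ⟨y', rfl⟩ := mem_range_of_isPullback h (y := y) ⟨z, hy.symm⟩
    change IsRegularDivisorAt _ _
    rw [← hy, ← isRegularDivisorAt_iff_of_isPullback h]
    exact isRegularDivisor_of_hasPureCodim hw (hX.regular.of_isOpenImmersion (pullback.fst f (genPt A))) hW y'

/-- The image of the closure of z is closed in Spec A and nonempty, so it contains the closed point.
-/
theorem exists_specializes_specialFibre (g : Z ⟶ Spec (.of A)) [UniversallyClosed g] (z : Z) :
    ∃ z₀ ∈ Set.range (pullback.fst g (closedPt A)), z ⤳ z₀ := by
  obtain ⟨ϖ, hϖ⟩ := IsDiscreteValuationRing.exists_irreducible A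
  have h := g.isClosedMap _ (isClosed_closure (s := {z}))
  obtain ⟨z₀, hz₀, hg⟩ : IsLocalRing.closedPoint A ∈ g '' closure {z} :=
    (IsLocalRing.specializes_closedPoint (R := A) (g z)).mem_closed h
      ⟨z, subset_closure rfl, rfl⟩
  refine ⟨z₀, ?_, specializes_iff_mem_closure.2 hz₀⟩
  rw [Scheme.Pullback.range_fst, range_closedPt hϖ]
  change g z₀ ∈ (PrimeSpectrum.zeroLocus {ϖ} : Set (PrimeSpectrum A))
  rw [hg]
  exact Set.singleton_subset_iff.2 ((IsLocalRing.mem_maximalIdeal ϖ).2 hϖ.not_isUnit)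

/-- The kernel is generated by parameters; there is at most one by Krull's principal ideal theorem,
and at least one since a ≠ 0. -/
theorem _root_.isPartRSP_of_ker_eq_span_singleton {R S : Type*} [CommRing R] [IsRegularLocalRing R]
    [CommRing S] [IsRegularLocalRing S] (φ : R →+* S) (hφ : Function.Surjective φ) {a : R}
    (ha : a ≠ 0) (hker : RingHom.ker φ = Ideal.span {a}) : IsPartRSP fun _ : Unit => a := by
  obtain ⟨c, u, hu, h⟩ := IsRegularLocalRing.exists_isPartRSP_of_surjective φ hφ
  have hs : Ideal.span (Set.range u) = Ideal.span (Set.range fun _ : Unit => a) := by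
    rw [← h, hker, Set.range_const]
  refine hu.congr_span ?_ hs
  have h1 := hu.height_span
  have hc : c ≤ 1 := by
    have := IsRegularLocalRing.isDomain S
    have hp : (Ideal.span {a}).IsPrime := hker ▸ RingHom.ker_isPrime φ
    have := Ideal.height_le_one_of_isPrincipal_of_mem_minimalPrimes (Ideal.span {a}) (Ideal.span {a})
      (by rw [Ideal.minimalPrimes_eq_subsingleton_self]; rfl)
    rw [← h, hker] at h1
    rw [h1, Nat.card_fin] at this
    exact_mod_cast this
  have hc0 : c ≠ 0 := by
    rintro rfl
    rw [Set.range_eq_empty, Ideal.span_empty, Set.range_const, eq_comm,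
      Ideal.span_singleton_eq_bot] at hs
    exact ha hs
  rw [Nat.card_fin, Nat.card_unique]
  omega

/-- At a specialization z₀ in the special fibre, Z is regular. The local ring of Z at z is a
localization of the one at z₀, regular by Serre's theorem, and the equation of Z stays nonzero in
the localization of a domain. -/
theorem isRegularDivisor_of_universallyClosed [IsClosedImmersion j] [UniversallyClosed f]
    (hX : IsQuasiSemistable f)
    (hs : MeetsStrata f j) (hp : ∀ x, ∃ a, stalkIdeal j.ker x = Ideal.span {a}) :
    IsRegularDivisor j := fun z => by
  obtain ⟨z₀, hz₀, hz⟩ := exists_specializes_specialFibre (j ≫ f) z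
  obtain ⟨ϖ, hϖ⟩ := IsDiscreteValuationRing.exists_irreducible A
  have hx : j z₀ ∈ Set.range (pullback.fst f (closedPt A)) := by
    rw [mem_range_specialFibre_iff hϖ] at hz₀ ⊢
    rw [toStalk_comp] at hz₀
    rw [← IsLocalRing.maximalIdeal_comap (j.stalkMap z₀).hom]
    exact hz₀
  obtain ⟨a, ha⟩ := hp (j z₀)
  obtain ⟨r, C, t, -, -, -, ht, -⟩ := exists_parameters_of_meetsStrata hX hs hx ⟨z₀, rfl⟩ ha
  have hreg := hX.regular (j z₀)
  have hreg' := hX.regular (j z)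
  have hpa := ht.inr
  have hdom := IsRegularLocalRing.isDomain (X.presheaf.stalk (j z₀))
  have hz' : j z ⤳ j z₀ := hz.map j.continuous
  have h1 := stalkIdeal_map_stalkSpecializes j.ker hz'
  rw [ha, Ideal.map_span, Set.image_singleton] at h1
  refine ⟨_, h1.symm, ?_⟩
  have hZ₀ : IsRegularLocalRing (Z.presheaf.stalk z₀) := by
    have := isNoetherianRing_of_surjective _ _ (j.stalkMap z₀).hom (stalkMap_surjective j z₀)
    exact (hpa.sumEmpty.of_surjective (j.stalkMap z₀).hom (stalkMap_surjective j z₀)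
      (by rw [ker_stalkMap, ha, Set.range_const])).1.isRegularLocalRing
  have hZ : IsRegularLocalRing (Z.presheaf.stalk z) := by
    let _ := (Z.presheaf.stalkSpecializes hz).hom.toAlgebra
    have := isLocalization_stalkSpecializes hz
    exact .of_isLocalization_atPrime (genIdeal hz) _
  refine isPartRSP_of_ker_eq_span_singleton _ (stalkMap_surjective j z) ?_
    ((ker_stalkMap j z).trans h1.symm)
  let _ := (X.presheaf.stalkSpecializes hz').hom.toAlgebra
  have := isLocalization_stalkSpecializes hz'
  have hinj := IsLocalization.injective (X.presheaf.stalk (j z))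
    (genIdeal hz').primeCompl_le_nonZeroDivisors
  exact fun h => hpa.ne_zero () (hinj (h.trans (map_zero _).symm))

end GenericFibre

theorem _root_.RingHom.FormallySmooth.of_comp_algebraMap {R K S : Type u} [CommRing R] [CommRing K]
    [CommRing S] [Algebra R K] (M : Submonoid R) [IsLocalization M K] {φ : K →+* S}
    (h : (φ.comp (algebraMap R K)).FormallySmooth) : φ.FormallySmooth := by
  let _ := φ.toAlgebra
  let _ := (φ.comp (algebraMap R K)).toAlgebra
  have : IsScalarTower R K S := .of_algebraMap_eq' rfl
  have : Algebra.FormallySmooth R S := h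
  exact Algebra.FormallySmooth.localization_base (Rₘ := K) M

/-- The unit is absorbed into one of the parameters. -/
theorem _root_.IsPartRSP.exists_prod_eq_unit_mul {R : Type*} [CommRing R] [IsLocalRing R] {ι : Type*}
    [Fintype ι] [Nonempty ι] {t : ι → R} (h : IsPartRSP t) {v : R} (hv : IsUnit v) :
    ∃ t' : ι → R, IsPartRSP t' ∧ Ideal.span (Set.range t') = Ideal.span (Set.range t) ∧
      ∏ i, t' i = v * ∏ i, t i := by
  classical
  obtain ⟨i₀⟩ := ‹Nonempty ι›
  have hs : Ideal.span (Set.range (Function.update t i₀ (v * t i₀))) =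
      Ideal.span (Set.range t) := by
    apply le_antisymm <;> rw [Ideal.span_le] <;> rintro _ ⟨i, rfl⟩
    · by_cases hi : i = i₀
      · subst hi
        rw [Function.update_self]
        exact Ideal.mul_mem_left _ _ (Ideal.subset_span ⟨_, rfl⟩)
      · rw [Function.update_of_ne hi]
        exact Ideal.subset_span ⟨_, rfl⟩
    · by_cases hi : i = i₀
      · subst hi
        rw [SetLike.mem_coe, ← Ideal.unit_mul_mem_iff_mem _ hv]
        exact Ideal.subset_span ⟨i, Function.update_self _ _ _⟩
      · exact Ideal.subset_span ⟨i, Function.update_of_ne hi _ _⟩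
  refine ⟨_, h.congr_span rfl hs.symm, hs, ?_⟩
  rw [Finset.prod_update_of_mem (Finset.mem_univ i₀), mul_assoc,
    ← Finset.prod_erase_mul _ _ (Finset.mem_univ i₀), Finset.sdiff_singleton_eq_erase,
    mul_comm (∏ _ ∈ _, _) (t i₀)]

theorem stalkSpecializes_comp_toStalk {R : Type u} [CommRing R] {X : Scheme.{u}}
    (f : X ⟶ Spec (.of R)) {x y : X} (h : y ⤳ x) :
    (X.presheaf.stalkSpecializes h).hom.comp (toStalk f x) = toStalk f y :=
  congrArg (fun t => RingHom.comp t ((Scheme.ΓSpecIso (.of R)).inv ≫ f.appTop).hom)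
    (germ_comp_stalkSpecializes (U := ⊤) h trivial trivial)

/-! ### Smoothness of the generic fibre of the section. -/

section SmoothGenericFibre

variable {A : Type u} [CommRing A] [IsDomain A] [IsDiscreteValuationRing A]
  {X Z : Scheme.{u}} {f : X ⟶ Spec (.of A)} {j : Z ⟶ X}

/-- Reducedness makes π a unit times the plain product of the parameters at z₀. The quotient by all
of them is the local ring of the smallest stratum cut with Z, smooth by hypothesis; z is a point of
Spec of the local ring at z₀ where π is invertible. -/
theorem formallySmooth_toStalk_of_semistable [IsClosedImmersion j] (hX : IsSemistable f)
    (hs : MeetsStrata f j) (hj : IsRegularDivisor j) {z z₀ : Z} (hz : z ⤳ z₀)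
    (hz₀ : z₀ ∈ Set.range (pullback.fst (j ≫ f) (closedPt A))) {ϖ : A} (hϖ : Irreducible ϖ)
    (hu : IsUnit (toStalk (j ≫ f) z ϖ)) : (toStalk (j ≫ f) z).FormallySmooth := by
  classical
  have := hX.locallyOfFiniteType
  have := hX.reduced
  have hreg := hX.regular (j z₀)
  have hdom := IsRegularLocalRing.isDomain (X.presheaf.stalk (j z₀))
  have hregZ := hj.isRegularScheme hX.regular z₀
  have hmem := (mem_range_specialFibre_iff hϖ z₀).1 hz₀
  have hx : j z₀ ∈ Set.range (pullback.fst f (closedPt A)) := by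
    rw [mem_range_specialFibre_iff hϖ]
    rw [toStalk_comp] at hmem
    rw [← IsLocalRing.maximalIdeal_comap (j.stalkMap z₀).hom]
    exact hmem
  obtain ⟨r, C, t, a, -, hC', ha, ht, hφt, hmin, -, -, hstr⟩ :=
    exists_parameters_of_isRegularDivisor hX.toIsQuasiSemistable hs hj hz₀
  have hspan := span_toStalk_eq_span_prod hϖ hx ht.inl (hmin ϖ hϖ)
  obtain ⟨c, hc⟩ := Ideal.span_singleton_eq_span_singleton.1 hspan.symm
  have hprod : toStalk (j ≫ f) z₀ ϖ =
      (j.stalkMap z₀).hom c * ∏ i, ((j.stalkMap z₀).hom ∘ t) i := by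
    rw [toStalk_comp, RingHom.comp_apply, ← hc, map_mul, map_prod, mul_comm]
    rfl
  have hne : Nonempty (Fin r) := by
    by_contra hne
    rw [not_nonempty_iff] at hne
    rw [hprod, Finset.univ_eq_empty, Finset.prod_empty, mul_one] at hmem
    exact hmem (c.isUnit.map _)
  obtain ⟨s, hsp, hss, hsprod⟩ := hφt.exists_prod_eq_unit_mul (c.isUnit.map (j.stalkMap z₀).hom)
  have hCU : ((Finset.univ.image C : Finset _) : Set (Set (pullback f (closedPt A) : Scheme.{u}))) ⊆
      irreducibleComponents _ := by
    rw [Finset.coe_image]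
    rintro _ ⟨k, -, rfl⟩
    exact hC' k
  obtain ⟨W, k, v, hp, hsm, -⟩ := hs _ (Finset.univ_nonempty.image C) hCU
  have hker := hstr Finset.univ _ Finset.univ_nonempty (Finset.coe_image (f := C))
  obtain ⟨y, hy⟩ : j z₀ ∈ Set.range (stratumToTotal f (Finset.univ.image C)) := by
    rw [mem_range_iff_stalkIdeal, hker, Ideal.span_le]
    rintro _ ⟨i, -, rfl⟩
    exact ht.inl.mem i
  obtain ⟨ω, rfl⟩ := mem_range_of_isPullback hp (y := y) ⟨_, hy.symm⟩
  have : IsClosedImmersion v := MorphismProperty.of_isPullback hp inferInstance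
  have hv : v ω = z₀ := by
    apply j.isClosedEmbedding.injective
    rw [← hy, ← Scheme.Hom.comp_apply, ← Scheme.Hom.comp_apply, hp.w]
  obtain ⟨β, hβ, hβker, hβc⟩ := exists_surjective_stalk v hv
  obtain ⟨n, q, _, φ, hφ, hφc⟩ := exists_localization_surjective (j ≫ f) z₀
  let _ := (Z.presheaf.stalkSpecializes hz).hom.toAlgebra
  have := isLocalization_stalkSpecializes hz
  have hcz : (algebraMap (Z.presheaf.stalk z₀) (Z.presheaf.stalk z)).comp (toStalk (j ≫ f) z₀) =
      toStalk (j ≫ f) z := stalkSpecializes_comp_toStalk _ hz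
  have key := formallySmooth_localization_of_semistable q φ hφ β hβ
    (toStalk (k ≫ stratumι _ _ ≫ pullback.snd f (closedPt A)) ω) ((smooth_iff_toStalk _).1 hsm ω)
    ?_ hϖ s hsp ?_ ?_ (genIdeal hz) ?_ (S' := Z.presheaf.stalk z)
  · rw [hφc, hcz] at key
    exact key
  · rw [RingHom.comp_assoc, hφc, hβc, ← toStalk_SpecMap]
    congr 1
    simp only [Category.assoc, ← pullback.condition]
    exact hp.w_assoc f
  · rw [hβker, hss, stalkIdeal_ker_of_isPullback hp.flip, hker, Ideal.map_span, Finset.coe_univ,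
      Set.image_univ, ← Set.range_comp]
  · rw [hsprod, ← hprod, ← hφc]
    rfl
  · rw [← RingHom.comp_apply, hφc]
    intro h
    have h1 := congrArg (fun t => t ϖ) hcz
    exact (IsLocalRing.mem_maximalIdeal _).1 h ((congrArg IsUnit h1).mpr hu)

theorem smooth_genericFibre_of_semistable [IsClosedImmersion j] [UniversallyClosed f]
    (hX : IsSemistable f) (hs : MeetsStrata f j) (hj : IsRegularDivisor j) {W : Scheme.{u}}
    {w : W ⟶ pullback f (genPt A)} {v : W ⟶ Z} (h : IsPullback w v (pullback.fst f (genPt A)) j) :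
    Smooth (w ≫ pullback.snd f (genPt A)) := by
  have := hX.locallyOfFiniteType
  have : IsClosedImmersion w := MorphismProperty.of_isPullback h.flip inferInstance
  have : IsOpenImmersion v := MorphismProperty.of_isPullback h inferInstance
  have := locallyOfFinitePresentation_of_locallyOfFiniteType (w ≫ pullback.snd f (genPt A))
  rw [smooth_iff_toStalk]
  intro y
  obtain ⟨ϖ, hϖ⟩ := IsDiscreteValuationRing.exists_irreducible A
  obtain ⟨z₀, hz₀, hz⟩ := exists_specializes_specialFibre (j ≫ f) (v y)
  have hc : (v.stalkMap y).hom.comp (toStalk (j ≫ f) (v y)) =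
      (toStalk (w ≫ pullback.snd f (genPt A)) y).comp (algebraMap A (FractionRing A)) := by
    rw [← toStalk_comp, ← toStalk_SpecMap]
    congr 1
    rw [Category.assoc, ← pullback.condition]
    exact (h.w_assoc f).symm
  refine RingHom.FormallySmooth.of_comp_algebraMap (nonZeroDivisors A) ?_
  rw [← hc]
  refine RingHom.FormallySmooth.respectsIso.1 _
    (asIso (v.stalkMap y)).commRingCatIsoToRingEquiv
    (formallySmooth_toStalk_of_semistable hX hs hj hz hz₀ hϖ ?_)
  refine isUnit_of_map_unit (v.stalkMap y).hom _ ?_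
  have := congrArg (fun t => t ϖ) hc
  refine (congrArg IsUnit this).mpr ?_
  have h0 : algebraMap A (FractionRing A) ϖ ≠ 0 := by simpa using hϖ.ne_zero
  exact h0.isUnit.map (toStalk (w ≫ pullback.snd f (genPt A)) y)

theorem smooth_genericFibre_of_charZero [CharZero (FractionRing A)] [IsClosedImmersion j]
    (hX : IsQuasiSemistable f) (hj : IsRegularDivisor j) {W : Scheme.{u}}
    {w : W ⟶ pullback f (genPt A)} {v : W ⟶ Z} (h : IsPullback w v (pullback.fst f (genPt A)) j) :
    Smooth (w ≫ pullback.snd f (genPt A)) := by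
  have := hX.locallyOfFiniteType
  have : IsClosedImmersion w := MorphismProperty.of_isPullback h.flip inferInstance
  exact smooth_of_isRegularScheme _
    ((hj.of_isPullback h).isRegularScheme (hX.regular.of_isOpenImmersion (pullback.fst f (genPt A))))

end SmoothGenericFibre

theorem exists_isPullback_baseChange {X P H S T Y : Scheme.{u}} (i : X ⟶ P) (h : H ⟶ P) (p : P ⟶ S)
    (t : T ⟶ S) {k : Y ⟶ pullback (i ≫ p) t} {m : Y ⟶ pullback p t} (hm : m = k ≫ baseChange i p t) :
    ∃ v, IsPullback (pullback.fst m (baseChange h p t)) v (k ≫ pullback.fst (i ≫ p) t)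
      (pullback.fst i h) := by
  subst hm
  have h1 := (IsPullback.of_hasPullback (k ≫ baseChange i p t) (baseChange h p t)).flip.paste_horiz
    (isPullback_baseChange h p t).flip
  rw [Category.assoc, (isPullback_baseChange i p t).w, ← Category.assoc] at h1
  refine ⟨pullback.lift (pullback.fst _ _ ≫ k ≫ pullback.fst (i ≫ p) t)
    (pullback.snd _ _ ≫ pullback.fst (h ≫ p) t) ?_, ?_⟩
  · rw [h1.w, Category.assoc, Category.assoc]
  · refine (IsPullback.of_right (t := (IsPullback.of_hasPullback i h).flip) ?_
      (pullback.lift_fst _ _ _)).flip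
    rw [pullback.lift_snd]
    exact h1

/-! ### Hyperplane sections and the main theorem. -/

section HyperplaneSections

variable {A : Type u} [CommRing A] [IsDomain A] [IsDiscreteValuationRing A] {X P H : Scheme.{u}}
  {i : X ⟶ P} {h : H ⟶ P} {p : P ⟶ Spec (.of A)}

theorem meetsStrata_of_meetsSmoothly
    (hi : ∀ I : Finset (Set (pullback (i ≫ p) (closedPt A) : Scheme.{u})), I.Nonempty →
      (I : Set (Set (pullback (i ≫ p) (closedPt A) : Scheme.{u}))) ⊆ irreducibleComponents _ →
      MeetsSmoothly (stratumι _ I ≫ baseChange i p (closedPt A)) (baseChange h p (closedPt A))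
        (pullback.snd p (closedPt A))) :
    MeetsStrata (i ≫ p) (pullback.fst i h) := fun I hI hI' => by
  obtain ⟨v, hv⟩ := exists_isPullback_baseChange i h p (closedPt A) (k := stratumι _ I) rfl
  refine ⟨_, _, v, hv, ?_, (hi I hI hI').codim⟩
  have := (hi I hI hI').smooth
  rwa [Category.assoc, pullback.lift_snd] at this

end HyperplaneSections

end Bertini

theorem lemma1 {A : Type u} [CommRing A] [IsDomain A] [IsDiscreteValuationRing A] {N : ℕ}
    {X : Scheme.{u}} (i : X ⟶ Bertini.projSpace A N) [IsImmersion i]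
    (hX : Bertini.IsQuasiSemistable (i ≫ Bertini.projStr A N))
    (φ : (Fin (N + 1) → A) →ₗ[A] (Fin N → A)) (hφ : Function.Surjective φ)
    -- (i): `H_s` meets all `Y_{i_1} ∩ ⋯ ∩ Y_{i_p}` transversally in `ℙ^N_F`
    (hi : ∀ I : Finset (Set (pullback (i ≫ Bertini.projStr A N) (Bertini.closedPt A) :
        Scheme.{u})), I.Nonempty →
      (I : Set (Set (pullback (i ≫ Bertini.projStr A N) (Bertini.closedPt A) :
        Scheme.{u}))) ⊆ irreducibleComponents _ →
      Bertini.MeetsSmoothly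
        (Bertini.stratumι _ I ≫ Bertini.baseChange i (Bertini.projStr A N) (Bertini.closedPt A))
        (Bertini.baseChange (Bertini.hyperplane φ hφ) (Bertini.projStr A N) (Bertini.closedPt A))
        (pullback.snd (Bertini.projStr A N) (Bertini.closedPt A))) :
    -- (ii) implies the assertions on `X · H`
    (Bertini.MeetsRegularly
        (Bertini.baseChange i (Bertini.projStr A N) (Bertini.genPt A))
        (Bertini.baseChange (Bertini.hyperplane φ hφ) (Bertini.projStr A N) (Bertini.genPt A)) →
      Bertini.MeetsRegularly i (Bertini.hyperplane φ hφ) ∧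
      Bertini.IsQuasiSemistable
        (pullback.fst i (Bertini.hyperplane φ hφ) ≫ i ≫ Bertini.projStr A N) ∧
      (Bertini.IsSemistable (i ≫ Bertini.projStr A N) →
        Bertini.IsSemistable
          (pullback.fst i (Bertini.hyperplane φ hφ) ≫ i ≫ Bertini.projStr A N)) ∧
      Bertini.IsSNCDivisor
        ((pullback.fst i (Bertini.hyperplane φ hφ)).ker ⊓
          Bertini.specialFibreRed (i ≫ Bertini.projStr A N))) ∧
    -- if `X` is proper over `A`, then (ii) holds automatically
    (IsProper (i ≫ Bertini.projStr A N) →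
      Bertini.MeetsRegularly
        (Bertini.baseChange i (Bertini.projStr A N) (Bertini.genPt A))
        (Bertini.baseChange (Bertini.hyperplane φ hφ) (Bertini.projStr A N) (Bertini.genPt A)) ∧
      (Bertini.IsSemistable (i ≫ Bertini.projStr A N) ∨ CharZero (FractionRing A) →
        Bertini.MeetsSmoothly
          (Bertini.baseChange i (Bertini.projStr A N) (Bertini.genPt A))
          (Bertini.baseChange (Bertini.hyperplane φ hφ) (Bertini.projStr A N) (Bertini.genPt A))
          (pullback.snd (Bertini.projStr A N) (Bertini.genPt A)))) := by
  have hH := Bertini.isClosedImmersion_hyperplane φ hφ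
  have hs := Bertini.meetsStrata_of_meetsSmoothly hi
  have hp : ∀ x, ∃ a, Bertini.stalkIdeal (pullback.fst i (Bertini.hyperplane φ hφ)).ker x =
      Ideal.span {a} := fun x => by
    obtain ⟨a, ha⟩ := Bertini.exists_stalkIdeal_ker_hyperplane_eq φ hφ (i x)
    refine ⟨(i.stalkMap x).hom a, ?_⟩
    rw [Bertini.stalkIdeal_ker_fst, ha, Ideal.map_span, Set.image_singleton]
  -- Taking the identity for k presents the intersection of the two generic fibres as the
  -- restriction of X·H to the open subscheme X_η.
  obtain ⟨v, hv⟩ := Bertini.exists_isPullback_baseChange i (Bertini.hyperplane φ hφ)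
    (Bertini.projStr A N) (Bertini.genPt A) (k := 𝟙 _) (Category.id_comp _).symm
  rw [Category.id_comp] at hv
  refine ⟨fun hη => ?_, fun hprop => ?_⟩
  · have hj := Bertini.isRegularDivisor_of_generic hX hs hp hv hη.regular hη.codim
    exact ⟨⟨hj.isRegularScheme hX.regular, hj.hasPureCodim hX.regular⟩, hX.of_meetsStrata hs hj,
      fun hX' => hX'.of_meetsStrata hs hj, Bertini.isSNCDivisor_of_meetsStrata hX hs hj⟩
  · have hj := Bertini.isRegularDivisor_of_universallyClosed hX hs hp
    -- Being cut out by a regular parameter restricts to the open generic fibre, which yields (ii).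
    have hw := hj.of_isPullback hv
    have hη := hX.regular.of_isOpenImmersion
      (pullback.fst (i ≫ Bertini.projStr A N) (Bertini.genPt A))
    have : IsClosedImmersion (pullback.fst
        (Bertini.baseChange i (Bertini.projStr A N) (Bertini.genPt A))
        (Bertini.baseChange (Bertini.hyperplane φ hφ) (Bertini.projStr A N) (Bertini.genPt A))) :=
      MorphismProperty.of_isPullback hv.flip inferInstance
    refine ⟨⟨hw.isRegularScheme hη, hw.hasPureCodim hη⟩, fun hor => ⟨?_, hw.hasPureCodim hη⟩⟩
    rw [pullback.lift_snd]
    obtain hX' | hchar := hor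
    · exact Bertini.smooth_genericFibre_of_semistable hX' hs hj hv
    · exact Bertini.smooth_genericFibre_of_charZero hX hj hv
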